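/- Let $\mathfrak g$ be a real split semisimple Lie algebra with split Cartan subalgebra $\mathfrak h$ and simple roots $\Delta$, and let $G(\mathbb C)$ be a connected complex (linear) Lie group with Lie algebra $\mathfrak g_{\mathbb C}=\mathfrak g\otimes\mathbb C$, i.e. a closed connected subgroup of some $GL_n(\mathbb C)$ whose Lie algebra is $\mathfrak g\oplus i\mathfrak g$ with $\mathfrak g\subset\mathfrak{gl}_n(\mathbb C)$ a real form. Let $G\subset G(\mathbb C)$ be the connected Lie subgroup with Lie algebra $\mathfrak g$, and let $K\subset G$ be a maximal compact subgroup that is the fixed point group of an involution $\Theta$ of $G$ whose differential $\theta$ is a Cartan involution of $\mathfrak g$; put $\mathfrak k=\mathfrak g^\theta$. Let $\mathfrak b=\mathfrak h\oplus\bigoplus_{\alpha>0}\mathfrak g_\alpha$, let $B=N_G(\mathfrak b)$ and $B(\mathbb C)=N_{G(\mathbb C)}(\mathfrak b_{\mathbb C})$ be the corresponding Borel subgroups, and let $T=K\cap B$. Let $K(\mathbb C)\subset G(\mathbb C)$ be the complexification of $K$, i.e. the connected subgroup with Lie algebra $\mathfrak k_{\mathbb C}$, and let $\mathcal O_o$ be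 the open dense $K(\mathbb C)$-orbit in the flag manifold $G(\mathbb C)/B(\mathbb C)$. Then $T$ is finite, and: (a) for all $k$, the projection $K\to K/T$ induces an isomorphism $H^k(K/T;\mathbb Q)\cong H^k(K;\mathbb Q)$; (b) for every $K(\mathbb C)$-equivariant local system $\mathcal L$ of one-dimensional rational vector spaces on $\mathcal O_o$ that is not isomorphic to the constant local system, $H^k(\mathcal O_o;\mathcal L)=0$ for all $k$. -/

import Mathlib

open CategoryTheory
open scoped MatrixGroups

attribute [local instance 100] LieRing.ofAssociativeRing

noncomputable section

/-! ## Local systems and singular cohomology with local coefficients -/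

/-- The standard topological `k`-simplex. -/
abbrev TopSimplex (k : ℕ) : Type := stdSimplex ℝ (Fin (k + 1))

/-- The straight path between two points of a standard simplex. -/
def TopSimplex.segment {k : ℕ} (p q : TopSimplex k) : Path p q where
  toFun t := ⟨(1 - (t : ℝ)) • (p : Fin (k + 1) → ℝ) + (t : ℝ) • (q : Fin (k + 1) → ℝ),
    convex_stdSimplex ℝ _ p.2 q.2 (sub_nonneg.2 t.2.2) t.2.1 (sub_add_cancel _ _)⟩
  continuous_toFun := by
    refine Continuous.subtype_mk ?_ _
    fun_prop
  source' := by apply Subtype.ext; simp; rfl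
  target' := by apply Subtype.ext; simp; rfl

/-- The `i`-th face inclusion of the `k`-simplex in the `(k+1)`-simplex. -/
def TopSimplex.face (k : ℕ) (i : Fin (k + 2)) : C(TopSimplex k, TopSimplex (k + 1)) :=
  ⟨stdSimplex.map i.succAbove, stdSimplex.continuous_map _⟩

/-- The zeroth vertex of the `k`-simplex. -/
def TopSimplex.origin (k : ℕ) : TopSimplex k := stdSimplex.vertex 0

/-- A local system of rational vector spaces on `X`: a functor on the fundamental groupoid. -/
abbrev LocalSystem (X : Type) [TopologicalSpace X] : Type 1 :=
  FundamentalGroupoid X ⥤ ModuleCat.{0} ℚ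

namespace LocalSystem

variable {X Y : Type} [TopologicalSpace X] [TopologicalSpace Y]

/-- The constant local system with fibre `ℚ`. -/
abbrev trivial (X : Type) [TopologicalSpace X] : LocalSystem X :=
  (Functor.const _).obj (ModuleCat.of ℚ ℚ)

/-- The fibre of a local system at a point. -/
abbrev fiber (L : LocalSystem X) (x : X) : ModuleCat.{0} ℚ := L.obj ⟨x⟩

/-- Parallel transport along a path. -/
def transport (L : LocalSystem X) {x y : X} (γ : Path x y) : L.fiber x →ₗ[ℚ] L.fiber y :=
  (L.map (FundamentalGroupoid.fromPath (Path.Homotopic.Quotient.mk γ))).hom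

/-- The inverse image of a local system under a continuous map. -/
abbrev pullback (L : LocalSystem Y) (f : C(X, Y)) : LocalSystem X :=
  FundamentalGroupoid.map f ⋙ L

/-- Singular `k`-cochains with coefficients in `L`: a cochain assigns to each singular simplex
`σ` an element of the fibre of `L` at the image of the zeroth vertex. -/
abbrev Cochain (L : LocalSystem X) (k : ℕ) : Type :=
  (σ : C(TopSimplex k, X)) → L.fiber (σ (TopSimplex.origin k))

/-- The coboundary: the alternating sum over the faces of `σ`, where the value on the `i`-th
face is transported inside `σ` to the zeroth vertex of `σ`. -/
def coboundary (L : LocalSystem X) (k : ℕ) : L.Cochain k →ₗ[ℚ] L.Cochain (k + 1) where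
  toFun c σ := ∑ i : Fin (k + 2), (-1 : ℚ) ^ (i : ℕ) •
    L.transport ((TopSimplex.segment (TopSimplex.face k i (TopSimplex.origin k))
      (TopSimplex.origin (k + 1))).map σ.continuous) (c (σ.comp (TopSimplex.face k i)))
  map_add' c c' := by
    funext σ
    simp only [Pi.add_apply, map_add, smul_add, Finset.sum_add_distrib]
  map_smul' r c := by
    funext σ
    simp only [Pi.smul_apply, map_smul, Finset.smul_sum, RingHom.id_apply]
    exact Finset.sum_congr rfl fun i _ => smul_comm _ _ _

/-- The space of coboundaries in degree `k`. -/
def coboundaries (L : LocalSystem X) : (k : ℕ) → Submodule ℚ (L.Cochain k)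
  | 0 => ⊥
  | k + 1 => LinearMap.range (L.coboundary k)

/-- The space of cocycles in degree `k`. -/
def cocycles (L : LocalSystem X) (k : ℕ) : Submodule ℚ (L.Cochain k) :=
  LinearMap.ker (L.coboundary k)

/-- Singular cohomology with coefficients in a local system: cocycles modulo coboundaries. -/
abbrev Cohomology (L : LocalSystem X) (k : ℕ) : Type :=
  L.cocycles k ⧸ (L.coboundaries k).comap (L.cocycles k).subtype

/-- Pull-back of cochains. -/
def cochainMap (L : LocalSystem Y) (f : C(X, Y)) (k : ℕ) :
    L.Cochain k →ₗ[ℚ] (L.pullback f).Cochain k where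
  toFun c σ := c (f.comp σ)
  map_add' _ _ := rfl
  map_smul' _ _ := rfl

lemma transport_pullback (L : LocalSystem Y) (f : C(X, Y)) {x y : X} (γ : Path x y)
    (v : L.fiber (f x)) : (L.pullback f).transport γ v = L.transport (γ.map f.continuous) v :=
  rfl

lemma coboundary_cochainMap (L : LocalSystem Y) (f : C(X, Y)) (k : ℕ) (c : L.Cochain k) :
    (L.pullback f).coboundary k (L.cochainMap f k c) =
      L.cochainMap f (k + 1) (L.coboundary k c) := by
  funext σ
  rfl

lemma cochainMap_mem_coboundaries (L : LocalSystem Y) (f : C(X, Y)) :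
    ∀ (k : ℕ) (c : L.Cochain k), c ∈ L.coboundaries k →
      L.cochainMap f k c ∈ (L.pullback f).coboundaries k
  | 0, c, hc => by
      have h : c = 0 := hc
      rw [h, map_zero]
      exact Submodule.zero_mem _
  | k + 1, c, hc => by
      obtain ⟨b, rfl⟩ := hc
      exact ⟨L.cochainMap f k b, L.coboundary_cochainMap f k b⟩

/-- Pull-back of cocycles. -/
def cocycleMap (L : LocalSystem Y) (f : C(X, Y)) (k : ℕ) :
    L.cocycles k →ₗ[ℚ] (L.pullback f).cocycles k :=
  (L.cochainMap f k).restrict fun c hc => by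
    have h : L.coboundary k c = 0 := hc
    change (L.pullback f).coboundary k (L.cochainMap f k c) = 0
    rw [L.coboundary_cochainMap, h, map_zero]

/-- The map `f^* : H^k(Y; L) → H^k(X; f^* L)`. -/
def cohomologyMap (L : LocalSystem Y) (f : C(X, Y)) (k : ℕ) :
    L.Cohomology k →ₗ[ℚ] (L.pullback f).Cohomology k :=
  Submodule.mapQ _ _ (L.cocycleMap f k) fun _ hc => L.cochainMap_mem_coboundaries f k _ hc

/-- An equivariant structure on a local system `L` on a space `X` with a continuous action of a
topological group `Γ`: an isomorphism between the inverse images of `L` under the projection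
and the action `Γ × X → X` (that is, linear isomorphisms `L_x → L_{g • x}` which are compatible
with transport along all paths in `Γ × X`) that satisfies the unit and cocycle conditions. -/
structure EquivariantStructure (Γ : Type) [TopologicalSpace Γ] [Group Γ] [MulAction Γ X]
    [ContinuousSMul Γ X] (L : LocalSystem X) where
  act (g : Γ) (x : X) : L.fiber x ≃ₗ[ℚ] L.fiber (g • x)
  act_transport {g g' : Γ} {x y : X} (γ : Path g g') (δ : Path x y) (v : L.fiber x) :
    act g' y (L.transport δ v) =
      L.transport ((γ.prod δ).map (f := fun p : Γ × X => p.1 • p.2) continuous_smul) (act g x v)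
  act_one (x : X) (v : L.fiber x) :
    act 1 x v = L.transport ((Path.refl x).cast rfl (one_smul Γ x)) v
  act_mul (g h : Γ) (x : X) (v : L.fiber x) :
    act (g * h) x v =
      L.transport ((Path.refl (g • h • x)).cast rfl (mul_smul g h x)) (act g (h • x) (act h x v))

end LocalSystem

/-- The rational singular cohomology of `X`. -/
abbrev RationalCohomology (X : Type) [TopologicalSpace X] (k : ℕ) : Type :=
  (LocalSystem.trivial X).Cohomology k

/-- The map induced by `f` in rational singular cohomology. -/
def RationalCohomology.map {X Y : Type} [TopologicalSpace X] [TopologicalSpace Y] (f : C(X, Y))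
    (k : ℕ) : RationalCohomology Y k →ₗ[ℚ] RationalCohomology X k :=
  (LocalSystem.trivial Y).cohomologyMap f k

/-- The action of a subgroup by left translations on a coset space is continuous. -/
instance quotient_continuousSMul {Γ : Type} [TopologicalSpace Γ] [Group Γ] [IsTopologicalGroup Γ]
    (B H : Subgroup Γ) : ContinuousSMul H (Γ ⧸ B) :=
  Subgroup.continuousSMul

/-- The action of a group on an orbit in a space with continuous action is continuous. -/
instance orbit_continuousSMul {Γ X : Type} [TopologicalSpace Γ] [Group Γ] [TopologicalSpace X]
    [MulAction Γ X] [ContinuousSMul Γ X] (x : X) : ContinuousSMul Γ (MulAction.orbit Γ x) where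
  continuous_smul := by
    refine Continuous.subtype_mk (f := fun p : Γ × MulAction.orbit Γ x => p.1 • (p.2 : X)) ?_ _
    fun_prop

/-! ## Linear Lie groups -/

/-- Complex `n × n` matrices. -/
abbrev CMat (n : ℕ) : Type := Matrix (Fin n) (Fin n) ℂ

/-- The exponential of a matrix, as an invertible matrix. -/
def expGL {n : ℕ} (X : CMat n) : GL (Fin n) ℂ := (Matrix.isUnit_exp X).unit

/-- The connected Lie subgroup of `GL(n, ℂ)` that belongs to a Lie algebra `S` of matrices: the
subgroup generated by the exponentials of the elements of `S`. -/
def analyticSubgroup {n : ℕ} (S : Set (CMat n)) : Subgroup (GL (Fin n) ℂ) :=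
  Subgroup.closure (expGL '' S)

/-- The subgroup of those `g` whose adjoint action `X ↦ g X g⁻¹` maps `S` onto itself. -/
def adNormalizer {n : ℕ} (S : Set (CMat n)) : Subgroup (GL (Fin n) ℂ) where
  carrier := {g | ∀ X : CMat n, X ∈ S ↔ (g : CMat n) * X * ((g⁻¹ : GL (Fin n) ℂ) : CMat n) ∈ S}
  one_mem' := by simp
  mul_mem' := by
    intro g h hg hh X
    rw [hh X, hg]
    simp only [mul_inv_rev, Units.val_mul, mul_assoc]
  inv_mem' := by
    intro g hg X
    rw [hg (_ * X * _)]
    simp [mul_assoc]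

/-- The complex span of a set of matrices. -/
abbrev complexSpan {n : ℕ} (S : Set (CMat n)) : Submodule ℂ (CMat n) := Submodule.span ℂ S

/-- `G` is a connected complex Lie group with Lie algebra the complexification of `𝔤`: a closed
connected subgroup of `GL(n, ℂ)` whose Lie algebra is `𝔤 ⊕ i𝔤`. -/
structure IsComplexGroupOf {n : ℕ} (𝔤 : LieSubalgebra ℝ (CMat n))
    (G : Subgroup (GL (Fin n) ℂ)) : Prop where
  isClosed : IsClosed (G : Set (GL (Fin n) ℂ))
  isConnected : IsConnected (G : Set (GL (Fin n) ℂ))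
  real_form : ∀ X ∈ 𝔤, Complex.I • X ∈ 𝔤 → X = 0
  lieAlgebra : ∀ Z : CMat n, (∀ t : ℝ, expGL (t • Z) ∈ G) ↔ Z ∈ complexSpan (𝔤 : Set (CMat n))

/-- The real group `G`: the connected Lie subgroup with Lie algebra `𝔤`. -/
def realGroup {n : ℕ} (𝔤 : LieSubalgebra ℝ (CMat n)) : Subgroup (GL (Fin n) ℂ) :=
  analyticSubgroup (𝔤 : Set (CMat n))

/-- The exponential map `𝔤 → G`. -/
def realExp {n : ℕ} {𝔤 : LieSubalgebra ℝ (CMat n)} (X : 𝔤) : realGroup 𝔤 :=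
  ⟨expGL X, Subgroup.subset_closure ⟨X, X.2, rfl⟩⟩

/-- A Cartan involution of a real semisimple Lie algebra: an involutive automorphism `θ` such
that the form `-κ(X, θ X)` is positive definite, where `κ` is the Killing form. -/
structure IsCartanInvolution {L : Type} [LieRing L] [LieAlgebra ℝ L] (θ : L ≃ₗ⁅ℝ⁆ L) : Prop where
  involutive : ∀ X, θ (θ X) = X
  negative : ∀ X, X ≠ 0 → killingForm ℝ L X (θ X) < 0

/-- `K` is a maximal compact subgroup of `G`. -/
structure IsMaximalCompactSubgroup {n : ℕ} (K G : Subgroup (GL (Fin n) ℂ)) : Prop where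
  le : K ≤ G
  isCompact : IsCompact (K : Set (GL (Fin n) ℂ))
  maximal : ∀ K' : Subgroup (GL (Fin n) ℂ), K ≤ K' → K' ≤ G →
    IsCompact (K' : Set (GL (Fin n) ℂ)) → K' = K

/-- `𝔨`, the fixed points of `θ` in `𝔤`, as a set of matrices. -/
def fixedLie {n : ℕ} {𝔤 : LieSubalgebra ℝ (CMat n)} (θ : 𝔤 ≃ₗ⁅ℝ⁆ 𝔤) : Set (CMat n) :=
  {X | ∃ Y : 𝔤, θ Y = Y ∧ (Y : CMat n) = X}

/-- The subgroup of fixed points of an endomorphism `Θ` of the real group. -/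
def fixedGroup {n : ℕ} {𝔤 : LieSubalgebra ℝ (CMat n)} (Θ : realGroup 𝔤 →* realGroup 𝔤) :
    Subgroup (GL (Fin n) ℂ) :=
  (Θ.eqLocus (MonoidHom.id _)).map (realGroup 𝔤).subtype

section Borel

variable {n : ℕ} {𝔤 : LieSubalgebra ℝ (CMat n)} [LieAlgebra.IsKilling ℝ 𝔤]
  (𝔥 : LieSubalgebra ℝ 𝔤) [𝔥.IsCartanSubalgebra] [LieModule.IsTriangularizable ℝ 𝔥 𝔤]
  (Δ : (LieAlgebra.IsKilling.rootSystem 𝔥).Base)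

/-- The Borel subalgebra `𝔟 = 𝔥 ⊕ 𝔫` of `𝔤`, with `𝔫` the sum of the root spaces of the roots
that are positive for the base `Δ`. -/
def borelSubalgebra : Submodule ℝ 𝔤 :=
  𝔥.toSubmodule ⊔
    ⨆ α : {α : 𝔥.root // Δ.IsPos α}, (LieAlgebra.rootSpace 𝔥 (α.1 : 𝔥 → ℝ)).toSubmodule

/-- `𝔟` as a set of matrices. -/
def borelSet : Set (CMat n) := (fun X : 𝔤 => (X : CMat n)) '' (borelSubalgebra 𝔥 Δ : Set 𝔤)

/-- The Borel subgroup `B` of the real group `G`, the normalizer of `𝔟` in `G`. -/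
def realBorel : Subgroup (GL (Fin n) ℂ) := realGroup 𝔤 ⊓ adNormalizer (borelSet 𝔥 Δ)

/-- The finite group `T = K ∩ B`, as a subgroup of `K`. -/
def torusPart (K : Subgroup (GL (Fin n) ℂ)) : Subgroup K := (realBorel 𝔥 Δ).subgroupOf K

/-- The Borel subgroup `B(ℂ)` of `G(ℂ)`, the normalizer of `𝔟 ⊕ i𝔟` in `G(ℂ)`. -/
def complexBorel (Gc : Subgroup (GL (Fin n) ℂ)) : Subgroup Gc :=
  (adNormalizer (complexSpan (borelSet 𝔥 Δ) : Set (CMat n))).subgroupOf Gc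

end Borel

/-- `K(ℂ)`, the complexification of `K`: the connected Lie subgroup of `G(ℂ)` with Lie algebra
`𝔨 ⊕ i𝔨`. -/
def complexK {n : ℕ} {𝔤 : LieSubalgebra ℝ (CMat n)} (θ : 𝔤 ≃ₗ⁅ℝ⁆ 𝔤)
    (Gc : Subgroup (GL (Fin n) ℂ)) : Subgroup Gc :=
  (analyticSubgroup (complexSpan (fixedLie θ) : Set (CMat n))).subgroupOf Gc

/-- The projection `K → K/T`. -/
def quotientMap {Γ : Type} [TopologicalSpace Γ] [Group Γ] (T : Subgroup Γ) : C(Γ, Γ ⧸ T) :=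
  ⟨fun g => (g : Γ ⧸ T), continuous_quot_mk⟩

end

/-!
Everything is reduced to finite covering spaces of path connected groups.

*Topology.* Let `Γ` be a path connected group and `S` a finite subgroup. The projection `Γ → Γ / S`
is a regular covering, so the transfer makes the pull-back injective in rational cohomology, and its
image consists of the classes invariant under right translation by `S`. Right translations are
homotopic to the identity, so all classes are invariant: `bijective_cohomology_quotientMap`. For an
equivariant local system of rank one on a homogeneous space with finite stabilizer `S`, the group
action trivializes the inverse image on `Γ`, and right translation by `s ∈ S` multiplies the classes
that come from the homogeneous space by the value at `s` of the isotropy character. If the character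
is nontrivial these classes vanish; if it is trivial, the local system is constant:
`LocalSystem.EquivariantStructure.subsingleton_cohomology`.

It remains to see that `K` and `K(ℂ)` are path connected, that `T` and the stabilizer in `K(ℂ)` of a
point of the dense orbit are finite, and that the orbit map of `K(ℂ)` is open.

*Lie algebra.* Write `𝔨` and `𝔭` for the eigenspaces of `θ`. The Killing form is negative definite
on `𝔨` and positive semidefinite on `𝔟`, and the orthogonal of `𝔟` lies in `𝔟`; hence `𝔨 ∩ 𝔟 = 0`
and `𝔨 + 𝔟 = 𝔤`. The first fact shows that an element normalizing `𝔨`, `𝔭` and `𝔟` is zero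
(`IsCartanInvolution.eq_zero_of_normalizes`), the second that the orbit of the base point of the
flag manifold under `K(ℂ)` is open, so that it is the dense orbit.

*Finiteness.* The subgroup of `G(ℂ)` normalizing the complexifications of `𝔨`, `𝔭` and `𝔟` is
closed and contains no one-parameter subgroup, so it meets compact sets in finite sets
(`finite_borelNormalizer_inter`). It contains `T`, which lies in the compact group `K`. It also
contains the stabilizer of the base point in `K(ℂ)`, so this stabilizer has to be shown to lie in a
compact set. Take a Hermitian form preserved by `K`, with adjoint `†`. On `K(ℂ)` the automorphism
`s ↦ (s†)⁻¹` induces the complex conjugation of `𝔤 ⊗ ℂ`, so it preserves the stabilizer. For `s` in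
the stabilizer the positive operator `s† s` has a logarithm that normalizes `𝔨`, `𝔭` and `𝔟`, hence
commutes with `𝔤`; on each eigenspace of `s† s` the semisimple group acts with determinant one,
which forces the eigenvalue to be one. Thus `s` is unitary
(`finite_analyticSubgroup_inter_adNormalizer`).

*Connectedness of `K`.* The Cartan decomposition gives `G ⊆ M exp 𝔭`, with unique factors, where `M`
is the group of the elements of `G(ℂ)` whose adjoint action preserves `𝔤` and commutes with `θ`. Its
Lie algebra is `𝔨`, so the subgroup `K₀` generated by `exp 𝔨` is open and closed in `M`. As
multiplication by `exp 𝔭` preserves closed subsets of `M`, the connected group `G` lies in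
`K₀ exp 𝔭`, and therefore `K = K₀` (`pathConnectedSpace_fixedGroup`).
-/

noncomputable section

/-! ### Homotopy invariance of rational singular cohomology -/

/-- In the coboundary of the constant local system all transports are identities. -/
lemma trivial_coboundary_apply {X : Type} [TopologicalSpace X] (k : ℕ)
    (c : C(TopSimplex k, X) → ℚ) (σ : C(TopSimplex (k + 1), X)) :
    (LocalSystem.trivial X).coboundary k c σ =
      ∑ i : Fin (k + 2), (-1 : ℚ) ^ (i : ℕ) * c (σ.comp (TopSimplex.face k i)) := rfl

/-- Cancellation in the boundary of the prism operator: `b j i` stands for the value on the `j`-th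
face of the `i`-th prism simplex, `a i j` for the value on the `i`-th prism simplex over the `j`-th
face. -/
lemma prism_sum (n : ℕ) (a : Fin (n + 1) → Fin (n + 2) → ℚ) (b : Fin (n + 3) → Fin (n + 2) → ℚ)
    (h₁ : ∀ (i : Fin (n + 1)) (j : Fin (n + 2)), i.castSucc < j → b j.succ i.castSucc = a i j)
    (h₂ : ∀ (i : Fin (n + 1)) (j : Fin (n + 2)), j ≤ i.castSucc → b j.castSucc i.succ = a i j)
    (h₃ : ∀ i : Fin (n + 1), b i.castSucc.succ i.castSucc = b i.succ.castSucc i.succ) :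
    ∑ j : Fin (n + 2), (-1 : ℚ) ^ (j : ℕ) * ∑ i : Fin (n + 1), (-1 : ℚ) ^ (i : ℕ) * a i j +
      ∑ i : Fin (n + 2), (-1 : ℚ) ^ (i : ℕ) * ∑ j : Fin (n + 3), (-1 : ℚ) ^ (j : ℕ) * b j i =
    b 0 0 - b (Fin.last _) (Fin.last _) := by
  have split (i : Fin (n + 2)) (j : Fin (n + 3)) : (-1 : ℚ) ^ (i : ℕ) * ((-1 : ℚ) ^ (j : ℕ) * b j i)
      = ((if (j : ℕ) < i then (-1 : ℚ) ^ (i : ℕ) * ((-1 : ℚ) ^ (j : ℕ) * b j i) else 0)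
      + (if (i : ℕ) + 1 < j then (-1 : ℚ) ^ (i : ℕ) * ((-1 : ℚ) ^ (j : ℕ) * b j i) else 0))
      + ((if j = i.castSucc then b i.castSucc i else 0) -
        (if j = i.succ then b i.succ i else 0)) := by
    rcases lt_trichotomy (j : ℕ) i with h | h | h
    · have e1 : j ≠ i.castSucc := by rintro rfl; simp at h
      have e2 : j ≠ i.succ := by rintro rfl; simp at h
      rw [if_pos h, if_neg (by omega), if_neg e1, if_neg e2]; ring
    · obtain rfl : j = i.castSucc := Fin.ext h
      have e2 : i.castSucc ≠ i.succ := by intro h; simp [Fin.ext_iff] at h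
      rw [if_neg (by omega), if_neg (by omega), if_pos rfl, if_neg e2, ← mul_assoc, ← pow_add]
      simp
    · rcases Nat.lt_or_ge ((i : ℕ) + 1) j with h' | h'
      · have e1 : j ≠ i.castSucc := by rintro rfl; simp at h
        have e2 : j ≠ i.succ := by rintro rfl; simp at h'
        rw [if_neg (by omega), if_pos h', if_neg e1, if_neg e2]; ring
      · obtain rfl : j = i.succ := Fin.ext (by simp; omega)
        have e2 : i.succ ≠ i.castSucc := by intro h; simp [Fin.ext_iff] at h
        rw [if_neg (by omega), if_neg (by omega), if_neg e2, if_pos rfl, ← mul_assoc, ← pow_add]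
        simp
  have hdiag : ∑ i : Fin (n + 2), (b i.castSucc i - b i.succ i) =
      b 0 0 - b (Fin.last _) (Fin.last _) := by
    rw [Finset.sum_sub_distrib, Fin.sum_univ_succ, Fin.sum_univ_castSucc (fun i => b i.succ i)]
    simp only [h₃, Fin.castSucc_zero, Fin.succ_last]
    ring
  have hsum : ∑ i : Fin (n + 2), (-1 : ℚ) ^ (i : ℕ) * ∑ j : Fin (n + 3), (-1 : ℚ) ^ (j : ℕ) * b j i
      = _ := Finset.sum_congr rfl fun i _ =>
    (Finset.mul_sum _ _ _).trans (Finset.sum_congr rfl fun j _ => split i j)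
  rw [hsum]
  simp only [Finset.mul_sum]
  simp only [Finset.sum_add_distrib]
  rw [← hdiag]
  simp only [Finset.sum_sub_distrib, Finset.sum_ite_eq', Finset.mem_univ, if_true]
  rw [← add_assoc]
  convert zero_add _ using 2
  rw [Fin.sum_univ_succ (fun i : Fin (n + 2) => ∑ j : Fin (n + 3),
    if (j : ℕ) < i then (-1 : ℚ) ^ (i : ℕ) * ((-1 : ℚ) ^ (j : ℕ) * b j i) else 0),
    Fin.sum_univ_castSucc (fun i : Fin (n + 2) => ∑ j : Fin (n + 3),
    if (i : ℕ) + 1 < j then (-1 : ℚ) ^ (i : ℕ) * ((-1 : ℚ) ^ (j : ℕ) * b j i) else 0)]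
  rw [Finset.sum_eq_zero (s := Finset.univ)
    (f := fun j : Fin (n + 3) => if (j : ℕ) < (0 : Fin (n + 2)) then _ else _) (by simp),
    Finset.sum_eq_zero (s := Finset.univ) (f := fun j : Fin (n + 3) =>
    if (Fin.last (n + 1) : ℕ) + 1 < j then _ else _) (by
      intro j _; rw [if_neg]; have := j.2; simp; omega), zero_add, add_zero, Finset.sum_comm,
      ← Finset.sum_add_distrib, ← Finset.sum_add_distrib]
  refine Finset.sum_eq_zero fun i _ => ?_
  rw [Fin.sum_univ_castSucc (n := n + 2), if_neg (by simp; omega), Fin.sum_univ_succ (n := n + 2),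
    if_neg (by simp), zero_add, add_zero, ← Finset.sum_add_distrib, ← Finset.sum_add_distrib]
  refine Finset.sum_eq_zero fun j _ => ?_
  rcases le_or_gt j i.castSucc with h | h
  · have h' : (j : ℕ) ≤ i := h
    rw [if_pos (by simp; omega), if_neg (by simp; omega), h₂ i j h]
    simp [pow_succ]; ring
  · have h' : (i : ℕ) < j := h
    rw [if_neg (by simp; omega), if_pos (by simp; omega), h₁ i j h]
    simp [pow_succ]; ring

/-- The map of simplices induced by a map of vertices. -/
def TopSimplex.map {k l : ℕ} (f : Fin (k + 1) → Fin (l + 1)) : C(TopSimplex k, TopSimplex l) :=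
  ⟨stdSimplex.map f, stdSimplex.continuous_map _⟩

lemma TopSimplex.map_comp_face {k l : ℕ} (f : Fin (k + 2) → Fin (l + 1)) (i : Fin (k + 2)) :
    (TopSimplex.map f).comp (TopSimplex.face k i) = TopSimplex.map (f ∘ i.succAbove) := by
  ext1 x
  exact stdSimplex.map_comp_apply _ _ _

lemma TopSimplex.face_comp_map {k l : ℕ} (f : Fin (k + 1) → Fin (l + 1)) (i : Fin (l + 2)) :
    (TopSimplex.face l i).comp (TopSimplex.map f) = TopSimplex.map (i.succAbove ∘ f) := by
  ext1 x
  exact stdSimplex.map_comp_apply _ _ _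

/-- The coordinate on the `1`-simplex which is `0` at the first vertex and `1` at the second. -/
def TopSimplex.toUnitInterval : C(TopSimplex 1, unitInterval) :=
  ⟨fun x => ⟨x.1 1, x.2.1 1, by
      have := x.2.2; have := x.2.1 0; simp [Fin.sum_univ_two] at *; linarith⟩,
    by
      refine Continuous.subtype_mk ?_ _
      exact (continuous_apply 1).comp continuous_subtype_val⟩

lemma Fin.val_succAbove {k : ℕ} (j : Fin (k + 1)) (m : Fin k) :
    (j.succAbove m : ℕ) = if (m : ℕ) < j then (m : ℕ) else m + 1 := by
  simp only [Fin.succAbove, Fin.lt_def, Fin.val_castSucc]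
  split_ifs <;> simp

/-- The degeneracy that repeats the vertex `i`. -/
def prismVertex {k : ℕ} (i : Fin (k + 1)) (j : Fin (k + 2)) : Fin (k + 1) := i.predAbove j

/-- The height of the vertex `j` of the `i`-th simplex of the prism. -/
def prismHeight {k : ℕ} (i : Fin (k + 1)) (j : Fin (k + 2)) : Fin 2 :=
  if i.castSucc < j then 1 else 0

lemma val_prismVertex {k : ℕ} (i : Fin (k + 1)) (j : Fin (k + 2)) :
    (prismVertex i j : ℕ) = if (i : ℕ) < j then (j : ℕ) - 1 else j := by
  simp only [prismVertex, Fin.predAbove, Fin.lt_def, Fin.val_castSucc]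
  split_ifs <;> simp

lemma val_prismHeight {k : ℕ} (i : Fin (k + 1)) (j : Fin (k + 2)) :
    (prismHeight i j : ℕ) = if (i : ℕ) < j then 1 else 0 := by
  simp only [prismHeight, Fin.lt_def, Fin.val_castSucc]
  split_ifs <;> simp

/-- The `i`-th singular simplex in the prism over `σ`, mapped by a homotopy. -/
def prismSimplex {X Y : Type} [TopologicalSpace X] [TopologicalSpace Y] {f g : C(X, Y)}
    (F : f.Homotopy g) {k : ℕ} (i : Fin (k + 1)) (σ : C(TopSimplex k, X)) :
    C(TopSimplex (k + 1), Y) :=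
  F.toContinuousMap.comp ((TopSimplex.toUnitInterval.comp (TopSimplex.map (prismHeight i))).prodMk
    (σ.comp (TopSimplex.map (prismVertex i))))

section Prism

variable {X Y : Type} [TopologicalSpace X] [TopologicalSpace Y] {f g : C(X, Y)}
    (F : f.Homotopy g) {k : ℕ}

lemma prismSimplex_face (i : Fin (k + 1)) (j : Fin (k + 2)) (σ : C(TopSimplex k, X)) :
    (prismSimplex F i σ).comp (TopSimplex.face k j) = F.toContinuousMap.comp
      ((TopSimplex.toUnitInterval.comp (TopSimplex.map (prismHeight i ∘ j.succAbove))).prodMk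
      (σ.comp (TopSimplex.map (prismVertex i ∘ j.succAbove)))) := by
  rw [← TopSimplex.map_comp_face, ← TopSimplex.map_comp_face]
  rfl

lemma prismSimplex_comp_face (i : Fin (k + 1)) (j : Fin (k + 2)) (σ : C(TopSimplex (k + 1), X)) :
    prismSimplex F i (σ.comp (TopSimplex.face k j)) = F.toContinuousMap.comp
      ((TopSimplex.toUnitInterval.comp (TopSimplex.map (prismHeight i))).prodMk
      (σ.comp (TopSimplex.map (j.succAbove ∘ prismVertex i)))) := by
  rw [← TopSimplex.face_comp_map]
  rfl

lemma prismSimplex_face_of_lt (i : Fin (k + 1)) (j : Fin (k + 2)) (h : i.castSucc < j)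
    (σ : C(TopSimplex (k + 1), X)) :
    (prismSimplex F i.castSucc σ).comp (TopSimplex.face (k + 1) j.succ) =
      prismSimplex F i (σ.comp (TopSimplex.face k j)) := by
  rw [prismSimplex_face, prismSimplex_comp_face]
  rw [Fin.lt_def, Fin.val_castSucc] at h
  have h1 : prismHeight i.castSucc ∘ j.succ.succAbove = prismHeight i := by
    funext m
    apply Fin.ext
    simp only [Function.comp_apply, val_prismHeight, Fin.val_succAbove,
      Fin.val_succ, Fin.val_castSucc]
    split_ifs <;> omega
  have h2 : prismVertex i.castSucc ∘ j.succ.succAbove = j.succAbove ∘ prismVertex i := by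
    funext m
    apply Fin.ext
    simp only [Function.comp_apply, val_prismVertex, Fin.val_succAbove,
      Fin.val_succ, Fin.val_castSucc]
    split_ifs <;> omega
  rw [h1, h2]

lemma prismSimplex_face_of_le (i : Fin (k + 1)) (j : Fin (k + 2)) (h : j ≤ i.castSucc)
    (σ : C(TopSimplex (k + 1), X)) :
    (prismSimplex F i.succ σ).comp (TopSimplex.face (k + 1) j.castSucc) =
      prismSimplex F i (σ.comp (TopSimplex.face k j)) := by
  rw [prismSimplex_face, prismSimplex_comp_face]
  rw [Fin.le_def, Fin.val_castSucc] at h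
  have h1 : prismHeight i.succ ∘ j.castSucc.succAbove = prismHeight i := by
    funext m
    apply Fin.ext
    simp only [Function.comp_apply, val_prismHeight, Fin.val_succAbove,
      Fin.val_succ, Fin.val_castSucc]
    split_ifs <;> omega
  have h2 : prismVertex i.succ ∘ j.castSucc.succAbove = j.succAbove ∘ prismVertex i := by
    funext m
    apply Fin.ext
    simp only [Function.comp_apply, val_prismVertex, Fin.val_succAbove,
      Fin.val_succ, Fin.val_castSucc]
    split_ifs <;> omega
  rw [h1, h2]

lemma prismSimplex_face_middle (i : Fin (k + 1)) (σ : C(TopSimplex (k + 1), X)) :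
    (prismSimplex F i.castSucc σ).comp (TopSimplex.face (k + 1) i.castSucc.succ) =
      (prismSimplex F i.succ σ).comp (TopSimplex.face (k + 1) i.succ.castSucc) := by
  rw [prismSimplex_face, prismSimplex_face]
  have h1 : prismHeight i.castSucc ∘ i.castSucc.succ.succAbove =
      prismHeight i.succ ∘ i.succ.castSucc.succAbove := by
    funext m
    apply Fin.ext
    simp only [Function.comp_apply, val_prismHeight, Fin.val_succAbove,
      Fin.val_succ, Fin.val_castSucc]
    split_ifs <;> omega
  have h2 : prismVertex i.castSucc ∘ i.castSucc.succ.succAbove =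
      prismVertex i.succ ∘ i.succ.castSucc.succAbove := by
    funext m
    apply Fin.ext
    simp only [Function.comp_apply, val_prismVertex, Fin.val_succAbove,
      Fin.val_succ, Fin.val_castSucc]
    split_ifs <;> omega
  rw [h1, h2]

lemma prismSimplex_face_zero (σ : C(TopSimplex k, X)) :
    (prismSimplex F 0 σ).comp (TopSimplex.face k 0) = g.comp σ := by
  rw [prismSimplex_face]
  have h1 : (prismVertex (0 : Fin (k + 1))) ∘ Fin.succAbove 0 = id := by
    funext m; simp [prismVertex]
  have h2 : (prismHeight (0 : Fin (k + 1))) ∘ Fin.succAbove 0 = fun _ => 1 := by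
    funext m; simp [prismHeight]
  rw [h1, h2]
  ext x
  have e1 : TopSimplex.map (id : Fin (k + 1) → Fin (k + 1)) x = x := stdSimplex.map_id_apply x
  have e2 : TopSimplex.toUnitInterval (TopSimplex.map (fun _ : Fin (k + 1) => (1 : Fin 2)) x) =
      1 := by
    apply Subtype.ext
    change (stdSimplex.map (fun _ => (1 : Fin 2)) x : Fin 2 → ℝ) 1 = 1
    simp [stdSimplex.map_coe, FunOnFinite.linearMap_apply_apply]
  change F (TopSimplex.toUnitInterval _, σ (TopSimplex.map _ _)) = _
  rw [e1, e2, F.apply_one]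
  rfl

lemma prismSimplex_face_last (σ : C(TopSimplex k, X)) :
    (prismSimplex F (Fin.last k) σ).comp (TopSimplex.face k (Fin.last _)) = f.comp σ := by
  rw [prismSimplex_face]
  have h1 : (prismVertex (Fin.last k)) ∘ Fin.succAbove (Fin.last _) = id := by
    funext m; simp [prismVertex]
  have h2 : (prismHeight (Fin.last k)) ∘ Fin.succAbove (Fin.last _) = fun _ => 0 := by
    funext m; simp [prismHeight, Fin.lt_def]; omega
  rw [h1, h2]
  ext x
  have e1 : TopSimplex.map (id : Fin (k + 1) → Fin (k + 1)) x = x := stdSimplex.map_id_apply x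
  have e2 : TopSimplex.toUnitInterval (TopSimplex.map (fun _ : Fin (k + 1) => (0 : Fin 2)) x) =
      0 := by
    apply Subtype.ext
    change (stdSimplex.map (fun _ => (0 : Fin 2)) x : Fin 2 → ℝ) 1 = 0
    simp [stdSimplex.map_coe, FunOnFinite.linearMap_apply_apply]
  change F (TopSimplex.toUnitInterval _, σ (TopSimplex.map _ _)) = _
  rw [e1, e2, F.apply_zero]
  rfl

end Prism

/-- Homotopic maps pull a rational cocycle back to cohomologous cocycles. -/
theorem sub_mem_coboundaries_of_homotopy {X Y : Type} [TopologicalSpace X] [TopologicalSpace Y]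
    {f g : C(X, Y)} (F : f.Homotopy g) (k : ℕ) (c : C(TopSimplex k, Y) → ℚ)
    (hc : (LocalSystem.trivial Y).coboundary k c = 0) :
    (show (LocalSystem.trivial X).Cochain k from fun σ => c (g.comp σ) - c (f.comp σ)) ∈
      (LocalSystem.trivial X).coboundaries k := by
  rcases k with _ | k
  · change _ = _
    funext σ
    have h : (_ : ℚ) = _ := congrFun hc (prismSimplex F 0 σ)
    rw [trivial_coboundary_apply, Fin.sum_univ_two] at h
    have h0 := prismSimplex_face_zero F σ
    have h1 := prismSimplex_face_last F σ
    simp only [Nat.reduceAdd, Fin.reduceLast, Fin.last_zero] at h0 h1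
    rw [h0, h1] at h
    change _ = (0 : ℚ) at h
    change c (g.comp σ) - c (f.comp σ) = (0 : ℚ)
    simpa [← sub_eq_add_neg] using h
  · refine ⟨fun τ => ∑ i : Fin (k + 1), (-1 : ℚ) ^ (i : ℕ) * c (prismSimplex F i τ), ?_⟩
    funext σ
    rw [trivial_coboundary_apply]
    have hs := prism_sum k (fun i j => c (prismSimplex F i (σ.comp (TopSimplex.face k j))))
      (fun j i => c ((prismSimplex F i σ).comp (TopSimplex.face (k + 1) j)))
      (fun i j h => by rw [prismSimplex_face_of_lt F i j h])
      (fun i j h => by rw [prismSimplex_face_of_le F i j h])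
      (fun i => by rw [prismSimplex_face_middle])
    rw [prismSimplex_face_zero, prismSimplex_face_last] at hs
    rw [← hs]
    refine (add_eq_left.2 ?_).symm
    refine Finset.sum_eq_zero fun i _ => ?_
    have h : (_ : ℚ) = (0 : ℚ) := congrFun hc (prismSimplex F i σ)
    rw [trivial_coboundary_apply] at h
    rw [h, mul_zero]

/-! ### Transfer for finite regular coverings -/

namespace LocalSystem

section Cast

variable {X Y : Type} [TopologicalSpace X] [TopologicalSpace Y] (L : LocalSystem X)

/-- The identification of the fibres of a local system at equal points. -/
def castFiber {x y : X} (h : x = y) : L.fiber x →ₗ[ℚ] L.fiber y :=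
  L.transport ((Path.refl x).cast rfl h.symm)

lemma coboundary_apply {k : ℕ} (c : L.Cochain k) (σ : C(TopSimplex (k + 1), X)) :
    L.coboundary k c σ = ∑ i : Fin (k + 2), (-1 : ℚ) ^ (i : ℕ) •
      L.transport ((TopSimplex.segment (TopSimplex.face k i (TopSimplex.origin k))
        (TopSimplex.origin (k + 1))).map σ.continuous) (c (σ.comp (TopSimplex.face k i))) := rfl

lemma transport_refl (x : X) (v : L.fiber x) : L.transport (Path.refl x) v = v := by
  change (L.map (𝟙 _)).hom v = v
  rw [L.map_id]
  rfl

@[simp] lemma castFiber_rfl {x : X} (v : L.fiber x) : L.castFiber rfl v = v :=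
  L.transport_refl x v

@[simp] lemma castFiber_castFiber {x y z : X} (h : x = y) (h' : y = z) (v : L.fiber x) :
    L.castFiber h' (L.castFiber h v) = L.castFiber (h.trans h') v := by
  subst h h'
  simp

lemma castFiber_cochain {k : ℕ} (c : L.Cochain k) {σ τ : C(TopSimplex k, X)} (h : σ = τ) :
    L.castFiber (DFunLike.congr_fun h _) (c σ) = c τ := by
  subst h
  simp

end Cast

variable {X Y : Type} [TopologicalSpace X] [TopologicalSpace Y]

/-- The value of a cochain of the inverse image of `L` on a lift `τ` of the simplex `σ`, as an
element of the fibre of `L` belonging to `σ`. -/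
def liftValue (L : LocalSystem Y) {π : C(X, Y)} {k : ℕ} {σ : C(TopSimplex k, Y)}
    (τ : C(TopSimplex k, X)) (h : π.comp τ = σ) :
    (L.pullback π).Cochain k →ₗ[ℚ] L.fiber (σ (TopSimplex.origin k)) :=
  (L.castFiber (DFunLike.congr_fun h (TopSimplex.origin k))).comp
    (LinearMap.proj (φ := fun τ : C(TopSimplex k, X) => L.fiber (π (τ (TopSimplex.origin k)))) τ)

lemma liftValue_cochainMap (L : LocalSystem Y) {π : C(X, Y)} {k : ℕ} {σ : C(TopSimplex k, Y)}
    (τ : C(TopSimplex k, X)) (h : π.comp τ = σ) (c : L.Cochain k) :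
    L.liftValue τ h (L.cochainMap π k c) = c σ := by
  subst h
  exact L.castFiber_rfl _

lemma liftValue_coboundary (L : LocalSystem Y) {π : C(X, Y)} {k : ℕ}
    {σ : C(TopSimplex (k + 1), Y)} (τ : C(TopSimplex (k + 1), X)) (h : π.comp τ = σ)
    (c : (L.pullback π).Cochain k) :
    L.liftValue τ h ((L.pullback π).coboundary k c) = ∑ i : Fin (k + 2), (-1 : ℚ) ^ (i : ℕ) •
      L.transport ((TopSimplex.segment (TopSimplex.face k i (TopSimplex.origin k))
        (TopSimplex.origin (k + 1))).map σ.continuous)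
        (L.liftValue (σ := σ.comp (TopSimplex.face k i)) (τ.comp (TopSimplex.face k i))
          (by rw [← h]; rfl) c) := by
  subst h
  refine (L.castFiber_rfl _).trans ?_
  refine ((L.pullback π).coboundary_apply c τ).trans (Finset.sum_congr rfl fun i _ => ?_)
  exact congrArg (fun v => (-1 : ℚ) ^ (i : ℕ) • L.transport _ v) (L.castFiber_rfl _).symm

lemma liftValue_congr (L : LocalSystem Y) {π : C(X, Y)} {k : ℕ} {σ : C(TopSimplex k, Y)}
    {τ τ' : C(TopSimplex k, X)} (hτ : τ = τ') (h : π.comp τ = σ) (h' : π.comp τ' = σ)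
    (c : (L.pullback π).Cochain k) : L.liftValue τ h c = L.liftValue τ' h' c := by
  subst hτ
  rfl

end LocalSystem

instance (k : ℕ) : ContractibleSpace (TopSimplex k) :=
  (convex_stdSimplex ℝ (Fin (k + 1))).contractibleSpace ⟨_, (TopSimplex.origin k).2⟩

instance (k : ℕ) : LocallyPathConnectedSpace (TopSimplex k) :=
  LocallyPathConnectedSpace.of_bases (fun _ => Metric.nhds_basis_ball) fun x r hr => by
    rw [Topology.IsInducing.subtypeVal.isPathConnected_iff, ← Subtype.preimage_ball,
      Subtype.image_preimage_coe]
    exact ((convex_stdSimplex ℝ _).inter (convex_ball _ _)).isPathConnected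
      ⟨x, x.2, Metric.mem_ball_self hr⟩

namespace IsQuotientCoveringMap

variable {X Y S : Type} [TopologicalSpace X] [TopologicalSpace Y] [Group S] [MulAction S X]
  {π : C(X, Y)} (hπ : IsQuotientCoveringMap π S)
include hπ

lemma exists_lift_simplex {k : ℕ} (σ : C(TopSimplex k, Y)) :
    ∃ τ : C(TopSimplex k, X), π.comp τ = σ := by
  obtain ⟨x, hx⟩ := hπ.surjective (σ (TopSimplex.origin k))
  obtain ⟨τ, ⟨-, h⟩, -⟩ :=
    hπ.isCoveringMap.existsUnique_continuousMap_lifts σ (TopSimplex.origin k) x hx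
  exact ⟨τ, ContinuousMap.ext fun p => congrFun h p⟩

/-- The translate of a singular simplex by an element of the covering group. -/
def translate (s : S) {k : ℕ} (τ : C(TopSimplex k, X)) : C(TopSimplex k, X) :=
  ⟨fun p => s • τ p, (hπ.continuous_const_smul s).comp τ.continuous⟩

lemma comp_translate (s : S) {k : ℕ} (τ : C(TopSimplex k, X)) :
    π.comp (hπ.translate s τ) = π.comp τ :=
  ContinuousMap.ext fun _ => hπ.map_smul s

lemma translate_translate (s t : S) {k : ℕ} (τ : C(TopSimplex k, X)) :
    hπ.translate s (hπ.translate t τ) = hπ.translate (s * t) τ :=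
  ContinuousMap.ext fun _ => smul_smul _ _ _

lemma exists_translate_eq {k : ℕ} {τ τ' : C(TopSimplex k, X)} (h : π.comp τ = π.comp τ') :
    ∃ s : S, hπ.translate s τ = τ' := by
  obtain ⟨s, hs⟩ := hπ.apply_eq_iff_mem_orbit.1
    (DFunLike.congr_fun h.symm (TopSimplex.origin k))
  refine ⟨s, ?_⟩
  obtain ⟨_, -, hu⟩ := hπ.isCoveringMap.existsUnique_continuousMap_lifts (π.comp τ)
    (TopSimplex.origin k) _ (DFunLike.congr_fun h.symm (TopSimplex.origin k))
  exact (hu _ ⟨hs, congrArg DFunLike.coe (hπ.comp_translate s τ)⟩).trans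
    (hu τ' ⟨rfl, congrArg DFunLike.coe h.symm⟩).symm

variable [Fintype S] (L : LocalSystem Y)

/-- The transfer of cochains along a finite regular covering: the value on a simplex is the sum of
the values on its lifts, which are the translates of any one of them. -/
def transfer {k : ℕ} : (L.pullback π).Cochain k →ₗ[ℚ] L.Cochain k :=
  LinearMap.pi fun σ => ∑ s : S, L.liftValue (hπ.translate s (hπ.exists_lift_simplex σ).choose)
    ((hπ.comp_translate s _).trans (hπ.exists_lift_simplex σ).choose_spec)

lemma transfer_apply {k : ℕ} (c : (L.pullback π).Cochain k) {σ : C(TopSimplex k, Y)}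
    (τ : C(TopSimplex k, X)) (h : π.comp τ = σ) :
    hπ.transfer L c σ =
      ∑ s : S, L.liftValue (hπ.translate s τ) ((hπ.comp_translate s τ).trans h) c := by
  obtain ⟨s₀, hs₀⟩ := hπ.exists_translate_eq
    (h.trans (hπ.exists_lift_simplex σ).choose_spec.symm)
  rw [← Equiv.sum_comp (Equiv.mulRight s₀), transfer, LinearMap.pi_apply, LinearMap.sum_apply]
  refine Finset.sum_congr rfl fun s _ => L.liftValue_congr ?_ _ _ c
  rw [← hs₀, translate_translate]
  rfl

lemma transfer_cochainMap {k : ℕ} (c : L.Cochain k) :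
    hπ.transfer L (L.cochainMap π k c) = (Fintype.card S : ℚ) • c := by
  funext σ
  obtain ⟨τ, hτ⟩ := hπ.exists_lift_simplex σ
  rw [hπ.transfer_apply L _ τ hτ]
  simp_rw [L.liftValue_cochainMap]
  simp [Nat.cast_smul_eq_nsmul]

lemma coboundary_transfer {k : ℕ} (c : (L.pullback π).Cochain k) :
    L.coboundary k (hπ.transfer L c) = hπ.transfer L ((L.pullback π).coboundary k c) := by
  funext σ
  obtain ⟨τ, hτ⟩ := hπ.exists_lift_simplex σ
  rw [hπ.transfer_apply L _ τ hτ]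
  simp_rw [L.liftValue_coboundary]
  rw [Finset.sum_comm, L.coboundary_apply]
  refine Finset.sum_congr rfl fun i _ => ?_
  rw [hπ.transfer_apply L c (σ := σ.comp (TopSimplex.face k i)) (τ.comp (TopSimplex.face k i))
    (by rw [← hτ]; rfl), map_sum, Finset.smul_sum]
  rfl

/-- The transfer makes the pull-back along a finite regular covering injective in rational
cohomology. -/
theorem mem_coboundaries_of_cochainMap_mem {k : ℕ} {c : L.Cochain k}
    (hc : L.cochainMap π k c ∈ (L.pullback π).coboundaries k) : c ∈ L.coboundaries k := by
  have hS : (Fintype.card S : ℚ) ≠ 0 := Nat.cast_ne_zero.2 Fintype.card_ne_zero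
  have key : (Fintype.card S : ℚ) • c ∈ L.coboundaries k := by
    rw [← hπ.transfer_cochainMap L c]
    rcases k with _ | k
    · have h : L.cochainMap π 0 c = 0 := hc
      rw [h, map_zero]
      exact Submodule.zero_mem _
    · obtain ⟨b, hb⟩ := hc
      exact ⟨hπ.transfer L b, by rw [coboundary_transfer, hb]⟩
  exact (Submodule.smul_mem_iff _ hS).1 key

end IsQuotientCoveringMap

/-- Right translations of a path connected group act trivially on rational cohomology. -/
lemma translate_sub_mem_coboundaries {Γ : Type} [Group Γ] [TopologicalSpace Γ]
    [IsTopologicalGroup Γ] [PathConnectedSpace Γ] (g : Γ) (k : ℕ) (c : C(TopSimplex k, Γ) → ℚ)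
    (hc : (LocalSystem.trivial Γ).coboundary k c = 0) :
    (show (LocalSystem.trivial Γ).Cochain k from
      fun σ => c ((ContinuousMap.mk fun x : Γ => x * g).comp σ) - c σ) ∈
      (LocalSystem.trivial Γ).coboundaries k := by
  let γ := PathConnectedSpace.somePath (1 : Γ) g
  let F : (ContinuousMap.id Γ).Homotopy (ContinuousMap.mk fun x : Γ => x * g) :=
    { toFun := fun p => p.2 * γ p.1
      continuous_toFun := by fun_prop
      map_zero_left := fun x => by simp
      map_one_left := fun x => by simp }
  exact sub_mem_coboundaries_of_homotopy F k c hc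

/-- For a finite subgroup `T` of a path connected group `Γ`, the projection `Γ → Γ / T` induces an
isomorphism in rational cohomology. -/
theorem bijective_cohomology_quotientMap {Γ : Type} [Group Γ] [TopologicalSpace Γ]
    [IsTopologicalGroup Γ] [T2Space Γ] [PathConnectedSpace Γ] (T : Subgroup Γ) [Finite T] (k : ℕ) :
    Function.Bijective (RationalCohomology.map (quotientMap T) k) := by
  have hπ : IsQuotientCoveringMap (quotientMap T) T.op :=
    T.isQuotientCoveringMap (Set.toFinite _).isDiscrete
  have : Finite T.op := Finite.of_equiv T (T.equivOp)
  let _ : Fintype T.op := Fintype.ofFinite _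
  constructor
  · rw [← LinearMap.ker_eq_bot, LinearMap.ker_eq_bot']
    intro x
    obtain ⟨c, rfl⟩ := Submodule.Quotient.mk_surjective _ x
    intro hx
    refine (Submodule.Quotient.mk_eq_zero _).2 ?_
    have hx' := (Submodule.Quotient.mk_eq_zero _).1 hx
    exact hπ.mem_coboundaries_of_cochainMap_mem (LocalSystem.trivial (Γ ⧸ T)) hx'
  · intro x
    obtain ⟨c, rfl⟩ := Submodule.Quotient.mk_surjective _ x
    have hS : (Fintype.card T.op : ℚ) ≠ 0 := Nat.cast_ne_zero.2 Fintype.card_ne_zero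
    have hc : (LocalSystem.trivial Γ).coboundary k c.1 = 0 := c.2
    -- the preimage of a class is the average of its transfer
    let b : (LocalSystem.trivial (Γ ⧸ T)).Cochain k :=
      (Fintype.card T.op : ℚ)⁻¹ • hπ.transfer (LocalSystem.trivial (Γ ⧸ T)) c.1
    have hb : (LocalSystem.trivial (Γ ⧸ T)).coboundary k b = 0 := by
      rw [map_smul, hπ.coboundary_transfer]
      refine (congrArg _ (congrArg _ hc)).trans ?_
      rw [map_zero, smul_zero]
    refine ⟨Submodule.Quotient.mk ⟨b, hb⟩, (Submodule.Quotient.eq _).2 ?_⟩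
    let c' : C(TopSimplex k, Γ) → ℚ := c.1
    have key : (show (LocalSystem.trivial Γ).Cochain k from
          (LocalSystem.trivial (Γ ⧸ T)).cochainMap (quotientMap T) k b) - c.1 =
        (Fintype.card T.op : ℚ)⁻¹ • ∑ s : T.op, (show (LocalSystem.trivial Γ).Cochain k from
          fun σ => c' ((ContinuousMap.mk fun x : Γ => x * s.1.unop).comp σ) - c' σ) := by
      funext τ
      have h := hπ.transfer_apply (LocalSystem.trivial (Γ ⧸ T)) c.1 τ rfl
      have h' : hπ.transfer (LocalSystem.trivial (Γ ⧸ T)) c.1 ((quotientMap T).comp τ) =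
        ∑ s : T.op, c' ((ContinuousMap.mk fun x : Γ => x * s.1.unop).comp τ) := h
      have h'' : ((Fintype.card T.op : ℚ)⁻¹ • ∑ s : T.op,
          (show (LocalSystem.trivial Γ).Cochain k from fun σ =>
            c' ((ContinuousMap.mk fun x : Γ => x * s.1.unop).comp σ) - c' σ)) τ =
          (Fintype.card T.op : ℚ)⁻¹ * ∑ s : T.op,
            (c' ((ContinuousMap.mk fun x : Γ => x * s.1.unop).comp τ) - c' τ) := by
        rw [Pi.smul_apply, Finset.sum_apply]
        rfl
      refine Eq.trans ?_ h''.symm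
      change (Fintype.card T.op : ℚ)⁻¹ * _ - c' τ = _
      rw [h']
      rw [Finset.sum_sub_distrib, mul_sub]
      simp [hS]
    change (show (LocalSystem.trivial Γ).Cochain k from
          (LocalSystem.trivial (Γ ⧸ T)).cochainMap (quotientMap T) k b) - c.1 ∈
      (LocalSystem.trivial Γ).coboundaries k
    rw [key]
    exact Submodule.smul_mem _ _ (Submodule.sum_mem _ fun s _ =>
      translate_sub_mem_coboundaries s.1.unop k c.1 hc)

/-! ### Equivariant local systems of rank one on homogeneous spaces -/

namespace LocalSystem.EquivariantStructure

variable {Γ O : Type} [TopologicalSpace Γ] [Group Γ] [TopologicalSpace O] [MulAction Γ O]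
  [ContinuousSMul Γ O] {L : LocalSystem O} (E : L.EquivariantStructure Γ)

/-- The orbit map of a point. -/
def orbitMap (Γ : Type) {O : Type} [TopologicalSpace Γ] [Group Γ] [TopologicalSpace O]
    [MulAction Γ O] [ContinuousSMul Γ O] (o : O) : C(Γ, O) :=
  ⟨fun g => g • o, by fun_prop⟩

lemma act_castFiber (g : Γ) {x y : O} (h : x = y) (v : L.fiber x) :
    E.act g y (L.castFiber h v) = L.castFiber (by rw [h]) (E.act g x v) := by
  subst h
  simp

variable (o : O)

/-- The action maps at `o` are compatible with transport along the images of paths in the group. -/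
lemma transport_act {g g' : Γ} (γ : Path g g') (v : L.fiber o) :
    L.transport (γ.map (orbitMap Γ o).continuous) (E.act g o v) = E.act g' o v := by
  have h := E.act_transport γ (Path.refl o) v
  rw [L.transport_refl] at h
  exact h.symm

/-- The action of the stabilizer of `o` on the fibre at `o`. -/
def isotropy (s : MulAction.stabilizer Γ o) : L.fiber o →ₗ[ℚ] L.fiber o :=
  (L.castFiber (MulAction.mem_stabilizer_iff.1 s.2)).comp (E.act (s : Γ) o).toLinearMap

lemma act_mul_stabilizer (g : Γ) (s : MulAction.stabilizer Γ o) (v : L.fiber o) :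
    E.act (g * s) o v =
      L.castFiber (by rw [mul_smul, MulAction.mem_stabilizer_iff.1 s.2])
        (E.act g o (E.isotropy o s v)) := by
  have h := E.act_mul g s o v
  rw [isotropy, LinearMap.comp_apply, LinearEquiv.coe_coe, E.act_castFiber, castFiber_castFiber]
  exact h

/-- The identification of the fibre at `o` with the fibre at `y` given by an element that moves `o`
to `y`. -/
def moveFiber {y : O} (g : Γ) (h : g • o = y) : L.fiber o ≃ₗ[ℚ] L.fiber y :=
  (E.act g o).trans
    { L.castFiber h with
      invFun := L.castFiber h.symm
      left_inv := fun v => by simp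
      right_inv := fun v => by simp }

lemma moveFiber_apply {y : O} (g : Γ) (h : g • o = y) (v : L.fiber o) :
    E.moveFiber o g h v = L.castFiber h (E.act g o v) := rfl

lemma transport_moveFiber_of_lift {y z : O} (δ : Path y z) {g g' : Γ} (γ : Path g g')
    (hγ : ∀ t, γ t • o = δ t) (h : g • o = y) (h' : g' • o = z) (v : L.fiber o) :
    L.transport δ (E.moveFiber o g h v) = E.moveFiber o g' h' v := by
  subst h h'
  have hδ : δ = γ.map (orbitMap Γ o).continuous := by
    ext t
    exact (hγ t).symm
  rw [hδ, moveFiber_apply, moveFiber_apply, castFiber_rfl, castFiber_rfl]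
  exact E.transport_act o γ v

variable {o}

lemma moveFiber_congr (hE : ∀ s v, E.isotropy o s v = v) {y : O} (g g' : Γ) (h : g • o = y)
    (h' : g' • o = y) : E.moveFiber o g h = E.moveFiber o g' h' := by
  ext v
  obtain ⟨s, rfl⟩ : ∃ s : MulAction.stabilizer Γ o, g' = g * s :=
    ⟨⟨g⁻¹ * g', by rw [MulAction.mem_stabilizer_iff, mul_smul, h', ← h, inv_smul_smul]⟩, by simp⟩
  rw [moveFiber_apply, moveFiber_apply, act_mul_stabilizer, hE, castFiber_castFiber]

/-- The trivialization of the inverse image of `L` under the orbit map that is given by the group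
action and a coordinate `e` on the fibre at `o`. -/
def pullbackFiberEquiv (e : L.fiber o ≃ₗ[ℚ] ℚ) (g : Γ) :
    (L.pullback (orbitMap Γ o)).fiber g ≃ₗ[ℚ] ℚ :=
  (E.act g o).symm.trans e

lemma pullbackFiberEquiv_act (e : L.fiber o ≃ₗ[ℚ] ℚ) (g : Γ) (v : L.fiber o) :
    E.pullbackFiberEquiv e g (E.act g o v) = e v :=
  congrArg e (LinearEquiv.symm_apply_apply _ _)

lemma pullbackFiberEquiv_transport (e : L.fiber o ≃ₗ[ℚ] ℚ) {g g' : Γ} (γ : Path g g')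
    (w : (L.pullback (orbitMap Γ o)).fiber g) :
    E.pullbackFiberEquiv e g' ((L.pullback (orbitMap Γ o)).transport γ w) =
      E.pullbackFiberEquiv e g w := by
  obtain ⟨v, rfl⟩ := (E.act g o).surjective w
  exact (congrArg _ (E.transport_act o γ v)).trans
    ((E.pullbackFiberEquiv_act e g' v).trans (E.pullbackFiberEquiv_act e g v).symm)

/-- The identification of cochains that results from trivializing the inverse image of `L` under the
orbit map. -/
def trivialize (e : L.fiber o ≃ₗ[ℚ] ℚ) (k : ℕ) :
    (L.pullback (orbitMap Γ o)).Cochain k ≃ₗ[ℚ] (C(TopSimplex k, Γ) → ℚ) :=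
  LinearEquiv.piCongrRight fun σ => E.pullbackFiberEquiv e (σ (TopSimplex.origin k))

lemma trivialize_apply (e : L.fiber o ≃ₗ[ℚ] ℚ) {k : ℕ}
    (b : (L.pullback (orbitMap Γ o)).Cochain k) (σ : C(TopSimplex k, Γ)) :
    E.trivialize e k b σ = E.pullbackFiberEquiv e (σ (TopSimplex.origin k)) (b σ) := rfl

lemma coboundary_trivialize (e : L.fiber o ≃ₗ[ℚ] ℚ) {k : ℕ}
    (b : (L.pullback (orbitMap Γ o)).Cochain k) :
    (LocalSystem.trivial Γ).coboundary k (E.trivialize e k b) =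
      E.trivialize e (k + 1) ((L.pullback (orbitMap Γ o)).coboundary k b) := by
  funext σ
  rw [trivial_coboundary_apply, trivialize_apply, coboundary_apply, map_sum]
  refine Finset.sum_congr rfl fun i _ => ?_
  rw [map_smul, smul_eq_mul, trivialize_apply, pullbackFiberEquiv_transport]
  rfl

lemma trivialize_translate (e : L.fiber o ≃ₗ[ℚ] ℚ) [ContinuousMul Γ] {k : ℕ} (c : L.Cochain k)
    (s : MulAction.stabilizer Γ o) (r : ℚ)
    (hr : ∀ v, e (E.isotropy o s v) = r * e v) (σ : C(TopSimplex k, Γ)) :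
    r * E.trivialize e k (L.cochainMap (orbitMap Γ o) k c)
        ((ContinuousMap.mk fun x : Γ => x * s).comp σ) =
      E.trivialize e k (L.cochainMap (orbitMap Γ o) k c) σ := by
  rw [trivialize_apply, trivialize_apply]
  obtain ⟨w, hw⟩ := (E.act (σ (TopSimplex.origin k) * s) o).surjective
    (c ((orbitMap Γ o).comp ((ContinuousMap.mk fun x : Γ => x * s).comp σ)))
  have h2 : (orbitMap Γ o).comp ((ContinuousMap.mk fun x : Γ => x * (s : Γ)).comp σ) =
      (orbitMap Γ o).comp σ := by
    ext x
    change (σ x * s) • o = σ x • o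
    rw [mul_smul, MulAction.mem_stabilizer_iff.1 s.2]
  have h3 : L.castFiber _ _ = c ((orbitMap Γ o).comp σ) := L.castFiber_cochain c h2
  rw [← hw, act_mul_stabilizer] at h3
  have h4 : E.act (σ (TopSimplex.origin k)) o (E.isotropy o s w) = c ((orbitMap Γ o).comp σ) :=
    ((L.castFiber_castFiber _ _ _).trans (L.castFiber_rfl _)).symm.trans h3
  have h5 := (congrArg (E.pullbackFiberEquiv e (σ (TopSimplex.origin k) * s)) hw).symm.trans
    (E.pullbackFiberEquiv_act e _ w)
  have h6 := (congrArg (E.pullbackFiberEquiv e (σ (TopSimplex.origin k))) h4).symm.trans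
    (E.pullbackFiberEquiv_act e _ _)
  rw [hr] at h6
  exact (congrArg (r * ·) h5).trans h6.symm

variable [IsTopologicalGroup Γ] [T2Space Γ] [Finite (MulAction.stabilizer Γ o)]

lemma isQuotientCoveringMap_orbitMap (ho : IsOpenMap (orbitMap Γ o))
    (hs : Function.Surjective (orbitMap Γ o)) :
    IsQuotientCoveringMap (orbitMap Γ o) (MulAction.stabilizer Γ o).op :=
  (ho.isQuotientMap (orbitMap Γ o).continuous hs).isQuotientCoveringMap_of_subgroupOp _
    (Set.toFinite _).isDiscrete fun {g g'} => by
      rw [MulAction.mem_stabilizer_iff, mul_smul, inv_smul_eq_iff, eq_comm]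
      rfl

/-- If the isotropy representation is trivial then parallel transport is given by the group
action, as is seen by lifting paths to the group. -/
lemma transport_moveFiber (ho : IsOpenMap (orbitMap Γ o))
    (hs : Function.Surjective (orbitMap Γ o)) (hE : ∀ s v, E.isotropy o s v = v) {y z : O}
    (δ : Path y z) (g g' : Γ) (h : g • o = y) (h' : g' • o = z) (v : L.fiber o) :
    L.transport δ (E.moveFiber o g h v) = E.moveFiber o g' h' v := by
  have cov := (isQuotientCoveringMap_orbitMap ho hs).isCoveringMap
  have h0 : δ.toContinuousMap 0 = orbitMap Γ o g := by
    rw [show δ.toContinuousMap 0 = y from δ.source, ← h]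
    rfl
  let γ := cov.liftPath δ g h0
  have hγ : ∀ t, γ t • o = δ t := fun t => congrFun (cov.liftPath_lifts δ g h0) t
  have hγ0 : γ 0 = g := cov.liftPath_zero δ g h0
  have h1 : γ 1 • o = z := by rw [hγ, δ.target]
  rw [E.moveFiber_congr hE g' (γ 1) h' h1]
  exact E.transport_moveFiber_of_lift o δ ⟨γ, hγ0, rfl⟩ hγ h h1 v

/-- An equivariant local system of rank one with trivial isotropy representation is constant. -/
theorem nonempty_iso_trivial (ho : IsOpenMap (orbitMap Γ o))
    (hs : Function.Surjective (orbitMap Γ o)) (hE : ∀ s v, E.isotropy o s v = v)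
    (e : L.fiber o ≃ₗ[ℚ] ℚ) : Nonempty (L ≅ LocalSystem.trivial O) := by
  choose g hg using hs
  refine ⟨NatIso.ofComponents
    (fun y => ((E.moveFiber o (g y.as) (hg y.as)).symm.trans e).toModuleIso) ?_⟩
  rintro ⟨y⟩ ⟨z⟩ f
  obtain ⟨δ, rfl⟩ := Path.Homotopic.Quotient.mk_surjective f
  ext v
  have key := E.transport_moveFiber ho (fun y => ⟨g y, hg y⟩) hE δ (g y) (g z) (hg y) (hg z)
    ((E.moveFiber o (g y) (hg y)).symm v)
  rw [LinearEquiv.apply_symm_apply] at key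
  change e ((E.moveFiber o (g z) (hg z)).symm (L.transport δ v)) =
    e ((E.moveFiber o (g y) (hg y)).symm v)
  rw [key, LinearEquiv.symm_apply_apply]

variable (e : L.fiber o ≃ₗ[ℚ] ℚ) [PathConnectedSpace Γ]

/-- A rank one equivariant local system with nontrivial isotropy representation has no
cohomology: on the group, right translation by an element of the stabilizer is homotopic to the
identity but multiplies the classes that come from the homogeneous space by a scalar different
from one. -/
theorem subsingleton_cohomology_of_isotropy (ho : IsOpenMap (orbitMap Γ o))
    (hs : Function.Surjective (orbitMap Γ o)) (s : MulAction.stabilizer Γ o) (r : ℚ) (hr1 : r ≠ 1)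
    (hr : ∀ v, e (E.isotropy o s v) = r * e v) (k : ℕ) : Subsingleton (L.Cohomology k) := by
  have hπ := isQuotientCoveringMap_orbitMap ho hs
  have : Finite (MulAction.stabilizer Γ o).op :=
    Finite.of_equiv _ (MulAction.stabilizer Γ o).equivOp
  let _ : Fintype (MulAction.stabilizer Γ o).op := Fintype.ofFinite _
  refine Submodule.Quotient.subsingleton_iff.2 (eq_top_iff.2 fun c _ => ?_)
  have hc : L.coboundary k c.1 = 0 := c.2
  refine hπ.mem_coboundaries_of_cochainMap_mem L ?_
  set b := L.cochainMap (orbitMap Γ o) k c.1 with hb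
  have hb0 : (L.pullback (orbitMap Γ o)).coboundary k b = 0 := by
    rw [hb, coboundary_cochainMap, hc, map_zero]
  have hb1 : (LocalSystem.trivial Γ).coboundary k (E.trivialize e k b) = 0 := by
    rw [coboundary_trivialize, hb0, map_zero]
  -- translation by `s` multiplies the trivialized cocycle by `r⁻¹`, and `(1 - r)⁻¹ * r` is the
  -- inverse of `r⁻¹ - 1`
  have h1 := Submodule.smul_mem _ ((1 - r)⁻¹ * r)
    (translate_sub_mem_coboundaries (s : Γ) k _ hb1)
  have h2 : ((1 - r)⁻¹ * r) • (show (LocalSystem.trivial Γ).Cochain k from fun σ =>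
      E.trivialize e k b ((ContinuousMap.mk fun x : Γ => x * s).comp σ) - E.trivialize e k b σ) =
      E.trivialize e k b := by
    funext σ
    have h := E.trivialize_translate e c.1 s r hr σ
    have h1r : 1 - r ≠ 0 := sub_ne_zero.2 hr1.symm
    change (1 - r)⁻¹ * r * (_ - _) = _
    rw [← hb] at h
    rw [mul_assoc, mul_sub, h]
    field_simp
  rw [h2] at h1
  rcases k with _ | k
  · have h3 : E.trivialize e 0 b = 0 := h1
    exact (LinearEquiv.map_eq_zero_iff _).1 h3
  · obtain ⟨d, hd⟩ := h1
    refine ⟨(E.trivialize e k).symm d, (E.trivialize e (k + 1)).injective ?_⟩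
    rw [← coboundary_trivialize, LinearEquiv.apply_symm_apply]
    exact hd

include E in
/-- On a homogeneous space of a path connected group with finite stabilizers, a nonconstant
equivariant local system of rank one has no cohomology. -/
theorem subsingleton_cohomology (ho : IsOpenMap (orbitMap Γ o))
    (hs : Function.Surjective (orbitMap Γ o)) (hL : Module.finrank ℚ (L.fiber o) = 1)
    (hne : ¬ Nonempty (L ≅ LocalSystem.trivial O)) (k : ℕ) : Subsingleton (L.Cohomology k) := by
  have : Module.Finite ℚ (L.fiber o) := Module.finite_of_finrank_eq_succ hL
  obtain ⟨e⟩ : Nonempty (L.fiber o ≃ₗ[ℚ] ℚ) :=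
    FiniteDimensional.nonempty_linearEquiv_of_finrank_eq (by rw [hL, Module.finrank_self])
  have hr : ∀ s v, e (E.isotropy o s v) = e (E.isotropy o s (e.symm 1)) * e v := by
    intro s v
    have h : v = e v • e.symm 1 := by rw [← map_smul, smul_eq_mul, mul_one, e.symm_apply_apply]
    conv_lhs => rw [h, map_smul, map_smul, smul_eq_mul, mul_comm]
  by_cases h : ∀ s, e (E.isotropy o s (e.symm 1)) = 1
  · exact (hne (E.nonempty_iso_trivial ho hs (fun s v => e.injective (by rw [hr, h, one_mul]))
      e)).elim
  · push Not at h
    obtain ⟨s, h⟩ := h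
    exact E.subsingleton_cohomology_of_isotropy e ho hs s _ h (hr s) k

end LocalSystem.EquivariantStructure

/-! ### The Borel subalgebra and the Cartan involution -/

section SplitKilling

open LieAlgebra LieAlgebra.IsKilling Module

variable {L : Type} [LieRing L] [LieAlgebra ℝ L] [FiniteDimensional ℝ L] [IsKilling ℝ L]

omit [FiniteDimensional ℝ L] in
lemma eq_zero_of_killingForm_eq_zero {x : L} (h : ∀ y, killingForm ℝ L x y = 0) : x = 0 := by
  have hx : x ∈ LinearMap.ker (killingForm ℝ L) := LinearMap.ext h
  rwa [LieAlgebra.IsKilling.ker_killingForm_eq_bot ℝ L, Submodule.mem_bot] at hx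

omit [FiniteDimensional ℝ L] in
lemma eq_zero_of_forall_lie_eq_zero {x : L} (h : ∀ y : L, ⁅x, y⁆ = 0) : x = 0 := by
  refine eq_zero_of_killingForm_eq_zero fun y => ?_
  have : LieAlgebra.ad ℝ L x = 0 := LinearMap.ext h
  rw [killingForm_apply_apply, this, LinearMap.zero_comp, map_zero]

variable {H : LieSubalgebra ℝ L} [H.IsCartanSubalgebra] [LieModule.IsTriangularizable ℝ H L]
  (Δ : (rootSystem H).Base)

/-- The sum of the root spaces of the roots with a given property. -/
def sumRootSpaces (p : H.root → Prop) : Submodule ℝ L :=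
  ⨆ α : {α : H.root // p α}, (rootSpace H (α.1 : H → ℝ)).toSubmodule

/-- The Borel subalgebra of a split semisimple Lie algebra, as a subspace. -/
def borelSubmodule : Submodule ℝ L := H.toSubmodule ⊔ sumRootSpaces Δ.IsPos

lemma isPos_reflectionPerm_self_iff (α : H.root) :
    Δ.IsPos ((rootSystem H).reflectionPerm α α) ↔ ¬ Δ.IsPos α :=
  RootPairing.Base.IsPos.neg_iff_not Δ α

lemma root_add_ne_zero {α β : H.root} (h : Δ.IsPos α ↔ Δ.IsPos β) :
    ((α : LieModule.Weight ℝ H L) : H → ℝ) + (β : LieModule.Weight ℝ H L) ≠ 0 := by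
  intro h0
  have h1 : (rootSystem H).root β = - (rootSystem H).root α := by
    ext x
    have := congrFun h0 x
    simp only [Pi.add_apply, Pi.zero_apply] at this
    simp only [rootSystem_root_apply, LinearMap.neg_apply, LieModule.Weight.toLinear_apply]
    linarith
  rw [← (rootSystem H).reflection_apply_self, ← (rootSystem H).root_reflectionPerm] at h1
  have h2 := (rootSystem H).root.injective h1
  have h3 := isPos_reflectionPerm_self_iff Δ α
  rw [← h2, ← h] at h3
  tauto

omit [IsKilling ℝ L] [LieModule.IsTriangularizable ℝ H L] in
lemma zero_add_root_ne_zero (α : H.root) :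
    (0 : H → ℝ) + ((α : LieModule.Weight ℝ H L) : H → ℝ) ≠ 0 := by
  rw [zero_add]
  exact H.isNonZero_coe_root α

omit [IsKilling ℝ L] [LieModule.IsTriangularizable ℝ H L] in
lemma mem_rootSpace_zero_iff (x : L) : x ∈ rootSpace H (0 : H → ℝ) ↔ x ∈ H := by
  rw [rootSpace_zero_eq]
  exact Iff.rfl

lemma borelSubmodule_sup_neg :
    borelSubmodule Δ ⊔ sumRootSpaces (fun α => ¬ Δ.IsPos α) = ⊤ := by
  rw [eq_top_iff, ← LieSubmodule.top_toSubmodule (R := ℝ) (L := H),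
    ← LieModule.iSup_genWeightSpace_eq_top' ℝ H L, LieSubmodule.iSup_toSubmodule]
  refine iSup_le fun χ => ?_
  by_cases hχ : χ.IsZero
  · intro x hx
    have hx' : x ∈ rootSpace H (χ : H → ℝ) := hx
    rw [hχ.eq, mem_rootSpace_zero_iff] at hx'
    exact Submodule.mem_sup_left (Submodule.mem_sup_left hx')
  · have hχ' : χ ∈ H.root := by simpa [LieSubalgebra.root] using hχ
    by_cases hp : Δ.IsPos ⟨χ, hχ'⟩
    · exact le_trans (le_iSup (fun α : {α : H.root // Δ.IsPos α} =>
        (rootSpace H (α.1 : H → ℝ)).toSubmodule) ⟨⟨χ, hχ'⟩, hp⟩)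
        (le_sup_right.trans le_sup_left)
    · exact le_trans (le_iSup (fun α : {α : H.root // ¬ Δ.IsPos α} =>
        (rootSpace H (α.1 : H → ℝ)).toSubmodule) ⟨⟨χ, hχ'⟩, hp⟩) le_sup_right

lemma disjoint_borelSubmodule_neg :
    Disjoint (borelSubmodule Δ) (sumRootSpaces (fun α => ¬ Δ.IsPos α)) := by
  have hind := LieSubmodule.iSupIndep_toSubmodule.2 (LieModule.iSupIndep_genWeightSpace ℝ H L)
  let X : Set (H → ℝ) := {χ | χ = 0 ∨ ∃ α : H.root, Δ.IsPos α ∧ χ = (α : H → ℝ)}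
  let Y : Set (H → ℝ) := {χ | ∃ α : H.root, ¬ Δ.IsPos α ∧ χ = (α : H → ℝ)}
  have hXY : Disjoint X Y := by
    rw [Set.disjoint_left]
    rintro χ (rfl | ⟨α, hα, rfl⟩) ⟨β, hβ, h⟩
    · exact H.isNonZero_coe_root β h.symm
    · obtain rfl : α = β := Subtype.ext (DFunLike.coe_injective h)
      exact hβ hα
  refine (hind.disjoint_biSup_biSup hXY).mono (sup_le ?_ (iSup_le ?_)) (iSup_le ?_)
  · intro x hx
    exact Submodule.mem_iSup_of_mem 0 (Submodule.mem_iSup_of_mem (Or.inl rfl)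
      ((mem_rootSpace_zero_iff x).2 hx))
  · rintro ⟨α, hα⟩ x hx
    exact Submodule.mem_iSup_of_mem _ (Submodule.mem_iSup_of_mem (Or.inr ⟨α, hα, rfl⟩) hx)
  · rintro ⟨α, hα⟩ x hx
    exact Submodule.mem_iSup_of_mem _ (Submodule.mem_iSup_of_mem ⟨α, hα, rfl⟩ hx)

omit [IsKilling ℝ L] [LieModule.IsTriangularizable ℝ H L] in
lemma lie_mem_sumRootSpaces (p : H.root → Prop) (h : H) {x : L} (hx : x ∈ sumRootSpaces p) :
    ⁅(h : L), x⁆ ∈ sumRootSpaces p := by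
  suffices hle : sumRootSpaces p ≤ (sumRootSpaces p).comap (LieAlgebra.ad ℝ L h) from hle hx
  refine iSup_le fun α x hx => ?_
  exact Submodule.mem_iSup_of_mem α (LieSubmodule.lie_mem _ hx : ⁅h, x⁆ ∈ rootSpace H (α.1 : H → ℝ))

lemma lie_mem_borelSubmodule (h : H) {x : L} (hx : x ∈ borelSubmodule Δ) :
    ⁅(h : L), x⁆ ∈ borelSubmodule Δ := by
  obtain ⟨y, hy, z, hz, rfl⟩ := Submodule.mem_sup.1 hx
  rw [lie_add]
  exact Submodule.add_mem_sup (H.lie_mem h.2 hy) (lie_mem_sumRootSpaces _ h hz)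

lemma lie_mem_sumRootSpaces_isPos {x y : L} (hx : x ∈ sumRootSpaces Δ.IsPos)
    (hy : y ∈ sumRootSpaces Δ.IsPos) : ⁅x, y⁆ ∈ sumRootSpaces Δ.IsPos := by
  suffices h1 : sumRootSpaces Δ.IsPos ≤ (sumRootSpaces Δ.IsPos).comap (ad ℝ L x) from h1 hy
  refine iSup_le fun β y hy => ?_
  suffices h2 : sumRootSpaces Δ.IsPos ≤
      (sumRootSpaces Δ.IsPos).comap ((ad ℝ L).toLinearMap.flip y) from h2 hx
  refine iSup_le fun α x hx => ?_
  change ⁅x, y⁆ ∈ sumRootSpaces Δ.IsPos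
  have h : ⁅x, y⁆ ∈ rootSpace H (((α.1 : LieModule.Weight ℝ H L) : H → ℝ) +
      (β.1 : LieModule.Weight ℝ H L)) := lie_mem_genWeightSpace_of_mem_genWeightSpace hx hy
  by_cases h0 : rootSpace H (((α.1 : LieModule.Weight ℝ H L) : H → ℝ) +
      (β.1 : LieModule.Weight ℝ H L)) = ⊥
  · rw [h0, LieSubmodule.mem_bot] at h
    rw [h]
    exact zero_mem _
  · let γ : LieModule.Weight ℝ H L := ⟨_, h0⟩
    have hγ : γ ∈ H.root := by
      have : ¬ γ.IsZero := fun hz =>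
        root_add_ne_zero Δ (α := α.1) (β := β.1) (by simp [α.2, β.2]) hz
      simpa [LieSubalgebra.root] using this
    have hpos : Δ.IsPos ⟨γ, hγ⟩ := α.2.add β.2 (by ext; rfl)
    exact Submodule.mem_iSup_of_mem (⟨⟨γ, hγ⟩, hpos⟩ : {α : H.root // Δ.IsPos α}) h

lemma lie_mem_borelSubmodule_of_mem {x y : L} (hx : x ∈ borelSubmodule Δ)
    (hy : y ∈ borelSubmodule Δ) : ⁅x, y⁆ ∈ borelSubmodule Δ := by
  obtain ⟨h, hh, m, hm, rfl⟩ := Submodule.mem_sup.1 hx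
  obtain ⟨h', hh', m', hm', rfl⟩ := Submodule.mem_sup.1 hy
  rw [add_lie, lie_add m]
  refine add_mem (lie_mem_borelSubmodule Δ ⟨h, hh⟩ hy) (add_mem ?_ (Submodule.mem_sup_right
    (lie_mem_sumRootSpaces_isPos Δ hm hm')))
  rw [← lie_skew]
  exact neg_mem (Submodule.mem_sup_right (lie_mem_sumRootSpaces _ ⟨h', hh'⟩ hm))

/-- The Borel subalgebra contains its normalizer. -/
lemma mem_borelSubmodule_of_normalizes {x : L}
    (hx : ∀ y ∈ borelSubmodule Δ, ⁅x, y⁆ ∈ borelSubmodule Δ) : x ∈ borelSubmodule Δ := by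
  have hx' : x ∈ borelSubmodule Δ ⊔ sumRootSpaces (fun α => ¬ Δ.IsPos α) := by
    rw [borelSubmodule_sup_neg]
    trivial
  obtain ⟨b, hb, m, hm, rfl⟩ := Submodule.mem_sup.1 hx'
  have hcomm : ∀ h ∈ H, ⁅m, h⁆ = 0 := by
    intro h hh
    refine Submodule.disjoint_def.1 (disjoint_borelSubmodule_neg Δ) _ ?_ ?_
    · have h1 := hx h (Submodule.mem_sup_left hh)
      have h2 := add_mem h1 (lie_mem_borelSubmodule Δ ⟨h, hh⟩ hb)
      have h3 : ⁅b + m, h⁆ + ⁅h, b⁆ = ⁅m, h⁆ := by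
        rw [add_lie, ← lie_skew b h]
        abel
      rwa [h3] at h2
    · rw [← lie_skew]
      exact Submodule.neg_mem _ (lie_mem_sumRootSpaces _ ⟨h, hh⟩ hm)
  have hmH : m ∈ H := by
    rw [← LieSubalgebra.IsCartanSubalgebra.self_normalizing (H := H),
      LieSubalgebra.mem_normalizer_iff]
    intro h hh
    rw [hcomm h hh]
    exact H.zero_mem
  exact add_mem hb (Submodule.mem_sup_left hmH)

omit [IsKilling ℝ L] in
lemma killingForm_eq_zero_of_mem_sumRootSpaces (p q : H.root → Prop)
    (hpq : ∀ α β : H.root, p α → q β →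
      ((α : LieModule.Weight ℝ H L) : H → ℝ) + (β : LieModule.Weight ℝ H L) ≠ 0) {x y : L}
    (hx : x ∈ H.toSubmodule ⊔ sumRootSpaces p) (hy : y ∈ sumRootSpaces q) :
    killingForm ℝ L x y = 0 := by
  suffices h1 : sumRootSpaces q ≤ LinearMap.ker (killingForm ℝ L x) from h1 hy
  refine iSup_le fun β y hy => ?_
  suffices h2 : H.toSubmodule ⊔ sumRootSpaces p ≤ LinearMap.ker ((killingForm ℝ L).flip y) from
    h2 hx
  refine sup_le (fun x hx => ?_) (iSup_le fun α x hx => ?_)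
  · exact killingForm_apply_eq_zero_of_mem_rootSpace_of_add_ne_zero ℝ L H
      ((mem_rootSpace_zero_iff x).2 hx) hy (zero_add_root_ne_zero _)
  · exact killingForm_apply_eq_zero_of_mem_rootSpace_of_add_ne_zero ℝ L H hx hy
      (hpq _ _ α.2 β.2)

/-- The Killing form is positive semidefinite on the Borel subalgebra: on the Cartan subalgebra it
is a sum of squares of roots, and the nilradical is orthogonal to everything. -/
lemma killingForm_self_nonneg {x : L} (hx : x ∈ borelSubmodule Δ) : 0 ≤ killingForm ℝ L x x := by
  obtain ⟨h, hh, m, hm, rfl⟩ := Submodule.mem_sup.1 hx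
  have h1 : killingForm ℝ L (h + m) m = 0 := killingForm_eq_zero_of_mem_sumRootSpaces Δ.IsPos
    Δ.IsPos (fun α β hα hβ => root_add_ne_zero Δ (by tauto)) hx hm
  have h2 : killingForm ℝ L h m = 0 := killingForm_eq_zero_of_mem_sumRootSpaces Δ.IsPos
    Δ.IsPos (fun α β hα hβ => root_add_ne_zero Δ (by tauto)) (Submodule.mem_sup_left hh) hm
  rw [map_add, h1, add_zero, map_add, LinearMap.add_apply, LieModule.traceForm_comm ℝ L L m h]
  rw [h2, add_zero]
  have h3 : killingForm ℝ L h h = (killingForm ℝ L).restrict H ⟨h, hh⟩ ⟨h, hh⟩ := rfl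
  rw [h3, restrict_killingForm_eq_sum]
  simp only [LinearMap.sum_apply, LinearMap.smulRight_apply, LinearMap.smul_apply, smul_eq_mul]
  exact Finset.sum_nonneg fun α _ => mul_self_nonneg _

/-- The orthogonal of the Borel subalgebra for the Killing form is contained in it. -/
lemma mem_borelSubmodule_of_orthogonal {x : L}
    (hx : ∀ y ∈ borelSubmodule Δ, killingForm ℝ L y x = 0) : x ∈ borelSubmodule Δ := by
  have htop : borelSubmodule Δ ⊔ sumRootSpaces (fun α => ¬ Δ.IsPos α) = ⊤ :=
    borelSubmodule_sup_neg Δ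
  obtain ⟨b, hb, m, hm, rfl⟩ := Submodule.mem_sup.1 (htop ▸ Submodule.mem_top (x := x))
  have hH : ∀ y ∈ H.toSubmodule ⊔ sumRootSpaces (fun α => ¬ Δ.IsPos α), killingForm ℝ L y m = 0 :=
    fun y hy => killingForm_eq_zero_of_mem_sumRootSpaces _ _
      (fun α β hα hβ => root_add_ne_zero Δ (by tauto)) hy hm
  suffices hm0 : m = 0 by simpa [hm0] using hb
  refine eq_zero_of_killingForm_eq_zero fun y => ?_
  rw [LieModule.traceForm_comm]
  obtain ⟨c, hc, q, hq, rfl⟩ := Submodule.mem_sup.1 (htop ▸ Submodule.mem_top (x := y))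
  obtain ⟨h, hh, r, hr, rfl⟩ := Submodule.mem_sup.1 hc
  have h1 : killingForm ℝ L b r = 0 := killingForm_eq_zero_of_mem_sumRootSpaces Δ.IsPos
    Δ.IsPos (fun α β hα hβ => root_add_ne_zero Δ (by tauto)) hb hr
  have h2 := hx r (Submodule.mem_sup_right hr)
  rw [map_add, LieModule.traceForm_comm ℝ L L r b, h1, zero_add] at h2
  have h3 := hH h (Submodule.mem_sup_left hh)
  have h4 := hH q (Submodule.mem_sup_right hq)
  simp only [killingForm] at *
  rw [map_add, map_add, LinearMap.add_apply, LinearMap.add_apply, h2, h3, h4]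
  simp

variable {θ : L ≃ₗ⁅ℝ⁆ L}

namespace IsCartanInvolution

variable (hθ : IsCartanInvolution θ)
include hθ

omit [FiniteDimensional ℝ L] [IsKilling ℝ L] in
lemma killingForm_self_neg {x : L} (h : θ x = x) (hx : x ≠ 0) : killingForm ℝ L x x < 0 := by
  have := hθ.negative x hx
  rwa [h] at this

omit [FiniteDimensional ℝ L] [IsKilling ℝ L] in
lemma killingForm_self_pos {x : L} (h : θ x = -x) (hx : x ≠ 0) : 0 < killingForm ℝ L x x := by
  have := hθ.negative x hx
  rw [h, map_neg] at this
  linarith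

/-- The Lie algebra of the maximal compact subgroup meets the Borel subalgebra trivially. -/
lemma eq_zero_of_fixed_of_mem_borel {x : L} (h : θ x = x) (hx : x ∈ borelSubmodule Δ) : x = 0 := by
  by_contra h0
  exact absurd (killingForm_self_nonneg Δ hx) (not_le.2 (hθ.killingForm_self_neg h h0))

/-- The Iwasawa decomposition: the fixed points of a Cartan involution and the Borel subalgebra
span the Lie algebra. -/
lemma exists_fixed_add_borel (x : L) : ∃ y, θ y = y ∧ ∃ b ∈ borelSubmodule Δ, y + b = x := by
  let k : Submodule ℝ L := LinearMap.eqLocus (θ : L →ₗ[ℝ] L) LinearMap.id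
  suffices htop : k ⊔ borelSubmodule Δ = ⊤ by
    obtain ⟨y, hy, b, hb, rfl⟩ := Submodule.mem_sup.1 (htop ▸ Submodule.mem_top (x := x))
    exact ⟨y, hy, b, hb, rfl⟩
  by_contra htop
  -- a linear form vanishing on the sum is given by an element `z` orthogonal to it
  obtain ⟨f, hf0, hf⟩ := Submodule.exists_le_ker_of_lt_top _ (lt_top_iff_ne_top.2 htop)
  obtain ⟨z, rfl⟩ : ∃ z, killingForm ℝ L z = f :=
    ⟨_, LinearMap.ext (LinearMap.BilinForm.apply_toDual_symm_apply
      (hB := LieAlgebra.IsKilling.killingForm_nondegenerate ℝ L) f)⟩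
  have hinv : ∀ a b, killingForm ℝ L (θ a) (θ b) = killingForm ℝ L a b :=
    LieAlgebra.killingForm_of_equiv_apply θ
  have hfix : θ (z + θ z) = z + θ z := by rw [map_add, hθ.involutive, add_comm]
  have h1 : killingForm ℝ L z (z + θ z) = 0 := hf (Submodule.mem_sup_left hfix)
  have h2 : killingForm ℝ L (θ z) (z + θ z) = 0 := by
    rw [← hinv, hθ.involutive, hfix, h1]
  have h3 : z + θ z = 0 := by
    by_contra h0
    have := hθ.killingForm_self_neg hfix h0
    rw [map_add (killingForm ℝ L), LinearMap.add_apply, h1, h2] at this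
    simp at this
  have hzb : z ∈ borelSubmodule Δ := mem_borelSubmodule_of_orthogonal Δ fun y hy => by
    rw [LieModule.traceForm_comm]
    exact hf (Submodule.mem_sup_right hy)
  have h5 : killingForm ℝ L z z = 0 := hf (Submodule.mem_sup_right hzb)
  have hz : z = 0 := by
    by_contra h0
    exact (hθ.killingForm_self_pos (eq_neg_of_add_eq_zero_right h3) h0).ne' h5
  exact hf0 (by rw [hz, map_zero])

omit [FiniteDimensional ℝ L] in
/-- An element that normalizes both eigenspaces of a Cartan involution is fixed by it. -/
lemma fixed_of_normalizes {x : L} (h₁ : ∀ y, θ y = y → θ ⁅x, y⁆ = ⁅x, y⁆)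
    (h₂ : ∀ y, θ y = -y → θ ⁅x, y⁆ = -⁅x, y⁆) : θ x = x := by
  refine (sub_eq_zero.1 (eq_zero_of_forall_lie_eq_zero (x := θ x - x) fun y => ?_))
  have e1 := h₁ (y + θ y) (by rw [map_add, hθ.involutive, add_comm])
  have e2 := h₂ (y - θ y) (by rw [map_sub, hθ.involutive, neg_sub])
  rw [LieEquiv.map_lie, map_add, hθ.involutive] at e1
  rw [LieEquiv.map_lie, map_sub, hθ.involutive] at e2
  have e3 : (2 : ℝ) • ⁅θ x - x, y⁆ = 0 := by
    simp only [lie_add, lie_sub, sub_lie] at e1 e2 ⊢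
    linear_combination (norm := module) (1 : ℝ) • e1 - (1 : ℝ) • e2
  exact (smul_eq_zero.1 e3).resolve_left two_ne_zero

/-- An element that normalizes both eigenspaces of a Cartan involution and a Borel subalgebra is
zero. -/
lemma eq_zero_of_normalizes {x : L} (h₁ : ∀ y, θ y = y → θ ⁅x, y⁆ = ⁅x, y⁆)
    (h₂ : ∀ y, θ y = -y → θ ⁅x, y⁆ = -⁅x, y⁆)
    (h₃ : ∀ y ∈ borelSubmodule Δ, ⁅x, y⁆ ∈ borelSubmodule Δ) : x = 0 :=
  hθ.eq_zero_of_fixed_of_mem_borel Δ (hθ.fixed_of_normalizes h₁ h₂)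
    (mem_borelSubmodule_of_normalizes Δ h₃)

end IsCartanInvolution

end SplitKilling

/-! ### The exponential map and conjugation -/

section BanachAlgebra

open NormedSpace

variable {𝔸 : Type*} [NormedRing 𝔸] [NormedAlgebra ℝ 𝔸]

/-- The inner derivation `X ↦ Z * X - X * Z`, as a bounded operator. -/
def commutatorCLM (Z : 𝔸) : 𝔸 →L[ℝ] 𝔸 :=
  ContinuousLinearMap.mul ℝ 𝔸 Z - (ContinuousLinearMap.mul ℝ 𝔸).flip Z

lemma commutatorCLM_apply (Z X : 𝔸) : commutatorCLM Z X = Z * X - X * Z := rfl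

variable [CompleteSpace 𝔸]

/-- Conjugation by `exp Z` is the exponential of the inner derivation of `Z`. -/
lemma exp_commutatorCLM_apply (Z X : 𝔸) :
    exp (commutatorCLM Z) X = exp Z * X * exp (-Z) := by
  let _ : NormedAlgebra ℚ (𝔸 →L[ℝ] 𝔸) := NormedAlgebra.restrictScalars ℚ ℝ _
  have key : ∀ (f : 𝔸 →L[ℝ] 𝔸 →L[ℝ] 𝔸), (∀ (Y : 𝔸) (m : ℕ), f (Y ^ m) = f Y ^ m) →
      ∀ Y, exp (f Y) = f (exp Y) := by
    intro f hf Y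
    have h1 := (exp_series_hasSum_exp' (𝕂 := ℝ) Y).mapL f
    simp only [map_smul, hf] at h1
    exact (exp_series_hasSum_exp' (𝕂 := ℝ) (f Y)).unique h1
  have hl := key (ContinuousLinearMap.mul ℝ 𝔸) fun Y m => by
    ext X
    induction m with
    | zero => simp
    | succ m ih =>
      rw [pow_succ' (ContinuousLinearMap.mul ℝ 𝔸 Y), mul_apply_eq_comp,
        ← ih, pow_succ']
      simp [mul_assoc]
  have hr := key (ContinuousLinearMap.mul ℝ 𝔸).flip fun Y m => by
    ext X
    induction m with
    | zero => simp
    | succ m ih =>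
      rw [pow_succ' ((ContinuousLinearMap.mul ℝ 𝔸).flip Y), mul_apply_eq_comp,
        ← ih, pow_succ]
      simp [mul_assoc]
  have hcomm : Commute (ContinuousLinearMap.mul ℝ 𝔸 Z)
      ((ContinuousLinearMap.mul ℝ 𝔸).flip (-Z)) := by
    ext X
    simp [mul_assoc]
  rw [commutatorCLM, sub_eq_add_neg, ← map_neg, exp_add_of_commute hcomm, hl, hr]
  simp [mul_assoc]

lemma conj_exp_mem {W : Submodule ℝ 𝔸} (hc : IsClosed (W : Set 𝔸)) {Z : 𝔸}
    (h : ∀ X ∈ W, Z * X - X * Z ∈ W) {X : 𝔸} (hX : X ∈ W) : exp Z * X * exp (-Z) ∈ W := by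
  rw [← exp_commutatorCLM_apply]
  have h1 := (exp_series_hasSum_exp' (𝕂 := ℝ) (commutatorCLM Z)).mapL
    (ContinuousLinearMap.apply ℝ 𝔸 X)
  refine hc.mem_of_tendsto h1 (Filter.Eventually.of_forall fun s => W.sum_mem fun m hm => ?_)
  clear hm
  rw [map_smul]
  refine W.smul_mem _ ?_
  induction m with
  | zero => simpa using hX
  | succ m ih =>
    rw [pow_succ']
    exact h _ ih

/-- The variant of `conj_exp_mem` for pairs, conjugated componentwise. -/
lemma conj_exp_prod_mem {W : Submodule ℝ (𝔸 × 𝔸)} (hc : IsClosed (W : Set (𝔸 × 𝔸))) {Z Z' : 𝔸}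
    (h : ∀ q ∈ W, (Z * q.1 - q.1 * Z, Z' * q.2 - q.2 * Z') ∈ W) {q : 𝔸 × 𝔸} (hq : q ∈ W) :
    (exp Z * q.1 * exp (-Z), exp Z' * q.2 * exp (-Z')) ∈ W := by
  let _ : NormedAlgebra ℚ 𝔸 := NormedAlgebra.restrictScalars ℚ ℝ 𝔸
  have h1 := conj_exp_mem hc (Z := (Z, Z')) h hq
  have e : (exp Z * q.1 * exp (-Z), exp Z' * q.2 * exp (-Z')) =
      exp (Z, Z') * q * exp (-(Z, Z')) := by
    refine Prod.ext ?_ ?_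
    · simp only [Prod.fst_mul, Prod.fst_exp, Prod.fst_neg]
    · simp only [Prod.snd_mul, Prod.snd_exp, Prod.snd_neg]
  rwa [e]

lemma conj_exp_of_commutator_eq_smul {Z X : 𝔸} {a : ℝ} (h : Z * X - X * Z = a • X) :
    exp Z * X * exp (-Z) = Real.exp a • X := by
  rw [← exp_commutatorCLM_apply]
  have h1 := (exp_series_hasSum_exp' (𝕂 := ℝ) (commutatorCLM Z)).mapL
    (ContinuousLinearMap.apply ℝ 𝔸 X)
  have h2 := (exp_series_hasSum_exp' (𝕂 := ℝ) a).smul_const X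
  rw [Real.exp_eq_exp_ℝ]
  refine h1.unique (h2.congr_fun ?_)
  intro m
  have hm : ((commutatorCLM Z) ^ m) X = a ^ m • X := by
    induction m with
    | zero => simp
    | succ m ih =>
      rw [pow_succ', mul_apply_eq_comp, ih, map_smul, commutatorCLM_apply, h,
        pow_succ, smul_smul]
  rw [map_smul, ContinuousLinearMap.apply_apply, hm, smul_assoc]

lemma hasDerivAt_exp_smul_zero (Z : 𝔸) : HasDerivAt (fun t : ℝ => exp (t • Z)) Z 0 := by
  have h := hasDerivAt_exp_smul_const (𝕂 := ℝ) Z 0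
  rwa [zero_smul, exp_zero, one_mul] at h

lemma eq_of_forall_exp_smul_eq {X Y : 𝔸} (h : ∀ t : ℝ, exp (t • X) = exp (t • Y)) : X = Y := by
  have h1 := hasDerivAt_exp_smul_zero X
  rw [funext h] at h1
  exact h1.unique (hasDerivAt_exp_smul_zero Y)

lemma commutator_mem_of_forall_conj_exp_mem {W : Submodule ℝ 𝔸} (hc : IsClosed (W : Set 𝔸))
    {Z X : 𝔸} (hX : X ∈ W) (h : ∀ t : ℝ, exp (t • Z) * X * exp (-(t • Z)) ∈ W) :
    Z * X - X * Z ∈ W := by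
  have h1 : HasDerivAt (fun t : ℝ => exp (t • Z) * X * exp (-(t • Z))) (Z * X - X * Z) 0 := by
    have h2 := ((hasDerivAt_exp_smul_zero Z).mul_const X).mul (hasDerivAt_exp_smul_zero (-Z))
    simp only [zero_smul, neg_zero, exp_zero, one_mul, mul_one, mul_neg, ← sub_eq_add_neg,
      smul_neg] at h2
    exact h2
  rw [hasDerivAt_iff_tendsto_slope_zero] at h1
  refine hc.mem_of_tendsto h1 (Filter.Eventually.of_forall fun t => ?_)
  refine W.smul_mem _ (W.sub_mem (h _) ?_)
  simpa using hX

/-- Coordinates of the second kind in the unit group of a Banach algebra, by the inverse function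
theorem. -/
lemma map_nhds_exp_mul_exp_mul_exp [FiniteDimensional ℝ 𝔸] {V₁ V₂ W : Submodule ℝ 𝔸}
    (htop : V₁ ⊔ V₂ ⊔ W = ⊤) :
    Filter.map (fun x : V₁ × V₂ × W => exp (x.1 : 𝔸) * (exp (x.2.1 : 𝔸) * exp (x.2.2 : 𝔸)))
      (nhds 0) = nhds 1 := by
  let i₁ : V₁ × V₂ × W →L[ℝ] 𝔸 := V₁.subtypeL.comp (ContinuousLinearMap.fst ℝ _ _)
  let i₂ : V₁ × V₂ × W →L[ℝ] 𝔸 :=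
    (V₂.subtypeL.comp (ContinuousLinearMap.fst ℝ _ _)).comp (ContinuousLinearMap.snd ℝ _ _)
  let i₃ : V₁ × V₂ × W →L[ℝ] 𝔸 :=
    (W.subtypeL.comp (ContinuousLinearMap.snd ℝ _ _)).comp (ContinuousLinearMap.snd ℝ _ _)
  have hexp : ∀ i : V₁ × V₂ × W →L[ℝ] 𝔸, HasStrictFDerivAt (fun x => exp (i x)) i 0 := by
    intro i
    have h0 : HasStrictFDerivAt (exp : 𝔸 → 𝔸) (1 : 𝔸 →L[ℝ] 𝔸) (i 0) := by
      rw [map_zero]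
      exact hasStrictFDerivAt_exp_zero
    exact h0.comp 0 i.hasStrictFDerivAt
  have hF := (hexp i₁).mul' ((hexp i₂).mul' (hexp i₃))
  have hsurj : (exp (i₁ 0) • (exp (i₂ 0) • i₃ + MulOpposite.op (exp (i₃ 0)) • i₂) +
      MulOpposite.op (((fun x => exp (i₂ x)) * fun x => exp (i₃ x)) 0) • i₁).range = ⊤ := by
    rw [LinearMap.range_eq_top]
    intro X
    obtain ⟨u, hu, w, hw, rfl⟩ := Submodule.mem_sup.1 (htop ▸ Submodule.mem_top (x := X))
    obtain ⟨x, hx, y, hy, rfl⟩ := Submodule.mem_sup.1 hu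
    refine ⟨(⟨x, hx⟩, ⟨y, hy⟩, ⟨w, hw⟩), ?_⟩
    simp [i₁, i₂, i₃]
    abel
  have := hF.map_nhds_eq_of_surj hsurj
  simpa [i₁, i₂, i₃, Pi.mul_def] using this

end BanachAlgebra

section MatrixExp

open NormedSpace
open scoped Topology

attribute [local instance] Matrix.linftyOpNormedRing Matrix.linftyOpNormedAlgebra

variable {n : ℕ}

lemma coe_expGL (X : CMat n) : ((expGL X : GL (Fin n) ℂ) : CMat n) = exp X := rfl

lemma coe_expGL_inv (X : CMat n) : (((expGL X)⁻¹ : GL (Fin n) ℂ) : CMat n) = exp (-X) := by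
  rw [Matrix.exp_neg, Matrix.coe_units_inv]
  rfl

lemma expGL_neg (X : CMat n) : expGL (-X) = (expGL X)⁻¹ :=
  Units.ext (coe_expGL_inv X).symm

lemma expGL_zero : expGL (0 : CMat n) = 1 := Units.ext exp_zero

lemma expGL_add_smul (s t : ℝ) (X : CMat n) :
    expGL ((s + t) • X) = expGL (s • X) * expGL (t • X) := by
  refine Units.ext ?_
  rw [add_smul]
  exact Matrix.exp_add_of_commute _ _ (((Commute.refl X).smul_left s).smul_right t)

lemma expGL_nsmul (m : ℕ) (X : CMat n) : expGL (m • X) = expGL X ^ m :=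
  Units.ext (Matrix.exp_nsmul m X)

lemma expGL_zsmul (m : ℤ) (X : CMat n) : expGL (m • X) = expGL X ^ m := by
  obtain ⟨k, rfl | rfl⟩ := m.eq_nat_or_neg
  · rw [zpow_natCast, natCast_zsmul, expGL_nsmul]
  · rw [zpow_neg, zpow_natCast, neg_smul, natCast_zsmul, expGL_neg, expGL_nsmul]

lemma expGL_conj (g : GL (Fin n) ℂ) (X : CMat n) :
    expGL ((g : CMat n) * X * ((g⁻¹ : GL (Fin n) ℂ) : CMat n)) = g * expGL X * g⁻¹ :=
  Units.ext (NormedSpace.exp_units_conj g X)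

lemma continuous_expGL : Continuous (expGL : CMat n → GL (Fin n) ℂ) := by
  rw [Units.continuous_iff]
  refine ⟨exp_continuous, ?_⟩
  have : Continuous fun X : CMat n => exp (-X) := exp_continuous.comp continuous_neg
  exact this.congr fun X => (coe_expGL_inv X).symm

lemma eq_of_forall_expGL_smul_eq {X Y : CMat n} (h : ∀ t : ℝ, expGL (t • X) = expGL (t • Y)) :
    X = Y :=
  eq_of_forall_exp_smul_eq fun t => congrArg Units.val (h t)

/-! ### Normalizers and analytic subgroups -/

lemma mem_adNormalizer_of_conj_mem {S : Set (CMat n)} {g : GL (Fin n) ℂ}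
    (h₁ : ∀ X ∈ S, (g : CMat n) * X * ((g⁻¹ : GL (Fin n) ℂ) : CMat n) ∈ S)
    (h₂ : ∀ X ∈ S, ((g⁻¹ : GL (Fin n) ℂ) : CMat n) * X * (g : CMat n) ∈ S) :
    g ∈ adNormalizer S := by
  refine fun X => ⟨h₁ X, fun h => ?_⟩
  have := h₂ _ h
  simpa [mul_assoc] using this

lemma continuous_conj (X : CMat n) : Continuous fun g : GL (Fin n) ℂ =>
    (g : CMat n) * X * ((g⁻¹ : GL (Fin n) ℂ) : CMat n) :=
  (Units.continuous_val.mul continuous_const).mul (Units.continuous_val.comp continuous_inv)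

lemma isClosed_adNormalizer {S : Set (CMat n)} (hS : IsClosed S) :
    IsClosed (adNormalizer S : Set (GL (Fin n) ℂ)) := by
  have : (adNormalizer S : Set (GL (Fin n) ℂ)) = ⋂ X ∈ S,
      {g : GL (Fin n) ℂ | (g : CMat n) * X * ((g⁻¹ : GL (Fin n) ℂ) : CMat n) ∈ S} ∩
      {g : GL (Fin n) ℂ | ((g⁻¹ : GL (Fin n) ℂ) : CMat n) * X * (g : CMat n) ∈ S} := by
    ext g
    simp only [Set.mem_iInter, SetLike.mem_coe, Set.mem_inter_iff, Set.mem_ofPred_eq]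
    constructor
    · intro hg X hX
      refine ⟨(hg X).1 hX, ?_⟩
      have := (inv_mem hg X).1 hX
      rwa [inv_inv] at this
    · exact fun h => mem_adNormalizer_of_conj_mem (fun X hX => (h X hX).1) fun X hX => (h X hX).2
  rw [this]
  refine isClosed_biInter fun X _ => (hS.preimage (continuous_conj X)).inter ?_
  have h2 := (continuous_conj X).comp (continuous_inv (G := GL (Fin n) ℂ))
  simp only [Function.comp_def, inv_inv] at h2
  exact hS.preimage h2

lemma expGL_mem_adNormalizer {W : Submodule ℝ (CMat n)} {Z : CMat n}
    (h : ∀ X ∈ W, Z * X - X * Z ∈ W) : expGL Z ∈ adNormalizer (W : Set (CMat n)) := by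
  refine mem_adNormalizer_of_conj_mem (fun X hX => ?_) fun X hX => ?_
  · rw [coe_expGL_inv]
    exact conj_exp_mem W.closed_of_finiteDimensional h hX
  · rw [coe_expGL_inv, coe_expGL]
    have := conj_exp_mem W.closed_of_finiteDimensional (Z := -Z) (fun X hX => by
      have := W.neg_mem (h X hX)
      rw [neg_sub] at this
      simpa [sub_eq_add_neg, add_comm] using this) hX
    rwa [neg_neg] at this

lemma commutator_mem_of_expGL_mem_adNormalizer {W : Submodule ℝ (CMat n)} {Z : CMat n}
    (h : ∀ t : ℝ, expGL (t • Z) ∈ adNormalizer (W : Set (CMat n))) {X : CMat n} (hX : X ∈ W) :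
    Z * X - X * Z ∈ W := by
  refine commutator_mem_of_forall_conj_exp_mem W.closed_of_finiteDimensional hX fun t => ?_
  have := (h t X).1 hX
  rwa [coe_expGL_inv] at this

lemma expGL_mem_analyticSubgroup {S : Set (CMat n)} {X : CMat n} (hX : X ∈ S) :
    expGL X ∈ analyticSubgroup S := Subgroup.subset_closure ⟨X, hX, rfl⟩

lemma analyticSubgroup_le {S : Set (CMat n)} {G : Subgroup (GL (Fin n) ℂ)}
    (h : ∀ X ∈ S, expGL X ∈ G) : analyticSubgroup S ≤ G := by
  rw [analyticSubgroup, Subgroup.closure_le]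
  rintro _ ⟨X, hX, rfl⟩
  exact h X hX

lemma pathConnectedSpace_analyticSubgroup {S : Set (CMat n)}
    (hS : ∀ (t : ℝ), ∀ X ∈ S, t • X ∈ S) :
    PathConnectedSpace (analyticSubgroup S) := by
  have hj : ∀ g : analyticSubgroup S, Joined 1 g := by
    rintro ⟨g, hg⟩
    induction hg using Subgroup.closure_induction with
    | mem g hg =>
      obtain ⟨X, hX, rfl⟩ := hg
      refine ⟨⟨⟨fun t => ⟨expGL ((t : ℝ) • X), expGL_mem_analyticSubgroup (hS _ X hX)⟩, ?_⟩,
        ?_, ?_⟩⟩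
      · refine Continuous.subtype_mk (continuous_expGL.comp ?_) _
        fun_prop
      · refine Subtype.ext ?_
        simp [expGL_zero]
      · refine Subtype.ext ?_
        simp
    | one => exact Joined.refl _
    | mul g h hg hh ihg ihh =>
      have := ihg.mul ihh
      rwa [one_mul] at this
    | inv g hg ih =>
      have := ih.inv
      rwa [inv_one] at this
  exact ⟨⟨1⟩, fun g h => (hj g).symm.trans (hj h)⟩

/-! ### Closed subgroups near the identity -/

/-- If a closed subgroup contains no one-parameter subgroup with direction in `W`, then it
contains no `exp w` with `w ∈ W` small and nonzero: the directions of a sequence of such `w`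
tending to zero would accumulate at the direction of a one-parameter subgroup. -/
lemma eventually_eq_zero_of_expGL_mem {H : Subgroup (GL (Fin n) ℂ)}
    (hH : IsClosed (H : Set (GL (Fin n) ℂ))) {W : Submodule ℝ (CMat n)}
    (hW : ∀ Z ∈ W, (∀ t : ℝ, expGL (t • Z) ∈ H) → Z = 0) :
    ∀ᶠ Z in 𝓝 (0 : CMat n), Z ∈ W → expGL Z ∈ H → Z = 0 := by
  have : (𝓝 (0 : CMat n)).IsCountablyGenerated :=
    (inferInstance : FirstCountableTopology (Fin n → Fin n → ℂ)).nhds_generated_countable 0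
  by_contra hcon
  rw [Filter.not_eventually] at hcon
  obtain ⟨w, hw0, hw⟩ := Filter.exists_seq_forall_of_frequently hcon
  push Not at hw
  have hpos : ∀ k, 0 < ‖w k‖ := fun k => norm_pos_iff.2 (hw k).2.2
  obtain ⟨u, hu, φ, hφ, hlim⟩ := (isCompact_sphere (0 : CMat n) 1).tendsto_subseq
    (x := fun k => ‖w k‖⁻¹ • w k) fun k => by
      rw [mem_sphere_zero_iff_norm, norm_smul, norm_inv, norm_norm, inv_mul_cancel₀ (hpos k).ne']
  have huW : u ∈ W := W.closed_of_finiteDimensional.mem_of_tendsto hlim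
    (Filter.Eventually.of_forall fun k => W.smul_mem _ (hw _).1)
  have hu0 : u = 0 := by
    refine hW u huW fun t => ?_
    have hnorm : Filter.Tendsto (fun k => ‖w (φ k)‖) Filter.atTop (𝓝 0) := by
      have := (hw0.comp hφ.tendsto_atTop).norm
      rwa [norm_zero] at this
    -- the powers `exp (w k) ^ ⌊t / ‖w k‖⌋` in `H` converge to `exp (t • u)`
    have h1 : Filter.Tendsto (fun k => (⌊t / ‖w (φ k)‖⌋ : ℝ) * ‖w (φ k)‖) Filter.atTop (𝓝 t) := by
      have h2 : Filter.Tendsto (fun k => t - ‖w (φ k)‖) Filter.atTop (𝓝 t) := by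
        simpa using tendsto_const_nhds.sub hnorm
      refine tendsto_of_tendsto_of_tendsto_of_le_of_le h2 tendsto_const_nhds (fun k => ?_)
        fun k => ?_
      · have h3 := (Int.lt_floor_add_one (t / ‖w (φ k)‖)).le
        rw [div_le_iff₀ (hpos _)] at h3
        simp only
        linarith
      · have h3 := Int.floor_le (t / ‖w (φ k)‖)
        rwa [le_div_iff₀ (hpos _)] at h3
    have h4 := continuous_expGL.continuousAt.tendsto.comp (h1.smul hlim)
    refine hH.mem_of_tendsto h4 (Filter.Eventually.of_forall fun k => ?_)
    have h5 : ((⌊t / ‖w (φ k)‖⌋ : ℝ) * ‖w (φ k)‖) • (‖w (φ k)‖⁻¹ • w (φ k)) =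
        ⌊t / ‖w (φ k)‖⌋ • w (φ k) := by
      rw [smul_smul, mul_assoc, mul_inv_cancel₀ (hpos _).ne', mul_one, Int.cast_smul_eq_zsmul]
    simp only [Function.comp_apply, h5, expGL_zsmul]
    exact zpow_mem (hw _).2.1 _
  rw [hu0] at hu
  simp at hu

/-- Coordinates of the second kind on a closed subgroup: if `V₁`, `V₂` consist of directions of
one-parameter subgroups of `H` and span together with `W` the space of all matrices, while `W`
contains no such direction, then the elements of `H` near `1` are products
`exp X * exp Y` with small `X ∈ V₁`, `Y ∈ V₂`. -/
lemma eventually_exists_expGL_mul_expGL {H : Subgroup (GL (Fin n) ℂ)}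
    (hH : IsClosed (H : Set (GL (Fin n) ℂ))) {V₁ V₂ W : Submodule ℝ (CMat n)}
    (h₁ : ∀ X ∈ V₁, expGL X ∈ H) (h₂ : ∀ X ∈ V₂, expGL X ∈ H)
    (hW : ∀ Z ∈ W, (∀ t : ℝ, expGL (t • Z) ∈ H) → Z = 0) (htop : V₁ ⊔ V₂ ⊔ W = ⊤)
    {p : CMat n → Prop} (hp : ∀ᶠ X in 𝓝 (0 : CMat n), p X) :
    ∀ᶠ g in 𝓝 (1 : GL (Fin n) ℂ), g ∈ H →
      ∃ X ∈ V₁, p X ∧ ∃ Y ∈ V₂, g = expGL X * expGL Y := by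
  have hmap := map_nhds_exp_mul_exp_mul_exp htop
  have hw := eventually_eq_zero_of_expGL_mem hH hW
  have h1 : ∀ᶠ x in 𝓝 (0 : V₁ × V₂ × W), p x.1 ∧
      ((x.2.2 : CMat n) ∈ W → expGL (x.2.2 : CMat n) ∈ H → (x.2.2 : CMat n) = 0) := by
    have c1 : Filter.Tendsto (fun x : V₁ × V₂ × W => (x.1 : CMat n)) (𝓝 0) (𝓝 0) :=
      (continuous_subtype_val.comp continuous_fst).tendsto _
    have c2 : Filter.Tendsto (fun x : V₁ × V₂ × W => (x.2.2 : CMat n)) (𝓝 0) (𝓝 0) :=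
      (continuous_subtype_val.comp (continuous_snd.comp continuous_snd)).tendsto _
    exact (c1.eventually hp).and (c2.eventually hw)
  have h2 : ∀ᶠ A in 𝓝 (1 : CMat n), ∃ x : V₁ × V₂ × W,
      A = exp (x.1 : CMat n) * (exp (x.2.1 : CMat n) * exp (x.2.2 : CMat n)) ∧ p x.1 ∧
      ((x.2.2 : CMat n) ∈ W → expGL (x.2.2 : CMat n) ∈ H → (x.2.2 : CMat n) = 0) := by
    refine hmap.symm.le (Filter.mem_map.2 ?_)
    filter_upwards [h1] with x hx
    exact ⟨x, rfl, hx⟩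
  have h3 : Filter.Tendsto (fun g : GL (Fin n) ℂ => (g : CMat n)) (𝓝 1) (𝓝 1) :=
    Units.continuous_val.tendsto 1
  filter_upwards [h3.eventually h2] with g hg hgH
  obtain ⟨⟨x, y, w⟩, hxyw, hpx, hw0⟩ := hg
  have hgx : g = expGL (x : CMat n) * (expGL (y : CMat n) * expGL (w : CMat n)) := Units.ext hxyw
  have hwH : expGL (w : CMat n) ∈ H := by
    have h4 : expGL (w : CMat n) = (expGL (y : CMat n))⁻¹ * ((expGL (x : CMat n))⁻¹ * g) := by
      rw [hgx]
      group
    rw [h4]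
    exact H.mul_mem (H.inv_mem (h₂ _ y.2)) (H.mul_mem (H.inv_mem (h₁ _ x.2)) hgH)
  refine ⟨x, x.2, hpx, y, y.2, ?_⟩
  rw [hgx, hw0 w.2 hwH, expGL_zero, mul_one]

/-- A closed subgroup without one-parameter subgroups meets every compact set in a finite set. -/
lemma finite_inter_of_isCompact {H : Subgroup (GL (Fin n) ℂ)}
    (hH : IsClosed (H : Set (GL (Fin n) ℂ)))
    (h0 : ∀ Z : CMat n, (∀ t : ℝ, expGL (t • Z) ∈ H) → Z = 0) {C : Set (GL (Fin n) ℂ)}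
    (hC : IsCompact C) : ((H : Set (GL (Fin n) ℂ)) ∩ C).Finite := by
  have h1 : ∀ᶠ g in 𝓝 (1 : GL (Fin n) ℂ), g ∈ H → g = 1 := by
    filter_upwards [eventually_exists_expGL_mul_expGL (V₁ := ⊥) (V₂ := ⊥) (W := ⊤) hH
      (by simp [expGL_zero]) (by simp [expGL_zero]) (fun Z _ => h0 Z) (by simp)
      (p := fun _ => True) (Filter.Eventually.of_forall fun _ => trivial)] with g hg hgH
    obtain ⟨X, hX, -, Y, hY, rfl⟩ := hg hgH
    rw [(Submodule.mem_bot ℝ).1 hX, (Submodule.mem_bot ℝ).1 hY, expGL_zero, one_mul]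
  have h2 : DiscreteTopology H := by
    refine discreteTopology_of_isOpen_singleton_one ?_
    rw [isOpen_singleton_iff_nhds_eq_pure, nhds_subtype_eq_comap]
    refine le_antisymm ?_ (pure_le_nhds _ |>.trans_eq (nhds_subtype_eq_comap))
    rw [Filter.le_pure_iff]
    refine Filter.mem_comap.2 ⟨_, h1, fun g hg => Subtype.ext (hg g.2)⟩
  have h3 : IsCompact ((↑) ⁻¹' C : Set H) := hH.isClosedEmbedding_subtypeVal.isCompact_preimage hC
  have h4 := (isCompact_iff_finite.1 h3).image (Subtype.val : H → GL (Fin n) ℂ)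
  exact h4.subset fun g hg => ⟨⟨g, hg.1⟩, hg.2, rfl⟩

end MatrixExp

/-! ### Real forms -/

section RealForm

variable {n : ℕ} {𝔤 : LieSubalgebra ℝ (CMat n)}

/-- A subspace of `𝔤`, as a real space of matrices. -/
def toMat (W : Submodule ℝ 𝔤) : Submodule ℝ (CMat n) := W.map 𝔤.toSubmodule.subtype

/-- The complexification `W ⊕ iW` of a subspace `W` of `𝔤`. -/
def complexify (W : Submodule ℝ 𝔤) : Submodule ℂ (CMat n) :=
  complexSpan ((fun X : 𝔤 => (X : CMat n)) '' (W : Set 𝔤))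

lemma coe_toMat (W : Submodule ℝ 𝔤) :
    (toMat W : Set (CMat n)) = (fun X : 𝔤 => (X : CMat n)) '' (W : Set 𝔤) := rfl

lemma mem_toMat_iff {W : Submodule ℝ 𝔤} {X : 𝔤} : (X : CMat n) ∈ toMat W ↔ X ∈ W := by
  refine ⟨?_, fun h => ⟨X, h, rfl⟩⟩
  rintro ⟨Y, hY, h⟩
  rwa [← Subtype.ext h]

lemma coe_toMat_top : (toMat (⊤ : Submodule ℝ 𝔤) : Set (CMat n)) = 𝔤 := by
  ext X
  exact ⟨fun ⟨Y, _, h⟩ => h ▸ Y.2, fun h => ⟨⟨X, h⟩, trivial, rfl⟩⟩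

lemma complexify_top : complexify (⊤ : Submodule ℝ 𝔤) = complexSpan (𝔤 : Set (CMat n)) := by
  rw [complexify, ← coe_toMat, coe_toMat_top]

lemma coe_mem_complexify {W : Submodule ℝ 𝔤} {X : 𝔤} (hX : X ∈ W) :
    (X : CMat n) ∈ complexify W := Submodule.subset_span ⟨X, hX, rfl⟩

lemma add_I_smul_mem_complexify {W : Submodule ℝ 𝔤} {X Y : 𝔤} (hX : X ∈ W) (hY : Y ∈ W) :
    (X : CMat n) + Complex.I • (Y : CMat n) ∈ complexify W :=
  add_mem (coe_mem_complexify hX) (Submodule.smul_mem _ _ (coe_mem_complexify hY))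

/-- The real subspace `W + iW` is the complex span of `W`. -/
lemma exists_of_mem_complexify {W : Submodule ℝ 𝔤} {Z : CMat n} (hZ : Z ∈ complexify W) :
    ∃ X ∈ W, ∃ Y ∈ W, Z = (X : CMat n) + Complex.I • (Y : CMat n) := by
  induction hZ using Submodule.span_induction with
  | mem Z hZ =>
    obtain ⟨X, hX, rfl⟩ := hZ
    exact ⟨X, hX, 0, W.zero_mem, by simp⟩
  | zero => exact ⟨0, W.zero_mem, 0, W.zero_mem, by simp⟩
  | add Z Z' _ _ h h' =>
    obtain ⟨X, hX, Y, hY, rfl⟩ := h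
    obtain ⟨X', hX', Y', hY', rfl⟩ := h'
    refine ⟨X + X', W.add_mem hX hX', Y + Y', W.add_mem hY hY', ?_⟩
    push_cast
    module
  | smul c Z _ h =>
    obtain ⟨X, hX, Y, hY, rfl⟩ := h
    refine ⟨c.re • X - c.im • Y, W.sub_mem (W.smul_mem _ hX) (W.smul_mem _ hY),
      c.im • X + c.re • Y, W.add_mem (W.smul_mem _ hX) (W.smul_mem _ hY), ?_⟩
    ext i j
    apply Complex.ext <;> simp <;> ring

variable (hr : ∀ X ∈ 𝔤, Complex.I • X ∈ 𝔤 → X = 0)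
include hr

lemma add_I_smul_inj {X Y X' Y' : 𝔤} (h : (X : CMat n) + Complex.I • (Y : CMat n) =
    (X' : CMat n) + Complex.I • (Y' : CMat n)) : X = X' ∧ Y = Y' := by
  have h1 : Complex.I • ((Y - Y' : 𝔤) : CMat n) = ((X' - X : 𝔤) : CMat n) := by
    push_cast
    rw [smul_sub, sub_eq_sub_iff_add_eq_add, add_comm, h, add_comm]
  have h2 : ((Y - Y' : 𝔤) : CMat n) = 0 := hr _ (Y - Y').2 (h1 ▸ (X' - X).2)
  rw [h2, smul_zero] at h1
  exact ⟨(sub_eq_zero.1 (Subtype.ext h1.symm : X' - X = 0)).symm, sub_eq_zero.1 (Subtype.ext h2)⟩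

lemma add_I_smul_mem_complexify_iff {W : Submodule ℝ 𝔤} {X Y : 𝔤} :
    (X : CMat n) + Complex.I • (Y : CMat n) ∈ complexify W ↔ X ∈ W ∧ Y ∈ W := by
  refine ⟨fun h => ?_, fun h => add_I_smul_mem_complexify h.1 h.2⟩
  obtain ⟨X', hX', Y', hY', h'⟩ := exists_of_mem_complexify h
  obtain ⟨rfl, rfl⟩ := add_I_smul_inj hr h'
  exact ⟨hX', hY'⟩

omit hr in
lemma coe_lie_eq (X Y : 𝔤) : ((⁅X, Y⁆ : 𝔤) : CMat n) = (X : CMat n) * Y - Y * X := by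
  rw [LieSubalgebra.coe_bracket, Ring.lie_def]

omit hr in
lemma commutator_add_I_smul (X Y A : 𝔤) :
    ((X : CMat n) + Complex.I • (Y : CMat n)) * A - A * ((X : CMat n) + Complex.I • (Y : CMat n)) =
      ((⁅X, A⁆ : 𝔤) : CMat n) + Complex.I • ((⁅Y, A⁆ : 𝔤) : CMat n) := by
  rw [coe_lie_eq, coe_lie_eq]
  simp only [add_mul, mul_add, smul_mul_assoc, mul_smul_comm, smul_sub]
  abel

end RealForm

/-- The fixed points of an automorphism `θ`, as a subspace. -/
def fixedSubmodule {L : Type} [LieRing L] [LieAlgebra ℝ L] (θ : L ≃ₗ⁅ℝ⁆ L) : Submodule ℝ L :=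
  LinearMap.eqLocus (θ : L →ₗ[ℝ] L) LinearMap.id

/-- The eigenspace of an automorphism `θ` for the eigenvalue `-1`. -/
def antifixedSubmodule {L : Type} [LieRing L] [LieAlgebra ℝ L] (θ : L ≃ₗ⁅ℝ⁆ L) : Submodule ℝ L :=
  LinearMap.eqLocus (θ : L →ₗ[ℝ] L) (-LinearMap.id)

lemma mem_fixedSubmodule {L : Type} [LieRing L] [LieAlgebra ℝ L] {θ : L ≃ₗ⁅ℝ⁆ L} {X : L} :
    X ∈ fixedSubmodule θ ↔ θ X = X := Iff.rfl

lemma mem_antifixedSubmodule {L : Type} [LieRing L] [LieAlgebra ℝ L] {θ : L ≃ₗ⁅ℝ⁆ L} {X : L} :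
    X ∈ antifixedSubmodule θ ↔ θ X = -X := Iff.rfl

section Normalizers

variable {n : ℕ} {𝔤 : LieSubalgebra ℝ (CMat n)}

variable [LieAlgebra.IsKilling ℝ 𝔤]
  {𝔥 : LieSubalgebra ℝ 𝔤} [𝔥.IsCartanSubalgebra] [LieModule.IsTriangularizable ℝ 𝔥 𝔤]
  (Δ : (LieAlgebra.IsKilling.rootSystem 𝔥).Base)
  (hr : ∀ X ∈ 𝔤, Complex.I • X ∈ 𝔤 → X = 0) {θ : 𝔤 ≃ₗ⁅ℝ⁆ 𝔤} (hθ : IsCartanInvolution θ)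

include hr in
/-- A matrix normalizing `𝔤_ℂ` splits into a real and an imaginary derivation of `𝔤`, and both are
inner since `𝔤` is semisimple. -/
lemma exists_commutator_eq {Z : CMat n}
    (h : ∀ X : 𝔤, Z * X - X * Z ∈ complexify (⊤ : Submodule ℝ 𝔤)) :
    ∃ A B : 𝔤, ∀ X : 𝔤, Z * X - X * Z =
      ((⁅A, X⁆ : 𝔤) : CMat n) + Complex.I • ((⁅B, X⁆ : 𝔤) : CMat n) := by
  choose D₁ _ D₂ _ hD using fun X => exists_of_mem_complexify (h X)
  have hadd : ∀ X Y, D₁ (X + Y) = D₁ X + D₁ Y ∧ D₂ (X + Y) = D₂ X + D₂ Y := fun X Y => by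
    refine add_I_smul_inj hr ?_
    rw [← hD]
    push_cast
    have := congrArg₂ (· + ·) (hD X) (hD Y)
    rw [mul_add, add_mul, add_sub_add_comm, this]
    module
  have hsmul : ∀ (c : ℝ) X, D₁ (c • X) = c • D₁ X ∧ D₂ (c • X) = c • D₂ X := fun c X => by
    refine add_I_smul_inj hr ?_
    rw [← hD]
    push_cast
    rw [mul_smul_comm, smul_mul_assoc, ← smul_sub, hD, smul_add, smul_comm c Complex.I]
  have hlie : ∀ X Y, D₁ ⁅X, Y⁆ = ⁅X, D₁ Y⁆ - ⁅Y, D₁ X⁆ ∧ D₂ ⁅X, Y⁆ = ⁅X, D₂ Y⁆ - ⁅Y, D₂ X⁆ := by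
    intro X Y
    refine add_I_smul_inj hr ?_
    have e : Z * ((⁅X, Y⁆ : 𝔤) : CMat n) - ((⁅X, Y⁆ : 𝔤) : CMat n) * Z =
        ((X : CMat n) * (Z * Y - Y * Z) - (Z * Y - Y * Z) * X) -
        ((Y : CMat n) * (Z * X - X * Z) - (Z * X - X * Z) * Y) := by
      rw [coe_lie_eq]
      noncomm_ring
    rw [← hD, e, hD, hD]
    simp only [AddSubgroupClass.coe_sub, coe_lie_eq, mul_add, add_mul, mul_smul_comm,
      smul_mul_assoc, smul_sub]
    abel
  let d (D : 𝔤 → 𝔤) (h1 : ∀ X Y, D (X + Y) = D X + D Y) (h2 : ∀ (c : ℝ) X, D (c • X) = c • D X)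
      (h3 : ∀ X Y, D ⁅X, Y⁆ = ⁅X, D Y⁆ - ⁅Y, D X⁆) : LieDerivation ℝ 𝔤 𝔤 :=
    { toFun := D, map_add' := h1, map_smul' := h2, leibniz' := h3 }
  obtain ⟨A, hA⟩ := LieDerivation.IsKilling.exists_eq_ad (d D₁ (fun X Y => (hadd X Y).1)
    (fun c X => (hsmul c X).1) fun X Y => (hlie X Y).1)
  obtain ⟨B, hB⟩ := LieDerivation.IsKilling.exists_eq_ad (d D₂ (fun X Y => (hadd X Y).2)
    (fun c X => (hsmul c X).2) fun X Y => (hlie X Y).2)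
  refine ⟨A, B, fun X => ?_⟩
  have hA' : ⁅A, X⁆ = D₁ X := by
    rw [← LieAlgebra.ad_apply (R := ℝ), ← LieDerivation.coe_ad_apply_eq_ad_apply, hA]
    rfl
  have hB' : ⁅B, X⁆ = D₂ X := by
    rw [← LieAlgebra.ad_apply (R := ℝ), ← LieDerivation.coe_ad_apply_eq_ad_apply, hB]
    rfl
  rw [hA', hB', hD]

include hr hθ in
/-- A matrix that normalizes `𝔤_ℂ`, both complexified eigenspaces of a Cartan involution and a
complexified Borel subalgebra commutes with `𝔤`. -/
lemma commute_of_normalizes_complexify {Z : CMat n}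
    (h₀ : ∀ X ∈ complexify (⊤ : Submodule ℝ 𝔤), Z * X - X * Z ∈ complexify (⊤ : Submodule ℝ 𝔤))
    (h₁ : ∀ X ∈ complexify (fixedSubmodule θ), Z * X - X * Z ∈ complexify (fixedSubmodule θ))
    (h₂ : ∀ X ∈ complexify (antifixedSubmodule θ),
      Z * X - X * Z ∈ complexify (antifixedSubmodule θ))
    (h₃ : ∀ X ∈ complexify (borelSubmodule Δ), Z * X - X * Z ∈ complexify (borelSubmodule Δ))
    (X : 𝔤) : Z * X - X * Z = 0 := by
  obtain ⟨A, B, hAB⟩ := exists_commutator_eq hr fun X : 𝔤 => h₀ X (coe_mem_complexify trivial)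
  have hW : ∀ W : Submodule ℝ 𝔤, (∀ X ∈ complexify W, Z * X - X * Z ∈ complexify W) →
      ∀ X ∈ W, ⁅A, X⁆ ∈ W ∧ ⁅B, X⁆ ∈ W := by
    intro W h X hX
    rw [← add_I_smul_mem_complexify_iff hr, ← hAB]
    exact h X (coe_mem_complexify hX)
  have hA : A = 0 := hθ.eq_zero_of_normalizes Δ (fun X hX => (hW _ h₁ X hX).1)
    (fun X hX => (hW _ h₂ X hX).1) fun X hX => (hW _ h₃ X hX).1
  have hB : B = 0 := hθ.eq_zero_of_normalizes Δ (fun X hX => (hW _ h₁ X hX).2)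
    (fun X hX => (hW _ h₂ X hX).2) fun X hX => (hW _ h₃ X hX).2
  rw [hAB, hA, hB, zero_lie]
  simp

lemma eq_zero_of_commute (hr : ∀ X ∈ 𝔤, Complex.I • X ∈ 𝔤 → X = 0) {Z : CMat n}
    (hZ : Z ∈ complexify (⊤ : Submodule ℝ 𝔤)) (h : ∀ X : 𝔤, Z * X - X * Z = 0) : Z = 0 := by
  obtain ⟨A, -, B, -, rfl⟩ := exists_of_mem_complexify hZ
  have hAB : ∀ X : 𝔤, ⁅A, X⁆ = 0 ∧ ⁅B, X⁆ = 0 := fun X => by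
    refine add_I_smul_inj hr ?_
    rw [← commutator_add_I_smul, h]
    simp
  rw [eq_zero_of_forall_lie_eq_zero fun X => (hAB X).1,
    eq_zero_of_forall_lie_eq_zero fun X => (hAB X).2]
  simp

/-- The elements of `G(ℂ)` that normalize both complexified eigenspaces of `θ` and the complexified
Borel subalgebra. This group is discrete; it contains `T` and the stabilizer of the base point in
`K(ℂ)`. -/
def borelNormalizer (Gc : Subgroup (GL (Fin n) ℂ)) (θ : 𝔤 ≃ₗ⁅ℝ⁆ 𝔤) : Subgroup (GL (Fin n) ℂ) :=
  Gc ⊓ adNormalizer (complexify (fixedSubmodule θ) : Set (CMat n)) ⊓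
    adNormalizer (complexify (antifixedSubmodule θ) : Set (CMat n)) ⊓
    adNormalizer (complexify (borelSubmodule Δ) : Set (CMat n))

lemma isClosed_complex_submodule (W : Submodule ℂ (CMat n)) : IsClosed (W : Set (CMat n)) :=
  W.closed_of_finiteDimensional

variable {Gc : Subgroup (GL (Fin n) ℂ)} (hGc : IsComplexGroupOf 𝔤 Gc)
include hGc

omit [LieAlgebra.IsKilling ℝ 𝔤] in
lemma IsComplexGroupOf.expGL_mem {Z : CMat n} (hZ : Z ∈ complexify (⊤ : Submodule ℝ 𝔤)) :
    expGL Z ∈ Gc := by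
  rw [complexify_top, ← hGc.lieAlgebra] at hZ
  simpa using hZ 1

omit [LieAlgebra.IsKilling ℝ 𝔤] in
lemma IsComplexGroupOf.mem_complexify_top {Z : CMat n} (hZ : ∀ t : ℝ, expGL (t • Z) ∈ Gc) :
    Z ∈ complexify (⊤ : Submodule ℝ 𝔤) := by
  rw [complexify_top]
  exact (hGc.lieAlgebra Z).1 hZ

lemma isClosed_borelNormalizer :
    IsClosed (borelNormalizer Δ Gc θ : Set (GL (Fin n) ℂ)) :=
  ((hGc.isClosed.inter (isClosed_adNormalizer (isClosed_complex_submodule _))).inter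
    (isClosed_adNormalizer (isClosed_complex_submodule _))).inter
    (isClosed_adNormalizer (isClosed_complex_submodule _))

omit hGc [LieAlgebra.IsKilling ℝ 𝔤] in
lemma commutator_mem_complexify {V W : Submodule ℝ 𝔤} (h : ∀ X ∈ V, ∀ Y ∈ W, ⁅X, Y⁆ ∈ W)
    {Z X : CMat n} (hZ : Z ∈ complexify V) (hX : X ∈ complexify W) :
    Z * X - X * Z ∈ complexify W := by
  obtain ⟨A, hA, B, hB, rfl⟩ := exists_of_mem_complexify hZ
  obtain ⟨C, hC, D, hD, rfl⟩ := exists_of_mem_complexify hX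
  have e : ((A : CMat n) + Complex.I • (B : CMat n)) * ((C : CMat n) + Complex.I • (D : CMat n)) -
      ((C : CMat n) + Complex.I • (D : CMat n)) * ((A : CMat n) + Complex.I • (B : CMat n)) =
      (((⁅A, C⁆ : 𝔤) : CMat n) + Complex.I • ((⁅B, C⁆ : 𝔤) : CMat n)) +
      Complex.I • (((⁅A, D⁆ : 𝔤) : CMat n) + Complex.I • ((⁅B, D⁆ : 𝔤) : CMat n)) := by
    rw [← commutator_add_I_smul, ← commutator_add_I_smul]
    simp only [add_mul, mul_add, smul_mul_assoc, mul_smul_comm, smul_sub, smul_add]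
    abel
  rw [e]
  exact add_mem (add_I_smul_mem_complexify (h A hA C hC) (h B hB C hC))
    (Submodule.smul_mem _ _ (add_I_smul_mem_complexify (h A hA D hD) (h B hB D hD)))

omit hGc [LieAlgebra.IsKilling ℝ 𝔤] in
lemma commutator_mem_complexify_top {Z X : CMat n} (hZ : Z ∈ complexify (⊤ : Submodule ℝ 𝔤))
    (hX : X ∈ complexify (⊤ : Submodule ℝ 𝔤)) :
    Z * X - X * Z ∈ complexify (⊤ : Submodule ℝ 𝔤) :=
  commutator_mem_complexify (V := ⊤) (W := ⊤) (fun _ _ _ _ => trivial) hZ hX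

include hθ in
lemma eq_zero_of_expGL_mem_borelNormalizer {Z : CMat n}
    (hZ : ∀ t : ℝ, expGL (t • Z) ∈ borelNormalizer Δ Gc θ) : Z = 0 := by
  have hZg := hGc.mem_complexify_top fun t => (hZ t).1.1.1
  have key : ∀ W : Submodule ℝ 𝔤,
      (∀ t : ℝ, expGL (t • Z) ∈ adNormalizer (complexify W : Set (CMat n))) →
      ∀ X ∈ complexify W, Z * X - X * Z ∈ complexify W := fun W h X hX =>
    commutator_mem_of_expGL_mem_adNormalizer (W := (complexify W).restrictScalars ℝ) h hX
  exact eq_zero_of_commute hGc.real_form hZg (commute_of_normalizes_complexify Δ hGc.real_form hθ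
    (fun X hX => commutator_mem_complexify_top hZg hX) (key _ fun t => (hZ t).1.1.2)
    (key _ fun t => (hZ t).1.2) (key _ fun t => (hZ t).2))

include hθ in
lemma finite_borelNormalizer_inter {C : Set (GL (Fin n) ℂ)} (hC : IsCompact C) :
    ((borelNormalizer Δ Gc θ : Set (GL (Fin n) ℂ)) ∩ C).Finite :=
  finite_inter_of_isCompact (isClosed_borelNormalizer Δ hGc)
    (fun _ hZ => eq_zero_of_expGL_mem_borelNormalizer Δ hθ hGc hZ) hC

end Normalizers

/-! ### The adjoint action of the real group -/

section RealGroup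

variable {n : ℕ} {𝔤 : LieSubalgebra ℝ (CMat n)}

/-- The adjoint action of an element normalizing `𝔤`, as an automorphism of `𝔤`. -/
def adEquiv (g : adNormalizer (𝔤 : Set (CMat n))) : 𝔤 ≃ₗ⁅ℝ⁆ 𝔤 where
  toFun X := ⟨(g : GL (Fin n) ℂ) * X * ((g⁻¹ : GL (Fin n) ℂ) : CMat n), (g.2 X).1 X.2⟩
  invFun X := ⟨((g⁻¹ : GL (Fin n) ℂ) : CMat n) * X * (g : GL (Fin n) ℂ), by
    have := (inv_mem g.2 X).1 X.2
    rwa [inv_inv] at this⟩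
  map_add' X Y := Subtype.ext (by simp [mul_add, add_mul])
  map_smul' c X := Subtype.ext (by simp)
  map_lie' {X Y} := Subtype.ext (by simp [Ring.lie_def, mul_sub, sub_mul, mul_assoc])
  left_inv X := Subtype.ext (by simp [mul_assoc])
  right_inv X := Subtype.ext (by simp [mul_assoc])

lemma coe_adEquiv (g : adNormalizer (𝔤 : Set (CMat n))) (X : 𝔤) : (adEquiv g X : CMat n) =
    (g : GL (Fin n) ℂ) * (X : CMat n) * ((g⁻¹ : GL (Fin n) ℂ) : CMat n) := rfl

lemma adEquiv_mul (g h : adNormalizer (𝔤 : Set (CMat n))) (X : 𝔤) :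
    adEquiv (g * h) X = adEquiv g (adEquiv h X) :=
  Subtype.ext (by simp [coe_adEquiv, mul_assoc])

lemma adEquiv_one (X : 𝔤) : adEquiv 1 X = X := Subtype.ext (by simp [coe_adEquiv])

lemma adEquiv_inv (g : adNormalizer (𝔤 : Set (CMat n))) (X : 𝔤) :
    adEquiv g⁻¹ X = (adEquiv g).symm X := by
  rw [← (adEquiv g).symm_apply_apply (adEquiv g⁻¹ X), ← adEquiv_mul, mul_inv_cancel, adEquiv_one]

lemma expGL_mem_adNormalizer_self (X : 𝔤) : expGL (X : CMat n) ∈ adNormalizer (𝔤 : Set (CMat n)) :=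
  expGL_mem_adNormalizer (W := 𝔤.toSubmodule) fun Y hY => by
    have := 𝔤.lie_mem X.2 hY
    rwa [Ring.lie_def] at this

lemma realGroup_le_adNormalizer : realGroup 𝔤 ≤ adNormalizer (𝔤 : Set (CMat n)) :=
  analyticSubgroup_le fun X hX => expGL_mem_adNormalizer_self ⟨X, hX⟩

lemma mem_adNormalizer_toMat_iff (g : adNormalizer (𝔤 : Set (CMat n))) (W : Submodule ℝ 𝔤) :
    (g : GL (Fin n) ℂ) ∈ adNormalizer (toMat W : Set (CMat n)) ↔ ∀ X, X ∈ W ↔ adEquiv g X ∈ W := by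
  constructor
  · intro h X
    rw [← mem_toMat_iff, ← mem_toMat_iff]
    exact h X
  · intro h
    refine mem_adNormalizer_of_conj_mem ?_ ?_
    · rintro _ ⟨X, hX, rfl⟩
      exact ⟨_, (h X).1 hX, rfl⟩
    · rintro _ ⟨X, hX, rfl⟩
      refine ⟨(adEquiv g).symm X, (h _).2 ?_, rfl⟩
      rwa [LieEquiv.apply_symm_apply]

lemma adNormalizer_toMat_le (W : Submodule ℝ 𝔤) :
    adNormalizer (toMat W : Set (CMat n)) ≤ adNormalizer (complexify W : Set (CMat n)) := by
  have key : ∀ g ∈ adNormalizer (toMat W : Set (CMat n)), ∀ X ∈ complexify W,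
      (g : CMat n) * X * ((g⁻¹ : GL (Fin n) ℂ) : CMat n) ∈ complexify W := by
    intro g hg X hX
    induction hX using Submodule.span_induction with
    | mem X hX => exact Submodule.subset_span ((hg X).1 hX)
    | zero => simp
    | add X Y _ _ hX hY =>
      rw [mul_add, add_mul]
      exact add_mem hX hY
    | smul c X _ hX =>
      rw [mul_smul_comm, smul_mul_assoc]
      exact Submodule.smul_mem _ _ hX
  intro g hg
  refine mem_adNormalizer_of_conj_mem (key g hg) fun X hX => ?_
  have := key g⁻¹ (inv_mem hg) X hX
  rwa [inv_inv] at this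

variable {θ : 𝔤 ≃ₗ⁅ℝ⁆ 𝔤} {Θ : realGroup 𝔤 →* realGroup 𝔤}

/-- The involution `Θ` of the group intertwines the adjoint action with `θ`. -/
lemma theta_adEquiv (hΘ : ∀ X : 𝔤, Θ (realExp X) = realExp (θ X)) (g : realGroup 𝔤) (X : 𝔤) :
    θ (adEquiv ⟨g, realGroup_le_adNormalizer g.2⟩ X) =
      adEquiv ⟨Θ g, realGroup_le_adNormalizer (Θ g).2⟩ (θ X) := by
  have hconj : ∀ (g : realGroup 𝔤) (X : 𝔤),
      realExp (adEquiv ⟨g, realGroup_le_adNormalizer g.2⟩ X) = g * realExp X * g⁻¹ :=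
    fun g X => Subtype.ext (expGL_conj _ _)
  refine Subtype.ext (eq_of_forall_expGL_smul_eq fun t => ?_)
  have h1 : realExp (θ (adEquiv ⟨g, realGroup_le_adNormalizer g.2⟩ (t • X))) =
      realExp (adEquiv ⟨Θ g, realGroup_le_adNormalizer (Θ g).2⟩ (θ (t • X))) := by
    rw [hconj, ← hΘ, hconj, map_mul, map_mul, map_inv, hΘ]
  rw [map_smul, map_smul, map_smul, map_smul] at h1
  exact congrArg Subtype.val h1

lemma fixedGroup_le_realGroup : fixedGroup Θ ≤ realGroup 𝔤 := by
  rintro _ ⟨g, -, rfl⟩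
  exact g.2

lemma theta_adEquiv_of_mem_fixedGroup (hΘ : ∀ X : 𝔤, Θ (realExp X) = realExp (θ X))
    {g : GL (Fin n) ℂ} (hg : g ∈ fixedGroup Θ) (X : 𝔤) :
    θ (adEquiv ⟨g, realGroup_le_adNormalizer (fixedGroup_le_realGroup hg)⟩ X) =
      adEquiv ⟨g, realGroup_le_adNormalizer (fixedGroup_le_realGroup hg)⟩ (θ X) := by
  obtain ⟨g, hg', rfl⟩ := hg
  have hg'' : Θ g = g := hg'
  have := theta_adEquiv hΘ g X
  simp only [hg''] at this
  exact this

lemma expGL_mem_fixedGroup (hΘ : ∀ X : 𝔤, Θ (realExp X) = realExp (θ X)) {X : 𝔤}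
    (hX : X ∈ fixedSubmodule θ) : expGL (X : CMat n) ∈ fixedGroup Θ := by
  refine ⟨realExp X, ?_, rfl⟩
  have h : Θ (realExp X) = realExp X := by
    rw [hΘ, mem_fixedSubmodule.1 hX]
  exact h

/-- An element whose adjoint action commutes with `θ` normalizes the eigenspaces of `θ`. -/
lemma mem_adNormalizer_of_theta_comm {g : adNormalizer (𝔤 : Set (CMat n))}
    (h : ∀ X, θ (adEquiv g X) = adEquiv g (θ X)) :
    (g : GL (Fin n) ℂ) ∈ adNormalizer (toMat (fixedSubmodule θ) : Set (CMat n)) ∧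
    (g : GL (Fin n) ℂ) ∈ adNormalizer (toMat (antifixedSubmodule θ) : Set (CMat n)) := by
  rw [mem_adNormalizer_toMat_iff, mem_adNormalizer_toMat_iff]
  refine ⟨fun X => ?_, fun X => ?_⟩
  · rw [mem_fixedSubmodule, mem_fixedSubmodule, h, EquivLike.injective (adEquiv g) |>.eq_iff]
  · rw [mem_antifixedSubmodule, mem_antifixedSubmodule, h, ← map_neg,
      EquivLike.injective (adEquiv g) |>.eq_iff]

lemma IsComplexGroupOf.realGroup_le {Gc : Subgroup (GL (Fin n) ℂ)} (hGc : IsComplexGroupOf 𝔤 Gc) :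
    realGroup 𝔤 ≤ Gc :=
  analyticSubgroup_le fun X hX => hGc.expGL_mem (coe_mem_complexify (X := ⟨X, hX⟩) trivial)

/-- The group `T = K ∩ B` is finite. -/
lemma finite_torusPart [LieAlgebra.IsKilling ℝ 𝔤]
    {𝔥 : LieSubalgebra ℝ 𝔤} [𝔥.IsCartanSubalgebra] [LieModule.IsTriangularizable ℝ 𝔥 𝔤]
    (Δ : (LieAlgebra.IsKilling.rootSystem 𝔥).Base)
    {Gc : Subgroup (GL (Fin n) ℂ)} (hGc : IsComplexGroupOf 𝔤 Gc) (hθ : IsCartanInvolution θ)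
    (hΘ : ∀ X : 𝔤, Θ (realExp X) = realExp (θ X))
    {K : Subgroup (GL (Fin n) ℂ)} (hK : IsCompact (K : Set (GL (Fin n) ℂ)))
    (hKΘ : K = fixedGroup Θ) : Finite (torusPart 𝔥 Δ K) := by
  have hfin := finite_borelNormalizer_inter Δ hθ hGc hK
  have hmem : ∀ t : torusPart 𝔥 Δ K, ((t : K) : GL (Fin n) ℂ) ∈
      (borelNormalizer Δ Gc θ : Set (GL (Fin n) ℂ)) ∩ K := by
    rintro ⟨⟨t, htK⟩, htB⟩
    have htB' : t ∈ realBorel 𝔥 Δ := htB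
    have htΘ : t ∈ fixedGroup Θ := hKΘ ▸ htK
    have h1 := mem_adNormalizer_of_theta_comm (theta_adEquiv_of_mem_fixedGroup hΘ htΘ)
    exact ⟨⟨⟨⟨hGc.realGroup_le htB'.1, adNormalizer_toMat_le _ h1.1⟩,
      adNormalizer_toMat_le _ h1.2⟩, adNormalizer_toMat_le (borelSubmodule Δ) htB'.2⟩, htK⟩
  have : Finite ((borelNormalizer Δ Gc θ : Set (GL (Fin n) ℂ)) ∩ K : Set (GL (Fin n) ℂ)) := hfin
  refine Finite.of_injective (fun t => (⟨_, hmem t⟩ :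
    ((borelNormalizer Δ Gc θ : Set (GL (Fin n) ℂ)) ∩ K : Set (GL (Fin n) ℂ)))) fun s t h => ?_
  have h' : ((s : K) : GL (Fin n) ℂ) = (t : K) := by
    have h1 := congrArg Subtype.val h
    exact h1
  exact Subtype.ext (Subtype.ext h')

end RealGroup

/-! ### The Cartan decomposition of automorphisms of the Lie algebra -/

section LinearAlgebra

open Module

variable {V : Type} [AddCommGroup V] [Module ℝ V] [FiniteDimensional ℝ V]

/-- The spectral theorem for an operator that is symmetric for a positive definite form. -/
lemma exists_orthonormal_eigenbasis (B : V →ₗ[ℝ] V →ₗ[ℝ] ℝ) (hsymm : ∀ x y, B x y = B y x)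
    (hpos : ∀ x, x ≠ 0 → 0 < B x x) (T : V →ₗ[ℝ] V) (hT : ∀ x y, B (T x) y = B x (T y)) :
    ∃ (b : Basis (Fin (finrank ℝ V)) ℝ V) (a : Fin (finrank ℝ V) → ℝ),
      (∀ i, T (b i) = a i • b i) ∧ ∀ i j, B (b i) (b j) = if i = j then 1 else 0 := by
  let core : InnerProductSpace.Core ℝ V :=
    { inner := fun x y => B x y
      conj_inner_symm := fun x y => by simp [hsymm x y]
      re_inner_nonneg := fun x => by
        by_cases hx : x = 0
        · simp [hx]
        · exact (hpos x hx).le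
      add_left := fun x y z => by simp
      smul_left := fun x y r => by simp
      definite := fun x h => by
        by_contra hx
        exact (hpos x hx).ne' h }
  let _ : NormedAddCommGroup V := @InnerProductSpace.Core.toNormedAddCommGroup ℝ V _ _ _ core
  let _ : InnerProductSpace ℝ V := InnerProductSpace.ofCore core.toCore
  have hsym : T.IsSymmetric := hT
  refine ⟨(hsym.eigenvectorBasis rfl).toBasis, hsym.eigenvalues rfl, fun i => ?_, fun i j => ?_⟩
  · rw [OrthonormalBasis.coe_toBasis]
    exact hsym.apply_eigenvectorBasis rfl i
  · rw [OrthonormalBasis.coe_toBasis]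
    exact orthonormal_iff_ite.1 (hsym.eigenvectorBasis rfl).orthonormal i j

omit [FiniteDimensional ℝ V] in
/-- Functional calculus: an operator `D` that acts by `f (l i)` on an eigenbasis of `q` acts by
`f r` on every eigenvector of `q` with eigenvalue `r`. -/
lemma apply_eq_of_eigenbasis {ι : Type} [Finite ι] (b : Basis ι ℝ V) {q D : V →ₗ[ℝ] V} {l : ι → ℝ}
    (f : ℝ → ℝ) (hq : ∀ i, q (b i) = l i • b i) (hD : ∀ i, D (b i) = f (l i) • b i) {v : V} {r : ℝ}
    (hv : q v = r • v) : D v = f r • v := by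
  have := Fintype.ofFinite ι
  have hrepr : ∀ (T : V →ₗ[ℝ] V) (c : ι → ℝ), (∀ i, T (b i) = c i • b i) →
      ∀ i, b.repr (T v) i = c i * b.repr v i := by
    intro T c hT i
    have h1 : T v = ∑ j, (c j * b.repr v j) • b j := by
      conv_lhs => rw [← b.sum_repr v]
      rw [map_sum]
      refine Finset.sum_congr rfl fun j _ => ?_
      rw [map_smul, hT, smul_smul, mul_comm]
    rw [h1, b.repr_sum_self]
  refine b.repr.injective (Finsupp.ext fun i => ?_)
  have h2 := hrepr q l hq i
  rw [hv, map_smul, Finsupp.smul_apply, smul_eq_mul] at h2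
  rw [hrepr D _ hD, map_smul, Finsupp.smul_apply, smul_eq_mul]
  by_cases h0 : b.repr v i = 0
  · rw [h0, mul_zero, mul_zero]
  · rw [mul_right_cancel₀ h0 h2]

omit [FiniteDimensional ℝ V] in
lemma trace_eq_sum_of_eigenbasis {ι : Type} [Fintype ι] (b : Basis ι ℝ V) {q : V →ₗ[ℝ] V}
    {l : ι → ℝ} (hq : ∀ i, q (b i) = l i • b i) : LinearMap.trace ℝ V q = ∑ i, l i := by
  classical
  rw [LinearMap.trace_eq_matrix_trace ℝ b, Matrix.trace]
  refine Finset.sum_congr rfl fun i _ => ?_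
  simp [LinearMap.toMatrix_apply, hq]

end LinearAlgebra

section CartanForm

open Module

variable {L : Type} [LieRing L] [LieAlgebra ℝ L] {θ : L ≃ₗ⁅ℝ⁆ L}

/-- The positive definite form `-κ(X, θ Y)`, with `κ` the Killing form, attached to a Cartan
involution. -/
def cartanForm (θ : L ≃ₗ⁅ℝ⁆ L) : L →ₗ[ℝ] L →ₗ[ℝ] ℝ :=
  -(killingForm ℝ L).compl₂ (θ : L →ₗ[ℝ] L)

lemma cartanForm_apply (X Y : L) : cartanForm θ X Y = -killingForm ℝ L X (θ Y) := rfl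

lemma killingForm_lieEquiv (A : L ≃ₗ⁅ℝ⁆ L) (X Y : L) :
    killingForm ℝ L (A X) (A Y) = killingForm ℝ L X Y :=
  LieAlgebra.killingForm_of_equiv_apply A X Y

namespace IsCartanInvolution

variable (hθ : IsCartanInvolution θ)
include hθ

lemma cartanForm_comm (X Y : L) : cartanForm θ X Y = cartanForm θ Y X := by
  rw [cartanForm_apply, cartanForm_apply, ← killingForm_lieEquiv θ, hθ.involutive,
    LieModule.traceForm_comm]

lemma cartanForm_pos {X : L} (hX : X ≠ 0) : 0 < cartanForm θ X X :=
  neg_pos.2 (hθ.negative X hX)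

omit hθ in
lemma cartanForm_lie {Y : L} (hY : θ Y = -Y) (X Z : L) :
    cartanForm θ ⁅Y, X⁆ Z = cartanForm θ X ⁅Y, Z⁆ := by
  have h : ⁅Y, θ Z⁆ = -θ ⁅Y, Z⁆ := by
    rw [LieEquiv.map_lie, hY, neg_lie, neg_neg]
  rw [cartanForm_apply, cartanForm_apply, ← lie_skew, map_neg, LinearMap.neg_apply,
    LieModule.traceForm_apply_lie_apply, h, map_neg, neg_neg]

variable [FiniteDimensional ℝ L]

/-- The adjoint action of an element `Y` with `θ Y = -Y` is diagonalizable. -/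
lemma exists_eigenbasis_lie {Y : L} (hY : θ Y = -Y) :
    ∃ (b : Basis (Fin (finrank ℝ L)) ℝ L) (a : Fin (finrank ℝ L) → ℝ),
      ∀ i, ⁅Y, b i⁆ = a i • b i := by
  obtain ⟨b, a, h, -⟩ := exists_orthonormal_eigenbasis (cartanForm θ) hθ.cartanForm_comm
    (fun _ => hθ.cartanForm_pos) (LieAlgebra.ad ℝ L Y) (IsCartanInvolution.cartanForm_lie hY)
  exact ⟨b, a, h⟩

/-- The infinitesimal form of the Cartan decomposition of an automorphism `A`: the positive
automorphism `θ A⁻¹ θ A` is `exp (2 ad Y)` for some `Y` with `θ Y = -Y`. -/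
lemma exists_lie_eigenbasis_of_automorphism [LieAlgebra.IsKilling ℝ L] (A : L ≃ₗ⁅ℝ⁆ L) :
    ∃ Y : L, θ Y = -Y ∧ ∃ (b : Basis (Fin (finrank ℝ L)) ℝ L) (a : Fin (finrank ℝ L) → ℝ),
      (∀ i, ⁅Y, b i⁆ = a i • b i) ∧
      ∀ i, θ (A.symm (θ (A (b i)))) = Real.exp (2 * a i) • b i := by
  let q : L →ₗ[ℝ] L := (θ : L →ₗ[ℝ] L) ∘ₗ (A.symm : L →ₗ[ℝ] L) ∘ₗ (θ : L →ₗ[ℝ] L) ∘ₗ (A : L →ₗ[ℝ] L)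
  have hq_apply : ∀ X, q X = θ (A.symm (θ (A X))) := fun X => rfl
  have hqB : ∀ X Y, cartanForm θ (q X) Y = cartanForm θ (A Y) (A X) := by
    intro X Y
    rw [cartanForm_apply, cartanForm_apply, hq_apply, killingForm_lieEquiv,
      ← killingForm_lieEquiv A, LieEquiv.apply_symm_apply, LieModule.traceForm_comm]
  obtain ⟨b, l, hl, hB⟩ := exists_orthonormal_eigenbasis (cartanForm θ) hθ.cartanForm_comm
    (fun _ => hθ.cartanForm_pos) q fun X Y => by
      rw [hqB, hθ.cartanForm_comm X, hqB, hθ.cartanForm_comm]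
  have hlpos : ∀ i, 0 < l i := by
    intro i
    have h1 := hqB (b i) (b i)
    rw [hl, map_smul, LinearMap.smul_apply, hB, if_pos rfl, smul_eq_mul, mul_one] at h1
    rw [h1]
    refine hθ.cartanForm_pos fun h0 => b.ne_zero i ?_
    rw [← A.symm_apply_apply (b i), h0, map_zero]
  -- half the logarithm of the positive automorphism `q` is a derivation, hence inner
  let D : L →ₗ[ℝ] L := b.constr ℝ fun i => (Real.log (l i) / 2) • b i
  have hDb : ∀ i, D (b i) = (Real.log (l i) / 2) • b i := fun i => b.constr_basis ℝ _ i
  have hD : ∀ {v : L} {r : ℝ}, q v = r • v → D v = (Real.log r / 2) • v := fun hv =>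
    apply_eq_of_eigenbasis b (fun r => Real.log r / 2) hl hDb hv
  have hder₁ : ∀ i j, D ⁅b i, b j⁆ = ⁅b i, D (b j)⁆ + ⁅D (b i), b j⁆ := by
    intro i j
    have h1 : q ⁅b i, b j⁆ = (l i * l j) • ⁅b i, b j⁆ := by
      have h2 : q ⁅b i, b j⁆ = ⁅q (b i), q (b j)⁆ := by
        simp only [hq_apply, LieEquiv.map_lie]
      rw [h2, hl, hl, smul_lie, lie_smul, smul_smul]
    rw [hD h1, hDb, hDb, Real.log_mul (hlpos i).ne' (hlpos j).ne', smul_lie, lie_smul, add_div]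
    module
  have hder₂ : ∀ i, D ∘ₗ LieAlgebra.ad ℝ L (b i) =
      LieAlgebra.ad ℝ L (b i) ∘ₗ D + LieAlgebra.ad ℝ L (D (b i)) := fun i =>
    b.ext fun j => hder₁ i j
  have hder₃ : (LinearMap.mulLeft ℝ D) ∘ₗ (LieAlgebra.ad ℝ L : L →ₗ[ℝ] Module.End ℝ L) =
      (LinearMap.mulRight ℝ D) ∘ₗ (LieAlgebra.ad ℝ L : L →ₗ[ℝ] Module.End ℝ L) +
      (LieAlgebra.ad ℝ L : L →ₗ[ℝ] Module.End ℝ L) ∘ₗ D := b.ext hder₂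
  have hder : ∀ X Y, D ⁅X, Y⁆ = ⁅X, D Y⁆ + ⁅D X, Y⁆ := fun X Y =>
    LinearMap.congr_fun (LinearMap.congr_fun hder₃ X) Y
  obtain ⟨Y, hY⟩ := LieDerivation.IsKilling.exists_eq_ad
    ({ toLinearMap := D
       leibniz' := fun X Y => by
        change D ⁅X, Y⁆ = ⁅X, D Y⁆ - ⁅Y, D X⁆
        rw [hder, ← lie_skew Y, sub_neg_eq_add] } : LieDerivation ℝ L L)
  have hYD : ∀ X, ⁅Y, X⁆ = D X := fun X => by
    rw [← LieAlgebra.ad_apply (R := ℝ), ← LieDerivation.coe_ad_apply_eq_ad_apply, hY]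
  refine ⟨Y, ?_, b, fun i => Real.log (l i) / 2, fun i => by rw [hYD, hDb], fun i => ?_⟩
  · rw [eq_neg_iff_add_eq_zero]
    refine eq_zero_of_forall_lie_eq_zero fun X => ?_
    have h1 : (D ∘ₗ (θ : L →ₗ[ℝ] L)) = -((θ : L →ₗ[ℝ] L) ∘ₗ D) := by
      refine b.ext fun i => ?_
      have h2 : q (θ (b i)) = (l i)⁻¹ • θ (b i) := by
        have h3 : q (θ (q (b i))) = θ (b i) := by
          simp only [hq_apply, hθ.involutive, LieEquiv.apply_symm_apply, LieEquiv.symm_apply_apply]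
        rw [hl, map_smul, map_smul] at h3
        rw [eq_inv_smul_iff₀ (hlpos i).ne', h3]
      change D (θ (b i)) = -θ (D (b i))
      rw [hD h2, hDb, Real.log_inv, map_smul]
      module
    have h4 : ⁅θ Y, X⁆ = θ (D (θ X)) := by
      rw [← hYD, LieEquiv.map_lie, hθ.involutive]
    have h5 : D (θ X) = -θ (D X) := LinearMap.congr_fun h1 X
    rw [add_lie, h4, h5, map_neg, hθ.involutive, hYD, neg_add_cancel]
  · rw [← hq_apply, hl, mul_div_cancel₀ _ two_ne_zero, Real.exp_log (hlpos i)]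

end IsCartanInvolution

end CartanForm

/-! ### The Cartan decomposition of the group -/

section CartanDecomposition

open Module

variable {n : ℕ} {𝔤 : LieSubalgebra ℝ (CMat n)}

/-- The exponential of an element of `𝔤`, as an element normalizing `𝔤`. -/
def expAd (Y : 𝔤) : adNormalizer (𝔤 : Set (CMat n)) :=
  ⟨expGL (Y : CMat n), expGL_mem_adNormalizer_self Y⟩

section
attribute [local instance] Matrix.linftyOpNormedRing Matrix.linftyOpNormedAlgebra

lemma conj_expGL_of_commutator_eq_smul {Z X : CMat n} {a : ℝ} (h : Z * X - X * Z = a • X) :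
    (expGL Z : CMat n) * X * (((expGL Z)⁻¹ : GL (Fin n) ℂ) : CMat n) = Real.exp a • X := by
  rw [coe_expGL_inv]
  exact conj_exp_of_commutator_eq_smul h

end

lemma adEquiv_expAd_of_lie_eq_smul {Y X : 𝔤} {a : ℝ} (h : ⁅Y, X⁆ = a • X) :
    adEquiv (expAd Y) X = Real.exp a • X := by
  refine Subtype.ext (conj_expGL_of_commutator_eq_smul ?_)
  rw [← coe_lie_eq, h]
  rfl

lemma adEquiv_expAd_twice_of_lie_eq_smul {Y X : 𝔤} {a : ℝ} (h : ⁅Y, X⁆ = a • X) :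
    adEquiv (expAd Y) (adEquiv (expAd Y) X) = Real.exp (2 * a) • X := by
  rw [adEquiv_expAd_of_lie_eq_smul h, map_smul, adEquiv_expAd_of_lie_eq_smul h,
    smul_smul, ← Real.exp_add, two_mul]

variable [LieAlgebra.IsKilling ℝ 𝔤] {θ : 𝔤 ≃ₗ⁅ℝ⁆ 𝔤} (hθ : IsCartanInvolution θ)
include hθ

omit [LieAlgebra.IsKilling ℝ 𝔤] in
lemma adEquiv_expAd_theta {Y : 𝔤} (hY : θ Y = -Y) (X : 𝔤) :
    adEquiv (expAd Y) (θ (adEquiv (expAd Y) X)) = θ X := by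
  obtain ⟨b, a, hb⟩ := hθ.exists_eigenbasis_lie hY
  let E : 𝔤 →ₗ[ℝ] 𝔤 := (adEquiv (expAd Y) : 𝔤 →ₗ[ℝ] 𝔤)
  have h : E ∘ₗ (θ : 𝔤 →ₗ[ℝ] 𝔤) ∘ₗ E = (θ : 𝔤 →ₗ[ℝ] 𝔤) := by
    refine b.ext fun i => ?_
    have h1 : ⁅Y, θ (b i)⁆ = (-a i) • θ (b i) := by
      have h2 : ⁅Y, θ (b i)⁆ = -θ ⁅Y, b i⁆ := by
        rw [LieEquiv.map_lie, hY, neg_lie, neg_neg]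
      rw [h2, hb, map_smul, neg_smul]
    change adEquiv (expAd Y) (θ (adEquiv (expAd Y) (b i))) = θ (b i)
    rw [adEquiv_expAd_of_lie_eq_smul (hb i), map_smul, map_smul, adEquiv_expAd_of_lie_eq_smul h1,
      smul_smul, ← Real.exp_add, add_neg_cancel, Real.exp_zero, one_smul]
  exact LinearMap.congr_fun h X

/-- Existence of the Cartan decomposition: every automorphism of `𝔤` that is induced by a matrix
is, up to a factor `exp Y` with `θ Y = -Y`, one commuting with `θ`. -/
lemma exists_theta_comm_mul_expAd (g : adNormalizer (𝔤 : Set (CMat n))) :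
    ∃ Y : 𝔤, θ Y = -Y ∧ ∀ X, θ (adEquiv (g * (expAd Y)⁻¹) X) = adEquiv (g * (expAd Y)⁻¹) (θ X) := by
  obtain ⟨Y, hY, b, a, hb, hq⟩ := hθ.exists_lie_eigenbasis_of_automorphism (adEquiv g)
  refine ⟨Y, hY, ?_⟩
  have hEE : ∀ X, θ ((adEquiv g).symm (θ (adEquiv g X))) =
      adEquiv (expAd Y) (adEquiv (expAd Y) X) := by
    let q : 𝔤 →ₗ[ℝ] 𝔤 := (θ : 𝔤 →ₗ[ℝ] 𝔤) ∘ₗ ((adEquiv g).symm : 𝔤 →ₗ[ℝ] 𝔤) ∘ₗ (θ : 𝔤 →ₗ[ℝ] 𝔤) ∘ₗ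
      (adEquiv g : 𝔤 →ₗ[ℝ] 𝔤)
    have h : q = (adEquiv (expAd Y) : 𝔤 →ₗ[ℝ] 𝔤) ∘ₗ (adEquiv (expAd Y) : 𝔤 →ₗ[ℝ] 𝔤) := by
      refine b.ext fun i => ?_
      change θ ((adEquiv g).symm (θ (adEquiv g (b i)))) =
        adEquiv (expAd Y) (adEquiv (expAd Y) (b i))
      rw [hq, adEquiv_expAd_twice_of_lie_eq_smul (hb i)]
    exact LinearMap.congr_fun h
  intro X
  obtain ⟨X, rfl⟩ : ∃ W, adEquiv (expAd Y) W = X := ⟨_, (adEquiv (expAd Y)).apply_symm_apply X⟩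
  have h1 : adEquiv (g * (expAd Y)⁻¹) (adEquiv (expAd Y) X) = adEquiv g X := by
    rw [← adEquiv_mul, inv_mul_cancel_right]
  have h2 : θ (adEquiv g X) = adEquiv g (θ (adEquiv (expAd Y) (adEquiv (expAd Y) X))) := by
    rw [← hEE, hθ.involutive, LieEquiv.apply_symm_apply]
  have h3 : θ (adEquiv (expAd Y) X) =
      adEquiv (expAd Y) (θ (adEquiv (expAd Y) (adEquiv (expAd Y) X))) :=
    (adEquiv_expAd_theta hθ hY _).symm
  rw [h1, h2, h3, ← adEquiv_mul (g * (expAd Y)⁻¹), inv_mul_cancel_right]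

omit [LieAlgebra.IsKilling ℝ 𝔤] in
lemma theta_inv_theta_mul_expAd {m : adNormalizer (𝔤 : Set (CMat n))}
    (hm : ∀ X, θ (adEquiv m X) = adEquiv m (θ X)) {Y : 𝔤} (hY : θ Y = -Y) (X : 𝔤) :
    θ (adEquiv (m * expAd Y)⁻¹ (θ (adEquiv (m * expAd Y) X))) =
      adEquiv (expAd Y) (adEquiv (expAd Y) X) := by
  rw [adEquiv_mul m, hm, mul_inv_rev, adEquiv_mul, adEquiv_inv m, LieEquiv.symm_apply_apply,
    adEquiv_inv, ← adEquiv_expAd_theta hθ hY (adEquiv (expAd Y) X), LieEquiv.symm_apply_apply,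
    hθ.involutive]

/-- Uniqueness in the Cartan decomposition. -/
lemma expAd_unique {m m' : adNormalizer (𝔤 : Set (CMat n))}
    (hm : ∀ X, θ (adEquiv m X) = adEquiv m (θ X)) (hm' : ∀ X, θ (adEquiv m' X) = adEquiv m' (θ X))
    {Y Y' : 𝔤} (hY : θ Y = -Y) (hY' : θ Y' = -Y') (h : m * expAd Y = m' * expAd Y') : Y = Y' := by
  obtain ⟨b, a, hb⟩ := hθ.exists_eigenbasis_lie hY
  obtain ⟨b', a', hb'⟩ := hθ.exists_eigenbasis_lie hY'
  have hEE : ∀ X, adEquiv (expAd Y') (adEquiv (expAd Y') X) =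
      adEquiv (expAd Y) (adEquiv (expAd Y) X) := fun X => by
    rw [← theta_inv_theta_mul_expAd hθ hm hY, ← theta_inv_theta_mul_expAd hθ hm' hY', h]
  have hlog : ∀ x : ℝ, Real.log (Real.exp (2 * x)) / 2 = x := fun x => by
    rw [Real.log_exp, mul_div_cancel_left₀ _ two_ne_zero]
  let q : 𝔤 →ₗ[ℝ] 𝔤 := (adEquiv (expAd Y') : 𝔤 →ₗ[ℝ] 𝔤) ∘ₗ (adEquiv (expAd Y') : 𝔤 →ₗ[ℝ] 𝔤)
  have hq : ∀ j, q (b' j) = Real.exp (2 * a' j) • b' j := fun j => by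
    change adEquiv (expAd Y') (adEquiv (expAd Y') (b' j)) = _
    exact adEquiv_expAd_twice_of_lie_eq_smul (hb' j)
  have hD : ∀ j, LieAlgebra.ad ℝ 𝔤 Y' (b' j) = (Real.log (Real.exp (2 * a' j)) / 2) • b' j :=
    fun j => by rw [LieAlgebra.ad_apply, hb', hlog]
  have had : LieAlgebra.ad ℝ 𝔤 Y = LieAlgebra.ad ℝ 𝔤 Y' := by
    refine b.ext fun i => ?_
    have h1 : LieAlgebra.ad ℝ 𝔤 Y' (b i) = (Real.log (Real.exp (2 * a i)) / 2) • b i :=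
      apply_eq_of_eigenbasis b' (q := q) (fun r => Real.log r / 2) hq hD
        ((hEE (b i)).trans (adEquiv_expAd_twice_of_lie_eq_smul (hb i)))
    rw [h1, LieAlgebra.ad_apply, hb, hlog]
  refine sub_eq_zero.1 (eq_zero_of_forall_lie_eq_zero fun X => ?_)
  rw [sub_lie, sub_eq_zero]
  exact LinearMap.congr_fun had X

end CartanDecomposition

/-! ### The maximal compact subgroup is connected -/

section MaximalCompact

open Module Pointwise

variable {n : ℕ} {𝔤 : LieSubalgebra ℝ (CMat n)} {θ : 𝔤 ≃ₗ⁅ℝ⁆ 𝔤}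

lemma sq_le_exp_add_exp_neg (a : ℝ) : a * a ≤ Real.exp (2 * a) + Real.exp (2 * -a) := by
  rcases le_total 0 a with h | h
  · have h1 := Real.quadratic_le_exp_of_nonneg (x := 2 * a) (by linarith)
    have h2 := Real.exp_pos (2 * -a)
    nlinarith
  · have h1 := Real.quadratic_le_exp_of_nonneg (x := 2 * -a) (by linarith)
    have h2 := Real.exp_pos (2 * a)
    nlinarith

/-- For `θ Y = -Y`, the size of `Y` is controlled by the trace of `exp (2 ad Y)`. The eigenvalues of
`ad Y` are symmetric about zero, as `θ` maps eigenvectors to eigenvectors for the opposite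
eigenvalue. -/
lemma IsCartanInvolution.cartanForm_le_trace (hθ : IsCartanInvolution θ) {Y : 𝔤} (hY : θ Y = -Y)
    {q : 𝔤 →ₗ[ℝ] 𝔤} (hq : ∀ X, q X = adEquiv (expAd Y) (adEquiv (expAd Y) X)) :
    cartanForm θ Y Y ≤ 2 * LinearMap.trace ℝ 𝔤 q := by
  obtain ⟨b, a, hb⟩ := hθ.exists_eigenbasis_lie hY
  have hq₁ : ∀ i, q (b i) = Real.exp (2 * a i) • b i := fun i => by
    rw [hq, adEquiv_expAd_twice_of_lie_eq_smul (hb i)]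
  have hq₂ : ∀ i, q (b.map (θ : 𝔤 ≃ₗ[ℝ] 𝔤) i) = Real.exp (2 * -a i) • b.map (θ : 𝔤 ≃ₗ[ℝ] 𝔤) i := by
    intro i
    have h2 : ⁅Y, θ (b i)⁆ = (-a i) • θ (b i) := by
      have h3 : ⁅Y, θ (b i)⁆ = -θ ⁅Y, b i⁆ := by
        rw [LieEquiv.map_lie, hY, neg_lie, neg_neg]
      rw [h3, hb, map_smul, neg_smul]
    rw [hq, Basis.map_apply]
    exact adEquiv_expAd_twice_of_lie_eq_smul h2
  have hκ : cartanForm θ Y Y = ∑ i, a i * a i := by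
    rw [cartanForm_apply, hY, map_neg, neg_neg, killingForm_apply_apply]
    refine trace_eq_sum_of_eigenbasis b fun i => ?_
    rw [LinearMap.comp_apply, LieAlgebra.ad_apply, LieAlgebra.ad_apply, hb, lie_smul, hb, smul_smul]
  have h3 : 2 * LinearMap.trace ℝ 𝔤 q = ∑ i, (Real.exp (2 * a i) + Real.exp (2 * -a i)) := by
    rw [Finset.sum_add_distrib, ← trace_eq_sum_of_eigenbasis b hq₁,
      ← trace_eq_sum_of_eigenbasis _ hq₂, two_mul]
  rw [hκ, h3]
  exact Finset.sum_le_sum fun i _ => sq_le_exp_add_exp_neg (a i)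

/-- The bounded part of the `-1` eigenspace of a Cartan involution lies in a compact set. -/
lemma IsCartanInvolution.exists_isCompact (hθ : IsCartanInvolution θ) (c : ℝ) :
    ∃ R : Set (CMat n), IsCompact R ∧ R ⊆ toMat (antifixedSubmodule θ) ∧
      ∀ Y : 𝔤, θ Y = -Y → cartanForm θ Y Y ≤ c → (Y : CMat n) ∈ R := by
  obtain ⟨b, -, -, hb⟩ := exists_orthonormal_eigenbasis (cartanForm θ) hθ.cartanForm_comm
    (fun _ => hθ.cartanForm_pos) 0 (by simp)
  have hcont : Continuous fun y : Fin (finrank ℝ 𝔤) → ℝ => ∑ i, y i • (b i : CMat n) := by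
    fun_prop
  refine ⟨(fun y : Fin (finrank ℝ 𝔤) → ℝ => ∑ i, y i • (b i : CMat n)) ''
      Metric.closedBall 0 (Real.sqrt c) ∩ toMat (antifixedSubmodule θ),
    ((isCompact_closedBall _ _).image hcont).inter_right (toMat _).closed_of_finiteDimensional,
    Set.inter_subset_right, fun Y hY hc => ⟨⟨b.repr Y, ?_, ?_⟩, mem_toMat_iff.2 hY⟩⟩
  · have h1 : cartanForm θ Y Y = ∑ i, b.repr Y i ^ 2 := by
      conv_lhs => rw [← b.sum_repr Y]
      simp only [map_sum, LinearMap.sum_apply, map_smul, LinearMap.smul_apply, hb, smul_eq_mul,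
        mul_ite, mul_one, mul_zero, Finset.sum_ite_eq', Finset.mem_univ, if_true,
        sq]
    rw [mem_closedBall_zero_iff, pi_norm_le_iff_of_nonneg (Real.sqrt_nonneg _)]
    intro i
    rw [Real.norm_eq_abs]
    refine Real.abs_le_sqrt (le_trans ?_ hc)
    rw [h1]
    exact Finset.single_le_sum (f := fun i => b.repr Y i ^ 2) (fun i _ => sq_nonneg _)
      (Finset.mem_univ i)
  · have h2 : ((∑ i, b.repr Y i • b i : 𝔤) : CMat n) = ∑ i, b.repr Y i • (b i : CMat n) := by
      rw [AddSubmonoidClass.coe_finsetSum]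
      rfl
    change ∑ i, b.repr Y i • (b i : CMat n) = Y
    rw [← h2, b.sum_repr]

/-- The trace of the positive part of `Ad g` extends to a continuous function on the group of all
invertible matrices. -/
lemma exists_continuous_eq_trace (θ : 𝔤 ≃ₗ⁅ℝ⁆ 𝔤) : ∃ τ : GL (Fin n) ℂ → ℝ, Continuous τ ∧
    ∀ (g : adNormalizer (𝔤 : Set (CMat n))) (q : 𝔤 →ₗ[ℝ] 𝔤),
      (∀ X, q X = θ (adEquiv g⁻¹ (θ (adEquiv g X)))) → τ g = LinearMap.trace ℝ 𝔤 q := by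
  obtain ⟨p, hp⟩ := 𝔤.toSubmodule.subtype.exists_leftInverse_of_injective
    𝔤.toSubmodule.ker_subtype
  have hp' : ∀ X : 𝔤, p (X : CMat n) = X := fun X => LinearMap.congr_fun hp X
  let b := Module.finBasis ℝ 𝔤
  let f : CMat n →ₗ[ℝ] CMat n := 𝔤.toSubmodule.subtype ∘ₗ (θ : 𝔤 →ₗ[ℝ] 𝔤) ∘ₗ p
  let φ (i : Fin (finrank ℝ 𝔤)) : CMat n →ₗ[ℝ] ℝ := b.coord i ∘ₗ (θ : 𝔤 →ₗ[ℝ] 𝔤) ∘ₗ p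
  have hf : Continuous f := f.continuous_of_finiteDimensional
  have hφ : ∀ i, Continuous (φ i) := fun i => (φ i).continuous_of_finiteDimensional
  have hinv : Continuous fun g : GL (Fin n) ℂ => ((g⁻¹ : GL (Fin n) ℂ) : CMat n) :=
    Units.continuous_val.comp continuous_inv
  have hval : Continuous fun g : GL (Fin n) ℂ => (g : CMat n) := Units.continuous_val
  refine ⟨fun g => ∑ i, φ i (((g⁻¹ : GL (Fin n) ℂ) : CMat n) *
    f (g * (b i : CMat n) * ((g⁻¹ : GL (Fin n) ℂ) : CMat n)) * g), ?_, ?_⟩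
  · refine continuous_finsetSum _ fun i _ => (hφ i).comp ?_
    exact (hinv.mul (hf.comp ((hval.mul continuous_const).mul hinv))).mul hval
  · intro g q hq
    rw [LinearMap.trace_eq_matrix_trace ℝ b, Matrix.trace]
    refine Finset.sum_congr rfl fun i _ => ?_
    have h1 : f ((g : GL (Fin n) ℂ) * (b i : CMat n) * ((g⁻¹ : GL (Fin n) ℂ) : CMat n)) =
        (θ (adEquiv g (b i)) : CMat n) := by
      change (θ (p (adEquiv g (b i) : CMat n)) : CMat n) = _
      rw [hp']
    have h2 : ((g⁻¹ : GL (Fin n) ℂ) : CMat n) * (θ (adEquiv g (b i)) : CMat n) *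
        (g : GL (Fin n) ℂ) = (adEquiv g⁻¹ (θ (adEquiv g (b i))) : CMat n) := by
      rw [coe_adEquiv]
      simp
    rw [h1, h2, Matrix.diag_apply, LinearMap.toMatrix_apply, hq]
    change b.coord i (θ (p _)) = _
    rw [hp']
    rfl

/-- Multiplication by `exp 𝔭` preserves closedness of sets of matrices whose adjoint action commutes
with `θ`, since the factor in `exp 𝔭` stays bounded when the product does. -/
lemma IsCartanInvolution.isClosed_mul_expGL (hθ : IsCartanInvolution θ) {C : Set (GL (Fin n) ℂ)}
    (hC : IsClosed C) (hCθ : ∀ g ∈ C, ∃ h : g ∈ adNormalizer (𝔤 : Set (CMat n)),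
      ∀ X, θ (adEquiv ⟨g, h⟩ X) = adEquiv ⟨g, h⟩ (θ X)) :
    IsClosed (C * expGL '' (toMat (antifixedSubmodule θ) : Set (CMat n))) := by
  obtain ⟨τ, hτ, hτq⟩ := exists_continuous_eq_trace θ
  refine isClosed_of_closure_subset fun g₀ hg₀ => ?_
  obtain ⟨R, hR, hRp, hRc⟩ := hθ.exists_isCompact (2 * (τ g₀ + 1))
  -- near `g₀` the trace `τ` is bounded, so the factors in `exp 𝔭` range over a compact set `R`
  have hU : IsOpen {g | τ g < τ g₀ + 1} := isOpen_lt hτ continuous_const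
  have hsub : {g | τ g < τ g₀ + 1} ∩ (C * expGL '' (toMat (antifixedSubmodule θ) : Set (CMat n))) ⊆
      C * expGL '' R := by
    rintro _ ⟨hlt, m, hm, _, ⟨_, ⟨Y, hY, rfl⟩, rfl⟩, rfl⟩
    obtain ⟨hmn, hmθ⟩ := hCθ m hm
    refine Set.mul_mem_mul hm ⟨_, hRc Y hY ?_, rfl⟩
    let q : 𝔤 →ₗ[ℝ] 𝔤 := (adEquiv (expAd Y) : 𝔤 →ₗ[ℝ] 𝔤) ∘ₗ (adEquiv (expAd Y) : 𝔤 →ₗ[ℝ] 𝔤)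
    have hq : ∀ X, q X = adEquiv (expAd Y) (adEquiv (expAd Y) X) := fun X => rfl
    have h1 := hτq (⟨m, hmn⟩ * expAd Y) q fun X => by
      rw [theta_inv_theta_mul_expAd hθ hmθ hY, hq]
    have h2 := hθ.cartanForm_le_trace hY hq
    rw [← h1] at h2
    have h3 : τ (m * expGL (Y : CMat n)) < τ g₀ + 1 := hlt
    have h4 : τ ((⟨m, hmn⟩ * expAd Y : adNormalizer (𝔤 : Set (CMat n))) : GL (Fin n) ℂ) =
      τ (m * expGL (Y : CMat n)) := rfl
    linarith
  have hclosed : IsClosed (C * expGL '' R) := hC.mul_right_of_isCompact (hR.image continuous_expGL)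
  have h1 : g₀ ∈ closure ({g | τ g < τ g₀ + 1} ∩
      (C * expGL '' (toMat (antifixedSubmodule θ) : Set (CMat n)))) :=
    hU.inter_closure ⟨lt_add_one (τ g₀), hg₀⟩
  exact Set.mul_subset_mul_left (Set.image_mono hRp) (closure_minimal hsub hclosed h1)

/-- The elements of `G(ℂ)` whose adjoint action preserves `𝔤` and commutes with `θ`. -/
def thetaCentralizer (Gc : Subgroup (GL (Fin n) ℂ)) (θ : 𝔤 ≃ₗ⁅ℝ⁆ 𝔤) : Subgroup (GL (Fin n) ℂ) :=
  Gc ⊓ adNormalizer (𝔤 : Set (CMat n)) ⊓ adNormalizer (toMat (fixedSubmodule θ) : Set (CMat n)) ⊓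
    adNormalizer (toMat (antifixedSubmodule θ) : Set (CMat n))

lemma IsCartanInvolution.theta_adEquiv_of_mem (hθ : IsCartanInvolution θ)
    {Gc : Subgroup (GL (Fin n) ℂ)} {g : GL (Fin n) ℂ} (hg : g ∈ thetaCentralizer Gc θ) (X : 𝔤) :
    θ (adEquiv ⟨g, hg.1.1.2⟩ X) = adEquiv ⟨g, hg.1.1.2⟩ (θ X) := by
  have h1 := (mem_adNormalizer_toMat_iff ⟨g, hg.1.1.2⟩ _).1 hg.1.2 (X + θ X)
  have h2 := (mem_adNormalizer_toMat_iff ⟨g, hg.1.1.2⟩ _).1 hg.2 (X - θ X)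
  have e1 := mem_fixedSubmodule.1 (h1.1 (by
    rw [mem_fixedSubmodule, map_add, hθ.involutive, add_comm]))
  have e2 := mem_antifixedSubmodule.1 (h2.1 (by
    rw [mem_antifixedSubmodule, map_sub, hθ.involutive, neg_sub]))
  simp only [map_add, map_sub] at e1 e2
  have e3 : (2 : ℝ) • θ (adEquiv ⟨g, hg.1.1.2⟩ X) = (2 : ℝ) • adEquiv ⟨g, hg.1.1.2⟩ (θ X) := by
    linear_combination (norm := module) (1 : ℝ) • e1 + (1 : ℝ) • e2
  exact smul_right_injective _ (two_ne_zero : (2 : ℝ) ≠ 0) e3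

lemma mem_thetaCentralizer_of_comm {Gc : Subgroup (GL (Fin n) ℂ)}
    {g : adNormalizer (𝔤 : Set (CMat n))} (hgG : (g : GL (Fin n) ℂ) ∈ Gc)
    (h : ∀ X, θ (adEquiv g X) = adEquiv g (θ X)) : (g : GL (Fin n) ℂ) ∈ thetaCentralizer Gc θ :=
  ⟨⟨⟨hgG, g.2⟩, (mem_adNormalizer_of_theta_comm h).1⟩, (mem_adNormalizer_of_theta_comm h).2⟩

variable {Gc : Subgroup (GL (Fin n) ℂ)} (hGc : IsComplexGroupOf 𝔤 Gc)
include hGc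

lemma isClosed_thetaCentralizer : IsClosed (thetaCentralizer Gc θ : Set (GL (Fin n) ℂ)) :=
  ((hGc.isClosed.inter (isClosed_adNormalizer
    (𝔤.toSubmodule.closed_of_finiteDimensional))).inter
    (isClosed_adNormalizer (toMat _).closed_of_finiteDimensional)).inter
    (isClosed_adNormalizer (toMat _).closed_of_finiteDimensional)

lemma expGL_mem_thetaCentralizer {Θ : realGroup 𝔤 →* realGroup 𝔤}
    (hΘ : ∀ X : 𝔤, Θ (realExp X) = realExp (θ X)) :
    fixedGroup Θ ≤ thetaCentralizer Gc θ := fun g hg =>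
  mem_thetaCentralizer_of_comm (g := ⟨g, realGroup_le_adNormalizer (fixedGroup_le_realGroup hg)⟩)
    (hGc.realGroup_le (fixedGroup_le_realGroup hg)) (theta_adEquiv_of_mem_fixedGroup hΘ hg)

variable [LieAlgebra.IsKilling ℝ 𝔤] (hθ : IsCartanInvolution θ)
include hθ

/-- The Lie algebra of the centralizer of `θ` is `𝔨`. -/
lemma mem_toMat_of_expGL_mem_thetaCentralizer {Z : CMat n}
    (hZ : ∀ t : ℝ, expGL (t • Z) ∈ thetaCentralizer Gc θ) : Z ∈ toMat (fixedSubmodule θ) := by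
  obtain ⟨X, -, Y, -, rfl⟩ := exists_of_mem_complexify
    (hGc.mem_complexify_top fun t => (hZ t).1.1.1)
  have hbr : ∀ W : Submodule ℝ 𝔤, (∀ t : ℝ, expGL (t • ((X : CMat n) + Complex.I • (Y : CMat n))) ∈
      adNormalizer (toMat W : Set (CMat n))) → ∀ A ∈ W, ⁅X, A⁆ ∈ W ∧ ⁅Y, A⁆ = 0 := by
    intro W hW A hA
    have h1 := commutator_mem_of_expGL_mem_adNormalizer hW (mem_toMat_iff.2 hA)
    rw [commutator_add_I_smul] at h1
    obtain ⟨C, hC, h2⟩ := h1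
    have h3 : (C : CMat n) + Complex.I • ((0 : 𝔤) : CMat n) =
        ((⁅X, A⁆ : 𝔤) : CMat n) + Complex.I • ((⁅Y, A⁆ : 𝔤) : CMat n) := by
      rw [← h2]
      simp
    obtain ⟨h4, h5⟩ := add_I_smul_inj hGc.real_form h3
    exact ⟨h4 ▸ hC, h5.symm⟩
  have hY : Y = 0 := eq_zero_of_forall_lie_eq_zero fun A => (hbr ⊤ (fun t => by
    rw [coe_toMat_top]
    exact (hZ t).1.1.2) A trivial).2
  have hX : X ∈ fixedSubmodule θ := hθ.fixed_of_normalizes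
    (fun A hA => (hbr _ (fun t => (hZ t).1.2) A hA).1)
    fun A hA => (hbr _ (fun t => (hZ t).2) A hA).1
  rw [hY]
  simpa using mem_toMat_iff.2 hX

variable {Θ : realGroup 𝔤 →* realGroup 𝔤} (hΘ : ∀ X : 𝔤, Θ (realExp X) = realExp (θ X))
include hΘ

omit hGc hθ [LieAlgebra.IsKilling ℝ 𝔤] in
lemma analyticSubgroup_fixedLie_le : analyticSubgroup (fixedLie θ) ≤ fixedGroup Θ := by
  refine analyticSubgroup_le ?_
  rintro _ ⟨X, hX, rfl⟩
  exact expGL_mem_fixedGroup hΘ hX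

/-- The analytic subgroup of `𝔨` is open and closed in the centralizer of `θ`. -/
lemma isClopen_analyticSubgroup_fixedLie :
    IsClosed (analyticSubgroup (fixedLie θ) : Set (GL (Fin n) ℂ)) ∧
    IsClosed ((thetaCentralizer Gc θ : Set (GL (Fin n) ℂ)) \ analyticSubgroup (fixedLie θ)) := by
  have hle : analyticSubgroup (fixedLie θ) ≤ thetaCentralizer Gc θ :=
    (analyticSubgroup_fixedLie_le hΘ).trans (expGL_mem_thetaCentralizer hGc hΘ)
  obtain ⟨W, hW⟩ := (toMat (fixedSubmodule θ)).exists_isCompl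
  have hnear := eventually_exists_expGL_mul_expGL (V₁ := toMat (fixedSubmodule θ)) (V₂ := ⊥)
    (W := W)
    (isClosed_thetaCentralizer hGc (θ := θ)) (fun X hX => hle (expGL_mem_analyticSubgroup hX))
    (by simp [expGL_zero, one_mem]) (fun Z hZ h => Submodule.disjoint_def.1 hW.disjoint Z
      (mem_toMat_of_expGL_mem_thetaCentralizer hGc hθ h) hZ)
    (by rw [sup_bot_eq, hW.sup_eq_top]) (p := fun _ => True)
    (Filter.Eventually.of_forall fun _ => trivial)
  have hopen : IsOpen (((analyticSubgroup (fixedLie θ)).subgroupOf (thetaCentralizer Gc θ) :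
      Subgroup (thetaCentralizer Gc θ)) : Set (thetaCentralizer Gc θ)) := by
    refine Subgroup.isOpen_of_mem_nhds _ (g := 1) ?_
    rw [nhds_subtype_eq_comap]
    refine Filter.mem_comap.2 ⟨_, hnear, fun g hg => ?_⟩
    obtain ⟨X, hX, -, Y, hY, h⟩ := hg g.2
    rw [(Submodule.mem_bot ℝ).1 hY, expGL_zero, mul_one] at h
    change (g : GL (Fin n) ℂ) ∈ analyticSubgroup (fixedLie θ)
    rw [h]
    exact expGL_mem_analyticSubgroup hX
  have hemb : Topology.IsClosedEmbedding (Subtype.val : thetaCentralizer Gc θ → GL (Fin n) ℂ) :=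
    (isClosed_thetaCentralizer hGc).isClosedEmbedding_subtypeVal
  constructor
  · have h1 := hemb.isClosedMap _ (Subgroup.isClosed_of_isOpen _ hopen)
    convert h1 using 1
    ext g
    exact ⟨fun hg => ⟨⟨g, hle hg⟩, hg, rfl⟩, by rintro ⟨g, hg, rfl⟩; exact hg⟩
  · have h1 := hemb.isClosedMap _ hopen.isClosed_compl
    convert h1 using 1
    ext g
    exact ⟨fun hg => ⟨⟨g, hg.1⟩, hg.2, rfl⟩, by rintro ⟨g, hg, rfl⟩; exact ⟨g.2, hg⟩⟩

/-- The fixed points of the Cartan involution of the group form a connected group: in the connected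
group `G ⊆ M exp 𝔭`, with `M` the centralizer of `θ`, both `K₀ exp 𝔭` and its complement
`(M \ K₀) exp 𝔭` are closed. -/
lemma fixedGroup_eq_analyticSubgroup : fixedGroup Θ = analyticSubgroup (fixedLie θ) := by
  refine le_antisymm (fun k hk => ?_) (analyticSubgroup_fixedLie_le hΘ)
  set K₀ := analyticSubgroup (fixedLie θ) with hK₀
  set M := thetaCentralizer Gc θ with hM
  have hle : K₀ ≤ M := (analyticSubgroup_fixedLie_le hΘ).trans (expGL_mem_thetaCentralizer hGc hΘ)
  have hMθ : ∀ g ∈ M, ∃ h : g ∈ adNormalizer (𝔤 : Set (CMat n)),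
      ∀ X, θ (adEquiv ⟨g, h⟩ X) = adEquiv ⟨g, h⟩ (θ X) := fun g hg =>
    ⟨hg.1.1.2, hθ.theta_adEquiv_of_mem hg⟩
  obtain ⟨hc₁, hc₂⟩ := isClopen_analyticSubgroup_fixedLie hGc hθ hΘ
  let P : Set (GL (Fin n) ℂ) := expGL '' (toMat (antifixedSubmodule θ) : Set (CMat n))
  have hF₁ : IsClosed ((K₀ : Set (GL (Fin n) ℂ)) * P) :=
    hθ.isClosed_mul_expGL hc₁ fun g hg => hMθ g (hle hg)
  have hF₂ : IsClosed (((M : Set (GL (Fin n) ℂ)) \ K₀) * P) :=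
    hθ.isClosed_mul_expGL hc₂ fun g hg => hMθ g hg.1
  have huniq : ∀ m ∈ M, ∀ m' ∈ M, ∀ Y Y' : 𝔤, θ Y = -Y → θ Y' = -Y' →
      m * expGL (Y : CMat n) = m' * expGL (Y' : CMat n) → m = m' := by
    intro m hm m' hm' Y Y' hY hY' h
    obtain ⟨h1, h2⟩ := hMθ m hm
    obtain ⟨h1', h2'⟩ := hMθ m' hm'
    have := expAd_unique hθ h2 h2' hY hY' (Subtype.ext h)
    rw [this] at h
    exact mul_right_cancel h
  have hcover : (realGroup 𝔤 : Set (GL (Fin n) ℂ)) ⊆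
      ((K₀ : Set (GL (Fin n) ℂ)) * P) ∪ (((M : Set (GL (Fin n) ℂ)) \ K₀) * P) := by
    intro g hg
    obtain ⟨Y, hY, hYθ⟩ := exists_theta_comm_mul_expAd hθ ⟨g, realGroup_le_adNormalizer hg⟩
    have hm := mem_thetaCentralizer_of_comm (Gc := Gc) (by
      refine Gc.mul_mem (hGc.realGroup_le hg) (Gc.inv_mem ?_)
      exact hGc.expGL_mem (coe_mem_complexify trivial)) hYθ
    have hg' : g = g * (expGL (Y : CMat n))⁻¹ * expGL (Y : CMat n) := by group
    rw [hg']
    have hP : expGL (Y : CMat n) ∈ P := ⟨_, mem_toMat_iff.2 hY, rfl⟩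
    by_cases h0 : g * (expGL (Y : CMat n))⁻¹ ∈ K₀
    · exact Or.inl (Set.mul_mem_mul h0 hP)
    · exact Or.inr (Set.mul_mem_mul ⟨hm, h0⟩ hP)
  have hdisj : Disjoint ((K₀ : Set (GL (Fin n) ℂ)) * P) (((M : Set (GL (Fin n) ℂ)) \ K₀) * P) := by
    rw [Set.disjoint_left]
    rintro _ ⟨m, hm, _, ⟨_, ⟨Y, hY, rfl⟩, rfl⟩, rfl⟩ ⟨m', hm', _, ⟨_, ⟨Y', hY', rfl⟩, rfl⟩, h⟩
    exact hm'.2 (huniq m' hm'.1 m (hle hm) Y' Y hY' hY h ▸ hm)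
  have hconn : IsPreconnected (realGroup 𝔤 : Set (GL (Fin n) ℂ)) := by
    have : PathConnectedSpace (realGroup 𝔤) :=
      pathConnectedSpace_analyticSubgroup fun t X hX => 𝔤.smul_mem t hX
    exact (isPreconnected_iff_preconnectedSpace.2 inferInstance)
  have hsub : (realGroup 𝔤 : Set (GL (Fin n) ℂ)) ⊆ (K₀ : Set (GL (Fin n) ℂ)) * P := by
    rcases isPreconnected_iff_subset_of_disjoint_closed.1 hconn _ _ hF₁ hF₂ hcover
      (by rw [hdisj.inter_eq, Set.inter_empty]) with h | h
    · exact h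
    · have h1 : (1 : GL (Fin n) ℂ) ∈ (K₀ : Set (GL (Fin n) ℂ)) * P :=
        ⟨1, one_mem _, 1, ⟨0, zero_mem _, expGL_zero⟩, mul_one _⟩
      exact absurd (h (one_mem (realGroup 𝔤))) (Set.disjoint_left.1 hdisj h1)
  obtain ⟨k₀, hk₀, _, ⟨_, ⟨Y, hY, rfl⟩, rfl⟩, h⟩ := hsub (fixedGroup_le_realGroup hk)
  have h2 := huniq k (expGL_mem_thetaCentralizer hGc hΘ hk) k₀ (hle hk₀) 0 Y (by simp) hY (by
    simpa [expGL_zero] using h.symm)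
  rw [h2]
  exact hk₀

lemma pathConnectedSpace_fixedGroup : PathConnectedSpace (fixedGroup Θ) := by
  rw [fixedGroup_eq_analyticSubgroup hGc hθ hΘ]
  refine pathConnectedSpace_analyticSubgroup ?_
  rintro t _ ⟨X, hX, rfl⟩
  exact ⟨t • X, (fixedSubmodule θ).smul_mem t hX, rfl⟩

end MaximalCompact

/-! ### Unitary structures -/

section Unitary

open MeasureTheory
open scoped ComplexOrder MatrixOrder

variable {n : ℕ}

/-- A linear form on matrices in terms of the matrix entries. -/
lemma linear_apply_eq_sum (l : CMat n →ₗ[ℂ] ℂ) (M : CMat n) :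
    l M = ∑ i, ∑ j, M i j * l (Matrix.single i j 1) := by
  conv_lhs => rw [Matrix.matrix_eq_sum_single M]
  simp only [map_sum]
  refine Finset.sum_congr rfl fun i _ => Finset.sum_congr rfl fun j _ => ?_
  rw [← mul_one (M i j), ← smul_eq_mul, ← Matrix.smul_single, map_smul, smul_eq_mul, smul_eq_mul,
    mul_one]

/-- Weyl's unitary trick: a compact group of matrices is conjugate to a group of unitary
matrices. -/
lemma exists_conj_unitary {K : Subgroup (GL (Fin n) ℂ)} (hK : IsCompact (K : Set (GL (Fin n) ℂ))) :
    ∃ r : GL (Fin n) ℂ, ∀ k ∈ K, star (r * k * r⁻¹) * (r * k * r⁻¹) = 1 := by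
  have hcpt : CompactSpace K := isCompact_iff_compactSpace.1 hK
  let _ : MeasurableSpace K := borel K
  have : BorelSpace K := ⟨rfl⟩
  let μ : Measure K := Measure.haar
  let f : K → CMat n := fun k =>
    ((k⁻¹ : GL (Fin n) ℂ) : CMat n).conjTranspose * ((k⁻¹ : GL (Fin n) ℂ) : CMat n)
  have hinv : Continuous fun k : K => ((k⁻¹ : GL (Fin n) ℂ) : CMat n) :=
    Units.continuous_val.comp (continuous_inv.comp continuous_subtype_val)
  have hf : Continuous f := hinv.matrix_conjTranspose.matrix_mul hinv
  have hint : ∀ φ : K → ℂ, Continuous φ → Integrable φ μ := fun φ hφ =>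
    hφ.integrable_of_hasCompactSupport (HasCompactSupport.of_compactSpace φ)
  -- the average of the Hermitian forms `⟨k⁻¹ v, k⁻¹ w⟩` over the group
  let H : CMat n := Matrix.of fun i j => ∫ k, f k i j ∂μ
  have hl : ∀ l : CMat n →ₗ[ℂ] ℂ, l H = ∫ k, l (f k) ∂μ := by
    intro l
    have hc : ∀ i j, Continuous fun k => f k i j * l (Matrix.single i j 1) := fun i j =>
      ((continuous_apply_apply i j).comp hf).mul continuous_const
    rw [linear_apply_eq_sum l H, integral_congr_ae (Filter.Eventually.of_forall fun k =>
      linear_apply_eq_sum l (f k)),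
      integral_finsetSum _ fun i _ => hint _ (continuous_finsetSum _ fun j _ => hc i j)]
    refine Finset.sum_congr rfl fun i _ => ?_
    rw [integral_finsetSum _ fun j _ => hint _ (hc i j)]
    refine Finset.sum_congr rfl fun j _ => ?_
    rw [integral_mul_const]
    rfl
  have hinvar : ∀ a ∈ K, (a : CMat n).conjTranspose * H * (a : CMat n) = H := by
    intro a ha
    ext i j
    let l : CMat n →ₗ[ℂ] ℂ := (Matrix.entryLinearMap ℂ ℂ i j) ∘ₗ
      (LinearMap.mulRight ℂ (a : CMat n)) ∘ₗ (LinearMap.mulLeft ℂ (a : CMat n).conjTranspose)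
    have h1 := hl l
    have h2 : ∀ k : K, l (f k) = f (⟨a, ha⟩⁻¹ * k) i j := by
      intro k
      change ((a : CMat n).conjTranspose * f k * (a : CMat n)) i j = _
      simp only [f, Subgroup.coe_mul, Subgroup.coe_inv, mul_inv_rev, inv_inv, Units.val_mul,
        Matrix.conjTranspose_mul, mul_assoc]
    simp only [h2] at h1
    rw [integral_mul_left_eq_self (fun k => f k i j)] at h1
    exact h1
  have hpos : H.PosDef := by
    refine Matrix.PosDef.of_dotProduct_mulVec_pos ?_ fun x hx => ?_
    · ext i j
      change star (∫ k, f k j i ∂μ) = ∫ k, f k i j ∂μ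
      have h1 : ∀ k, f k i j = star (f k j i) := fun k =>
        congrFun (congrFun (Matrix.isHermitian_conjTranspose_mul_self _).symm i) j
      simp only [h1]
      exact integral_conj.symm
    · let l : CMat n →ₗ[ℂ] ℂ :=
        { toFun := fun M => star x ⬝ᵥ (M.mulVec x)
          map_add' := fun A B => by rw [Matrix.add_mulVec, dotProduct_add]
          map_smul' := fun c A => by rw [Matrix.smul_mulVec, dotProduct_smul]; rfl }
      have hposk : ∀ k, 0 < l (f k) := fun k =>
        (Matrix.PosDef.conjTranspose_mul_self _ (Matrix.mulVec_injective_of_isUnit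
          (k⁻¹ : GL (Fin n) ℂ).isUnit)).dotProduct_mulVec_pos hx
      have hre : ∀ k, l (f k) = ((l (f k)).re : ℂ) := fun k =>
        Complex.ext rfl (Complex.pos_iff.1 (hposk k)).2.symm
      have hcl : Continuous fun k => (l (f k)).re := by
        refine Complex.continuous_re.comp (Continuous.congr ?_ fun k =>
          (linear_apply_eq_sum l (f k)).symm)
        exact continuous_finsetSum _ fun i _ => continuous_finsetSum _ fun j _ =>
          ((continuous_apply_apply i j).comp hf).mul continuous_const
      have h1 : l H = ((∫ k, (l (f k)).re ∂μ : ℝ) : ℂ) := by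
        rw [hl, ← integral_complex_ofReal]
        exact integral_congr_ae (Filter.Eventually.of_forall hre)
      have h2 : 0 < ∫ k, (l (f k)).re ∂μ :=
        hcl.integral_pos_of_hasCompactSupport_nonneg_nonzero (HasCompactSupport.of_compactSpace _)
          (fun k => (Complex.pos_iff.1 (hposk k)).1.le) (x := 1) (Complex.pos_iff.1 (hposk 1)).1.ne'
      change 0 < l H
      rw [h1]
      exact_mod_cast h2
  -- a square root of the invariant form conjugates the group into the unitary group
  obtain ⟨B, hB⟩ := CStarAlgebra.nonneg_iff_eq_star_mul_self.1 hpos.posSemidef.nonneg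
  have hBu : IsUnit B := by
    have h1 := hpos.isUnit
    rw [hB] at h1
    exact (isUnit_of_mul_isUnit_right h1)
  obtain ⟨r, rfl⟩ := hBu
  refine ⟨r, fun k hk => Units.ext ?_⟩
  have h1 := hinvar k hk
  rw [hB] at h1
  have h2 : star ((r⁻¹ : GL (Fin n) ℂ) : CMat n) * star (r : CMat n) = 1 := by
    rw [← star_mul, Units.mul_inv, star_one]
  calc ((star (r * k * r⁻¹) * (r * k * r⁻¹) : GL (Fin n) ℂ) : CMat n)
      = star ((r⁻¹ : GL (Fin n) ℂ) : CMat n) * ((k : CMat n).conjTranspose *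
          (star (r : CMat n) * r) * k) * ((r⁻¹ : GL (Fin n) ℂ) : CMat n) := by
        simp only [Units.val_mul, Units.coe_star, star_mul, Matrix.star_eq_conjTranspose, mul_assoc]
    _ = 1 := by
        rw [h1, ← mul_assoc, h2, one_mul, Units.mul_inv]

lemma isCompact_setOf_star_mul_self_eq_one :
    IsCompact {g : GL (Fin n) ℂ | star g * g = 1} := by
  have h1 : IsCompact {A : CMat n | star A * A = 1} := by
    have hc : IsCompact {A : Fin n → Fin n → ℂ | ∀ i, A i ∈
        {v : Fin n → ℂ | ∀ j, v j ∈ Metric.closedBall 0 1}} :=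
      isCompact_pi_infinite fun i => isCompact_pi_infinite fun j => isCompact_closedBall _ _
    refine IsCompact.of_isClosed_subset hc ?_ ?_
    · exact isClosed_eq (by fun_prop) continuous_const
    · intro A hA i j
      rw [mem_closedBall_zero_iff]
      exact entry_norm_bound_of_unitary (Matrix.mem_unitaryGroup_iff'.2 hA) i j
  have hcpt := isCompact_iff_compactSpace.1 h1
  let φ : {A : CMat n | star A * A = 1} → GL (Fin n) ℂ := fun A =>
    ⟨A, star (A : CMat n), mul_eq_one_comm.1 A.2, A.2⟩
  have hφ : Continuous φ := by
    rw [Units.continuous_iff]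
    exact ⟨continuous_subtype_val, continuous_star.comp continuous_subtype_val⟩
  refine (isCompact_range hφ).of_isClosed_subset ?_ ?_
  · have hs : Continuous fun g : GL (Fin n) ℂ => star (g : CMat n) * (g : CMat n) :=
      (continuous_star.comp Units.continuous_val).mul Units.continuous_val
    convert (isClosed_singleton (x := (1 : CMat n))).preimage hs using 1
    ext g
    exact ⟨fun h => congrArg Units.val h, fun h => Units.ext h⟩
  · intro g hg
    exact ⟨⟨g, congrArg Units.val hg⟩, Units.ext rfl⟩

end Unitary

/-! ### Diagonalizable matrices and determinants -/

section Diagonal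

open Polynomial

lemma apply_aeval_eq_eval_mul {V : Type*} [AddCommGroup V] [Module ℂ V] {c : V →ₗ[ℂ] ℂ}
    {T : Module.End ℂ V} {α : ℂ} (h : ∀ X, c (T X) = α * c X) (P : ℂ[X]) (v : V) :
    c (aeval T P v) = P.eval α * c v := by
  induction P using Polynomial.induction_on generalizing v with
  | C a => simp
  | add P R hP hR => simp [hP, hR, add_mul]
  | monomial m a ih =>
    rw [pow_succ, ← mul_assoc, map_mul, aeval_X, Module.End.mul_apply, ih, h,
      eval_mul (p := C a * X ^ m), eval_X, mul_assoc]

/-- If `T` and `D` are diagonal in the same coordinates and the eigenvalues of `D` are a function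
of those of `T`, then `D` is a polynomial in `T`, so it preserves the subspaces preserved
by `T`. -/
lemma apply_mem_of_simultaneously_diagonal {V ι : Type*} [Finite ι] [AddCommGroup V] [Module ℂ V]
    {c : ι → V →ₗ[ℂ] ℂ} (hc : ∀ v w, (∀ i, c i v = c i w) → v = w) {T D : Module.End ℂ V}
    {α β : ι → ℂ} (hT : ∀ i v, c i (T v) = α i * c i v) (hD : ∀ i v, c i (D v) = β i * c i v)
    (hαβ : ∀ i j, α i = α j → β i = β j) {W : Submodule ℂ V} (hW : ∀ v ∈ W, T v ∈ W) {v : V}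
    (hv : v ∈ W) : D v ∈ W := by
  classical
  have := Fintype.ofFinite ι
  let P : ℂ[X] := Lagrange.interpolate (Finset.univ.image α) id (Function.extend α β 0)
  have hP : ∀ i, P.eval (α i) = β i := fun i => by
    have h1 := Lagrange.eval_interpolate_at_node (v := id) (Function.extend α β 0)
      (Set.injOn_id _)
      (Finset.mem_image_of_mem α (Finset.mem_univ i))
    have h2 : Function.FactorsThrough β α := fun i j h => hαβ i j h
    exact h1.trans (h2.extend_apply 0 i)
  have hDP : D v = aeval T P v := hc _ _ fun i => by
    rw [hD, apply_aeval_eq_eval_mul (hT i), hP]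
  have hpow : ∀ (m : ℕ) (w : V), w ∈ W → (T ^ m) w ∈ W := fun m => by
    induction m with
    | zero => exact fun w hw => hw
    | succ m ih =>
      intro w hw
      rw [pow_succ', Module.End.mul_apply]
      exact hW _ (ih w hw)
  rw [hDP, aeval_eq_sum_range, LinearMap.sum_apply]
  exact W.sum_mem fun m _ => W.smul_mem _ (hpow m v hv)

variable {n : ℕ}

/-- The matrix `Q diag(d) Q⁻¹`, diagonal in the basis given by the columns of `Q`, as a ring
homomorphism in `d`. -/
def diagConj (Q : GL (Fin n) ℂ) : (Fin n → ℂ) →+* CMat n where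
  toFun d := (Q : CMat n) * Matrix.diagonal d * ((Q⁻¹ : GL (Fin n) ℂ) : CMat n)
  map_one' := by simp
  map_mul' d e := by
    have : Matrix.diagonal (d * e) = Matrix.diagonal d * Matrix.diagonal e :=
      (Matrix.diagonal_mul_diagonal d e).symm
    rw [this]
    simp only [mul_assoc, Units.inv_mul_cancel_left]
  map_zero' := by simp
  map_add' d e := by
    have : Matrix.diagonal (d + e) = Matrix.diagonal d + Matrix.diagonal e :=
      (Matrix.diagonal_add d e).symm
    rw [this, mul_add, add_mul]

lemma diagConj_apply (Q : GL (Fin n) ℂ) (d : Fin n → ℂ) : diagConj Q d =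
    (Q : CMat n) * Matrix.diagonal d * ((Q⁻¹ : GL (Fin n) ℂ) : CMat n) := rfl

lemma det_diagConj (Q : GL (Fin n) ℂ) (d : Fin n → ℂ) : (diagConj Q d).det = ∏ i, d i := by
  rw [diagConj_apply, Matrix.det_units_conj, Matrix.det_diagonal]

/-- The matrix entries in the basis given by the columns of `Q`. -/
def conjEntry (Q : GL (Fin n) ℂ) (i j : Fin n) : CMat n →ₗ[ℂ] ℂ :=
  Matrix.entryLinearMap ℂ ℂ i j ∘ₗ LinearMap.mulRight ℂ (Q : CMat n) ∘ₗ
    LinearMap.mulLeft ℂ ((Q⁻¹ : GL (Fin n) ℂ) : CMat n)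

lemma conjEntry_apply (Q : GL (Fin n) ℂ) (i j : Fin n) (M : CMat n) :
    conjEntry Q i j M = (((Q⁻¹ : GL (Fin n) ℂ) : CMat n) * M * (Q : CMat n)) i j := rfl

lemma eq_of_conjEntry_eq (Q : GL (Fin n) ℂ) {M N : CMat n}
    (h : ∀ i j, conjEntry Q i j M = conjEntry Q i j N) : M = N := by
  have h1 : ((Q⁻¹ : GL (Fin n) ℂ) : CMat n) * M * (Q : CMat n) =
      ((Q⁻¹ : GL (Fin n) ℂ) : CMat n) * N * (Q : CMat n) := Matrix.ext h
  exact (Units.mul_right_inj _).1 ((Units.mul_left_inj _).1 h1)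

lemma conjEntry_diagConj_mul (Q : GL (Fin n) ℂ) (i j : Fin n) (d : Fin n → ℂ) (M : CMat n) :
    conjEntry Q i j (diagConj Q d * M) = d i * conjEntry Q i j M := by
  rw [conjEntry_apply, conjEntry_apply, diagConj_apply]
  have : ((Q⁻¹ : GL (Fin n) ℂ) : CMat n) * ((Q : CMat n) * Matrix.diagonal d *
      ((Q⁻¹ : GL (Fin n) ℂ) : CMat n) * M) * (Q : CMat n) =
      Matrix.diagonal d * (((Q⁻¹ : GL (Fin n) ℂ) : CMat n) * M * (Q : CMat n)) := by
    simp only [mul_assoc, Units.inv_mul_cancel_left]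
  rw [this, Matrix.diagonal_mul]

lemma conjEntry_mul_diagConj (Q : GL (Fin n) ℂ) (i j : Fin n) (d : Fin n → ℂ) (M : CMat n) :
    conjEntry Q i j (M * diagConj Q d) = conjEntry Q i j M * d j := by
  rw [conjEntry_apply, conjEntry_apply, diagConj_apply]
  have : ((Q⁻¹ : GL (Fin n) ℂ) : CMat n) * (M * ((Q : CMat n) * Matrix.diagonal d *
      ((Q⁻¹ : GL (Fin n) ℂ) : CMat n))) * (Q : CMat n) =
      (((Q⁻¹ : GL (Fin n) ℂ) : CMat n) * M * (Q : CMat n)) * Matrix.diagonal d := by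
    simp only [mul_assoc, Units.inv_mul, mul_one]
  rw [this, Matrix.mul_diagonal]

lemma commute_diagConj_iff (Q : GL (Fin n) ℂ) (d : Fin n → ℂ) (M : CMat n) :
    Commute (diagConj Q d) M ↔ ∀ i j, d i = d j ∨ conjEntry Q i j M = 0 := by
  have h1 : ∀ i j, conjEntry Q i j (diagConj Q d * M) = conjEntry Q i j (M * diagConj Q d) ↔
      (d i = d j ∨ conjEntry Q i j M = 0) := fun i j => by
    rw [conjEntry_diagConj_mul, conjEntry_mul_diagConj, mul_comm (conjEntry Q i j M),
      mul_eq_mul_right_iff]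
  exact ⟨fun h i j => (h1 i j).1 (congrArg _ h), fun h =>
    eq_of_conjEntry_eq Q fun i j => (h1 i j).2 (h i j)⟩

/-- A complex subspace of matrices preserved by the conjugation with a positive diagonalizable
matrix is preserved by the commutator with its logarithm. -/
lemma commutator_diagConj_log_mem (Q : GL (Fin n) ℂ) {a : Fin n → ℝ} (ha : ∀ i, 0 < a i)
    {W : Submodule ℂ (CMat n)}
    (hW : ∀ X ∈ W, diagConj Q (fun i => (a i : ℂ)) * X * diagConj Q (fun i => ((a i)⁻¹ : ℂ)) ∈ W)
    {X : CMat n} (hX : X ∈ W) :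
    diagConj Q (fun i => (Real.log (a i) : ℂ)) * X - X * diagConj Q (fun i => (Real.log (a i) : ℂ))
      ∈ W := by
  let T : Module.End ℂ (CMat n) := LinearMap.mulRight ℂ (diagConj Q (fun i => ((a i)⁻¹ : ℂ))) ∘ₗ
    LinearMap.mulLeft ℂ (diagConj Q (fun i => (a i : ℂ)))
  let D : Module.End ℂ (CMat n) :=
    LinearMap.mulLeft ℂ (diagConj Q (fun i => (Real.log (a i) : ℂ))) -
    LinearMap.mulRight ℂ (diagConj Q (fun i => (Real.log (a i) : ℂ)))
  refine apply_mem_of_simultaneously_diagonal (ι := Fin n × Fin n)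
    (c := fun p => conjEntry Q p.1 p.2) (T := T) (D := D)
    (α := fun p => ((a p.1 / a p.2 : ℝ) : ℂ)) (β := fun p => ((Real.log (a p.1 / a p.2) : ℝ) : ℂ))
    (fun v w h => eq_of_conjEntry_eq Q fun i j => h (i, j)) ?_ ?_ ?_ hW hX
  · rintro ⟨i, j⟩ v
    change conjEntry Q i j (diagConj Q _ * v * diagConj Q _) = _
    rw [conjEntry_mul_diagConj, conjEntry_diagConj_mul]
    push_cast
    ring
  · rintro ⟨i, j⟩ v
    change conjEntry Q i j (diagConj Q _ * v - v * diagConj Q _) = _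
    rw [map_sub, conjEntry_mul_diagConj, conjEntry_diagConj_mul,
      Real.log_div (ha i).ne' (ha j).ne']
    push_cast
    ring
  · rintro p q h
    have h' : a p.1 / a p.2 = a q.1 / a q.2 := Complex.ofReal_injective h
    simp only [h']

/-- The derivative of the determinant at the identity is the trace. -/
lemma hasDerivAt_det {U : ℝ → CMat n} {B : CMat n}
    (hU : ∀ i j, HasDerivAt (fun t => U t i j) (B i j) 0) (h0 : U 0 = 1) :
    HasDerivAt (fun t => (U t).det) B.trace 0 := by
  have h1 : HasDerivAt (fun t => ∑ σ : Equiv.Perm (Fin n), ((σ.sign : ℤ) : ℂ) *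
      ∏ i, U t (σ i) i) (∑ σ : Equiv.Perm (Fin n), ((σ.sign : ℤ) : ℂ) *
      ∑ i, (∏ j ∈ Finset.univ.erase i, U 0 (σ j) j) • B (σ i) i) 0 :=
    HasDerivAt.fun_sum fun σ _ => (HasDerivAt.fun_finsetProd fun i _ => hU (σ i) i).const_mul _
  have h2 : ∑ σ : Equiv.Perm (Fin n), ((σ.sign : ℤ) : ℂ) *
      ∑ i, (∏ j ∈ Finset.univ.erase i, U 0 (σ j) j) • B (σ i) i = B.trace := by
    rw [Finset.sum_eq_single (1 : Equiv.Perm (Fin n))]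
    · simp [h0, Matrix.trace]
    · intro σ _ hσ
      rw [Finset.sum_eq_zero, mul_zero]
      intro i _
      -- a nontrivial permutation moves a point other than `i`
      obtain ⟨j, hji, hj⟩ : ∃ j, j ≠ i ∧ σ j ≠ j := by
        by_contra! h
        refine hσ (Equiv.ext fun j => ?_)
        by_cases hj : j = i
        · by_contra h3
          have h4 : σ j ≠ i := hj ▸ h3
          exact h3 (σ.injective (h _ h4))
        · exact h j hj
      rw [Finset.prod_eq_zero (Finset.mem_erase.2 ⟨hji, Finset.mem_univ j⟩), zero_smul]
      rw [h0, Matrix.one_apply_ne hj]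
    · simp
  rw [h2] at h1
  exact h1.congr_of_eventuallyEq (Filter.Eventually.of_forall fun t => Matrix.det_apply' (U t))

/-- A one-parameter group of matrices with generator of trace zero has determinant one. -/
lemma det_eq_one_of_trace_eq_zero {U : ℝ → CMat n} {B : CMat n}
    (hU : ∀ i j, HasDerivAt (fun t => U t i j) (B i j) 0) (h0 : U 0 = 1)
    (hadd : ∀ s t, U (s + t) = U s * U t) (hB : B.trace = 0) (t : ℝ) : (U t).det = 1 := by
  have h1 := hasDerivAt_det hU h0
  rw [hB] at h1
  have h2 : ∀ t, HasDerivAt (fun t => (U t).det) 0 t := fun t => by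
    have h3 : HasDerivAt (fun s => (U t).det * (U (s - t)).det) ((U t).det * 0) t := by
      refine HasDerivAt.const_mul _ ?_
      have h4 : HasDerivAt (fun s => (U s).det) 0 (t - t) := by rwa [sub_self]
      exact h4.comp_sub_const t t
    rw [mul_zero] at h3
    refine h3.congr_of_eventuallyEq (Filter.Eventually.of_forall fun s => ?_)
    change (U s).det = (U t).det * (U (s - t)).det
    rw [← Matrix.det_mul, ← hadd, add_sub_cancel]
  have h5 := is_const_of_deriv_eq_zero (fun t => (h2 t).differentiableAt)
    (fun t => (h2 t).deriv) t 0
  rw [h5, h0, Matrix.det_one]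

end Diagonal

/-! ### Positive elements of the normalizer -/

section Stabilizer

open NormedSpace

variable {n : ℕ} {𝔤 : LieSubalgebra ℝ (CMat n)}

/-- A semisimple Lie algebra has no nonzero characters. -/
lemma eq_zero_of_forall_lie_apply_eq_zero [LieAlgebra.IsKilling ℝ 𝔤] (f : 𝔤 →ₗ[ℝ] ℝ)
    (hf : ∀ X Y : 𝔤, f ⁅X, Y⁆ = 0) : f = 0 := by
  obtain ⟨A, rfl⟩ := (LinearMap.BilinForm.toDual (killingForm ℝ 𝔤)
    (LieAlgebra.IsKilling.killingForm_nondegenerate ℝ 𝔤)).surjective f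
  have hA : A = 0 := eq_zero_of_forall_lie_eq_zero fun X =>
    eq_zero_of_killingForm_eq_zero fun Y => by
      rw [LieModule.traceForm_apply_lie_apply]
      exact hf X Y
  rw [hA, map_zero]

/-- If `P` commutes with `𝔤`, then `X ↦ tr (X P)` is a character of `𝔤`, so it vanishes. -/
lemma trace_mul_eq_zero_of_commute [LieAlgebra.IsKilling ℝ 𝔤] {P : CMat n}
    (hP : ∀ X : 𝔤, Commute P (X : CMat n)) {X : CMat n}
    (hX : X ∈ complexify (⊤ : Submodule ℝ 𝔤)) : (X * P).trace = 0 := by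
  let f : 𝔤 →ₗ[ℝ] ℂ := ((Matrix.traceLinearMap (Fin n) ℝ ℂ) ∘ₗ LinearMap.mulRight ℝ P) ∘ₗ
    𝔤.toSubmodule.subtype
  have hf : ∀ X Y : 𝔤, f ⁅X, Y⁆ = 0 := fun X Y => by
    change (((⁅X, Y⁆ : 𝔤) : CMat n) * P).trace = 0
    rw [coe_lie_eq, sub_mul, Matrix.trace_sub, sub_eq_zero, mul_assoc (Y : CMat n), ← (hP X).eq,
      ← mul_assoc, Matrix.trace_mul_comm, ← mul_assoc, Matrix.trace_mul_cycle]
  have hre := eq_zero_of_forall_lie_apply_eq_zero (Complex.reLm ∘ₗ f) fun X Y => by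
    rw [LinearMap.comp_apply, hf, map_zero]
  have him := eq_zero_of_forall_lie_apply_eq_zero (Complex.imLm ∘ₗ f) fun X Y => by
    rw [LinearMap.comp_apply, hf, map_zero]
  have hf0 : ∀ X : 𝔤, ((X : CMat n) * P).trace = 0 := fun X =>
    Complex.ext (LinearMap.congr_fun hre X) (LinearMap.congr_fun him X)
  obtain ⟨A, -, B, -, rfl⟩ := exists_of_mem_complexify hX
  rw [add_mul, smul_mul_assoc, Matrix.trace_add, Matrix.trace_smul, hf0, hf0, smul_zero, add_zero]

lemma commute_of_mem_complexify {P : CMat n} (hP : ∀ X : 𝔤, Commute P (X : CMat n)) {X : CMat n}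
    (hX : X ∈ complexify (⊤ : Submodule ℝ 𝔤)) : Commute P X := by
  obtain ⟨A, -, B, -, rfl⟩ := exists_of_mem_complexify hX
  exact (hP A).add_right ((hP B).smul_right _)

lemma smul_mem_complexify {W : Submodule ℝ 𝔤} (t : ℝ) {X : CMat n} (hX : X ∈ complexify W) :
    t • X ∈ complexify W := ((complexify W).restrictScalars ℝ).smul_mem t hX

section

attribute [local instance] Matrix.linftyOpNormedRing Matrix.linftyOpNormedAlgebra

lemma hasDerivAt_entry_expGL_smul_mul (X P : CMat n) (i j : Fin n) :
    HasDerivAt (fun t : ℝ => ((expGL (t • X) : CMat n) * P) i j) ((X * P) i j) 0 := by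
  let l : CMat n →ₗ[ℝ] ℂ := Matrix.entryLinearMap ℝ ℂ i j ∘ₗ LinearMap.mulRight ℝ P
  exact (LinearMap.toContinuousLinearMap l).hasFDerivAt.comp_hasDerivAt (0 : ℝ)
    (hasDerivAt_exp_smul_zero X)

end

/-- A projection `P` commuting with `𝔤` commutes with the group of `𝔤_ℂ`, and this group acts on the
image of `P` with determinant one; `1 - P + g P` is the extension of `g` by the identity on the
kernel of `P`. -/
lemma det_one_sub_add_mul_eq_one [LieAlgebra.IsKilling ℝ 𝔤] {P : CMat n} (hPP : P * P = P)
    (hP : ∀ X : 𝔤, Commute P (X : CMat n)) {g : GL (Fin n) ℂ}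
    (hg : g ∈ analyticSubgroup (complexify (⊤ : Submodule ℝ 𝔤) : Set (CMat n))) :
    Commute P (g : CMat n) ∧ (1 - P + g * P).det = 1 := by
  have hmul : ∀ g h : GL (Fin n) ℂ, Commute P (g : CMat n) → Commute P (h : CMat n) →
      1 - P + ((g * h : GL (Fin n) ℂ) : CMat n) * P = (1 - P + g * P) * (1 - P + h * P) := by
    intro g h hg hh
    have e1 : (g : CMat n) * P * (h * P) = g * h * P := by
      rw [mul_assoc, ← mul_assoc P, hh.eq, mul_assoc (h : CMat n), hPP, mul_assoc]
    have e2 : P * ((h : CMat n) * P) = h * P := by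
      rw [← mul_assoc, hh.eq, mul_assoc, hPP]
    have e3 : (g : CMat n) * P * P = g * P := by rw [mul_assoc, hPP]
    simp only [add_mul, mul_add, sub_mul, mul_sub, one_mul, mul_one, hPP, e1, e2, e3, Units.val_mul]
    abel
  induction hg using Subgroup.closure_induction with
  | mem g hg =>
    obtain ⟨X, hX, rfl⟩ := hg
    have hc : ∀ t : ℝ, Commute P (expGL (t • X) : CMat n) := fun t =>
      (commute_of_mem_complexify hP (smul_mem_complexify t hX)).exp_right
    refine ⟨by simpa using hc 1, ?_⟩
    have := det_eq_one_of_trace_eq_zero (U := fun t => 1 - P + (expGL (t • X) : CMat n) * P)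
      (B := X * P) (fun i j => (hasDerivAt_entry_expGL_smul_mul X P i j).const_add _)
      (by simp [expGL_zero])
      (fun s t => by rw [expGL_add_smul, hmul _ _ (hc s) (hc t)])
      (trace_mul_eq_zero_of_commute hP hX) 1
    simpa using this
  | one => exact ⟨Commute.one_right P, by simp⟩
  | mul g h _ _ hg hh =>
    refine ⟨hg.1.mul_right hh.1, ?_⟩
    rw [hmul g h hg.1 hh.1, Matrix.det_mul, hg.2, hh.2, mul_one]
  | inv g _ hg =>
    have h1 : Commute P ((g⁻¹ : GL (Fin n) ℂ) : CMat n) := hg.1.units_inv_right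
    refine ⟨h1, ?_⟩
    have h2 := congrArg Matrix.det (hmul g⁻¹ g h1 hg.1)
    rw [Matrix.det_mul, hg.2, mul_one, inv_mul_cancel, Units.val_one, one_mul, sub_add_cancel,
      Matrix.det_one] at h2
    exact h2.symm

variable [LieAlgebra.IsKilling ℝ 𝔤]
  {𝔥 : LieSubalgebra ℝ 𝔤} [𝔥.IsCartanSubalgebra] [LieModule.IsTriangularizable ℝ 𝔥 𝔤]
  (Δ : (LieAlgebra.IsKilling.rootSystem 𝔥).Base)
  {θ : 𝔤 ≃ₗ⁅ℝ⁆ 𝔤} (hθ : IsCartanInvolution θ)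
  {Gc : Subgroup (GL (Fin n) ℂ)}

omit [LieAlgebra.IsKilling ℝ 𝔤] in
lemma analyticSubgroup_complexify_top_le :
    analyticSubgroup (complexify (⊤ : Submodule ℝ 𝔤) : Set (CMat n)) ≤
      adNormalizer (complexify (⊤ : Submodule ℝ 𝔤) : Set (CMat n)) :=
  analyticSubgroup_le fun _ hX => expGL_mem_adNormalizer
    (W := (complexify (⊤ : Submodule ℝ 𝔤)).restrictScalars ℝ)
    fun _ hY => commutator_mem_complexify_top hX hY

include hθ in
/-- A positive diagonalizable element of the discrete group `borelNormalizer` is trivial: its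
logarithm centralizes `𝔤`, hence so do its eigenprojections, and the determinant of `𝔤_ℂ` on the
eigenspaces is trivial. -/
lemma eq_one_of_eq_diagConj (hr : ∀ X ∈ 𝔤, Complex.I • X ∈ 𝔤 → X = 0) {p : GL (Fin n) ℂ}
    (hpA : p ∈ analyticSubgroup (complexify (⊤ : Submodule ℝ 𝔤) : Set (CMat n)))
    (hpN : p ∈ borelNormalizer Δ Gc θ) (Q : GL (Fin n) ℂ) {a : Fin n → ℝ} (ha : ∀ i, 0 < a i)
    (hp : (p : CMat n) = diagConj Q fun i => (a i : ℂ)) : p = 1 := by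
  have hpinv : ((p⁻¹ : GL (Fin n) ℂ) : CMat n) = diagConj Q fun i => ((a i)⁻¹ : ℂ) := by
    refine Units.inv_eq_of_mul_eq_one_right ?_
    rw [hp, ← map_mul, ← map_one (diagConj Q)]
    congr 1
    ext i
    simp [(ha i).ne']
  have hW : ∀ W : Submodule ℝ 𝔤, p ∈ adNormalizer (complexify W : Set (CMat n)) →
      ∀ X ∈ complexify W, diagConj Q (fun i => (Real.log (a i) : ℂ)) * X -
        X * diagConj Q (fun i => (Real.log (a i) : ℂ)) ∈ complexify W := by
    intro W h X hX
    refine commutator_diagConj_log_mem Q ha (fun Y hY => ?_) hX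
    rw [← hp, ← hpinv]
    exact (h Y).1 hY
  have hcomm : ∀ X : 𝔤, Commute (diagConj Q fun i => (Real.log (a i) : ℂ)) (X : CMat n) := fun X =>
    sub_eq_zero.1 (commute_of_normalizes_complexify Δ hr hθ
      (hW _ (analyticSubgroup_complexify_top_le hpA)) (hW _ hpN.1.1.2) (hW _ hpN.1.2)
      (hW _ hpN.2) X)
  have ha1 : ∀ i, a i = 1 := by
    intro i₀
    -- the projection onto the eigenspace of the eigenvalue `a i₀`
    let e : Fin n → ℂ := fun i => if a i = a i₀ then 1 else 0
    have hP : ∀ X : 𝔤, Commute (diagConj Q e) (X : CMat n) := fun X => by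
      rw [commute_diagConj_iff]
      intro i j
      refine ((commute_diagConj_iff Q _ _).1 (hcomm X) i j).imp_left fun h => ?_
      have h' : a i = a j := Real.log_injOn_pos (ha i) (ha j) (Complex.ofReal_injective h)
      simp only [e, h']
    have hee : e * e = e := by
      ext i
      by_cases h : a i = a i₀ <;> simp [e, h]
    have h1 := (det_one_sub_add_mul_eq_one (P := diagConj Q e) (by rw [← map_mul, hee]) hP hpA).2
    rw [hp, ← map_mul, ← map_one (diagConj Q), ← map_sub, ← map_add, det_diagConj] at h1
    have h2 : ∀ i, ((1 : Fin n → ℂ) - e + (fun i => (a i : ℂ)) * e) i =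
        if a i = a i₀ then (a i₀ : ℂ) else 1 := fun i => by
      by_cases h : a i = a i₀ <;> simp [e, h]
    rw [Finset.prod_congr rfl fun i _ => h2 i, Finset.prod_ite, Finset.prod_const_one, mul_one,
      Finset.prod_const] at h1
    have h3 : a i₀ ^ (Finset.univ.filter fun i => a i = a i₀).card = 1 := by exact_mod_cast h1
    have h4 : (Finset.univ.filter fun i => a i = a i₀).card ≠ 0 :=
      Finset.card_ne_zero_of_mem (a := i₀) (by simp)
    exact (pow_eq_one_iff_of_nonneg (ha i₀).le h4).1 h3
  refine Units.ext ?_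
  rw [hp, Units.val_one, ← map_one (diagConj Q)]
  congr 1
  ext i
  simp [ha1]

end Stabilizer

/-! ### The adjoint for a Hermitian form -/

section UnitaryDual

open scoped ComplexOrder

variable {n : ℕ}

/-- The automorphism `g ↦ (g†)⁻¹`, with the adjoint `†` for the Hermitian form `⟨r v, r w⟩`. Its
fixed points are the matrices that preserve this form. -/
def unitaryDual (r : GL (Fin n) ℂ) : GL (Fin n) ℂ →* GL (Fin n) ℂ where
  toFun g := r⁻¹ * (star (r * g * r⁻¹))⁻¹ * r
  map_one' := by simp
  map_mul' g h := by
    simp only [star_mul, star_inv]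
    group

lemma unitaryDual_apply (r g : GL (Fin n) ℂ) :
    unitaryDual r g = r⁻¹ * (star (r * g * r⁻¹))⁻¹ * r := rfl

lemma expGL_star (X : CMat n) : expGL (star X) = star (expGL X) :=
  Units.ext (Matrix.exp_conjTranspose X)

lemma unitaryDual_expGL (r : GL (Fin n) ℂ) (X : CMat n) : unitaryDual r (expGL X) =
    expGL (((r⁻¹ : GL (Fin n) ℂ) : CMat n) *
      (-star ((r : CMat n) * X * ((r⁻¹ : GL (Fin n) ℂ) : CMat n))) * (r : CMat n)) := by
  have h := expGL_conj r⁻¹ (-star ((r : CMat n) * X * ((r⁻¹ : GL (Fin n) ℂ) : CMat n)))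
  rw [inv_inv] at h
  rw [h, expGL_neg, expGL_star, expGL_conj, unitaryDual_apply]

/-- The one-parameter groups of unitary matrices are generated by skew-Hermitian matrices. -/
lemma star_conj_eq_neg {r : GL (Fin n) ℂ} {X : CMat n}
    (h : ∀ t : ℝ, star (r * expGL (t • X) * r⁻¹) * (r * expGL (t • X) * r⁻¹) = 1) :
    star ((r : CMat n) * X * ((r⁻¹ : GL (Fin n) ℂ) : CMat n)) =
      -((r : CMat n) * X * ((r⁻¹ : GL (Fin n) ℂ) : CMat n)) := by
  refine eq_of_forall_expGL_smul_eq fun t => ?_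
  have h1 : t • ((r : CMat n) * X * ((r⁻¹ : GL (Fin n) ℂ) : CMat n)) =
      (r : CMat n) * (t • X) * ((r⁻¹ : GL (Fin n) ℂ) : CMat n) := by
    rw [mul_smul_comm, smul_mul_assoc]
  have h2 : t • star ((r : CMat n) * X * ((r⁻¹ : GL (Fin n) ℂ) : CMat n)) =
      star (t • ((r : CMat n) * X * ((r⁻¹ : GL (Fin n) ℂ) : CMat n))) := by
    rw [star_smul, star_trivial t]
  rw [h2, smul_neg, h1, expGL_star, expGL_neg, expGL_conj]
  exact eq_inv_of_mul_eq_one_left (h t)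

lemma unitaryDual_expGL_add_I_smul {r : GL (Fin n) ℂ} {X Y : CMat n}
    (hX : star ((r : CMat n) * X * ((r⁻¹ : GL (Fin n) ℂ) : CMat n)) =
      -((r : CMat n) * X * ((r⁻¹ : GL (Fin n) ℂ) : CMat n)))
    (hY : star ((r : CMat n) * Y * ((r⁻¹ : GL (Fin n) ℂ) : CMat n)) =
      -((r : CMat n) * Y * ((r⁻¹ : GL (Fin n) ℂ) : CMat n))) :
    unitaryDual r (expGL (X + Complex.I • Y)) = expGL (X - Complex.I • Y) := by
  rw [unitaryDual_expGL]
  congr 1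
  have h1 : star ((r : CMat n) * (X + Complex.I • Y) * ((r⁻¹ : GL (Fin n) ℂ) : CMat n)) =
      -((r : CMat n) * (X - Complex.I • Y) * ((r⁻¹ : GL (Fin n) ℂ) : CMat n)) := by
    rw [mul_add, add_mul, mul_smul_comm, smul_mul_assoc, star_add, star_smul, hX, hY,
      mul_sub, sub_mul, mul_smul_comm, smul_mul_assoc, Complex.star_def, Complex.conj_I]
    module
  rw [h1, neg_neg]
  simp only [mul_assoc, Units.inv_mul, mul_one, Units.inv_mul_cancel_left]

/-- A matrix `g` with `(g†)⁻¹ = g` preserves the Hermitian form. -/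
lemma star_mul_self_eq_one_of_unitaryDual_eq {r g : GL (Fin n) ℂ} (h : unitaryDual r g = g) :
    star (r * g * r⁻¹) * (r * g * r⁻¹) = 1 := by
  rw [unitaryDual_apply] at h
  have h1 : (star (r * g * r⁻¹))⁻¹ = r * g * r⁻¹ := by
    nth_rewrite 2 [← h]
    group
  nth_rewrite 2 [← h1]
  exact mul_inv_cancel _

lemma isCompact_setOf_conj_star_mul_self_eq_one (r : GL (Fin n) ℂ) :
    IsCompact {g : GL (Fin n) ℂ | star (r * g * r⁻¹) * (r * g * r⁻¹) = 1} := by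
  have h1 := isCompact_setOf_star_mul_self_eq_one (n := n) |>.image
    (f := fun g => r⁻¹ * g * r) (by fun_prop)
  convert h1 using 1
  ext g
  constructor
  · exact fun hg => ⟨r * g * r⁻¹, hg, by group⟩
  · rintro ⟨u, hu, rfl⟩
    have : r * (r⁻¹ * u * r) * r⁻¹ = u := by group
    change star (r * (r⁻¹ * u * r) * r⁻¹) * (r * (r⁻¹ * u * r) * r⁻¹) = 1
    rwa [this]

/-- The positive matrix `g† g` is diagonalizable with positive eigenvalues. -/
lemma exists_unitaryDual_inv_mul_eq_diagConj (r g : GL (Fin n) ℂ) :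
    ∃ (Q : GL (Fin n) ℂ) (a : Fin n → ℝ), (∀ i, 0 < a i) ∧
      (((unitaryDual r g)⁻¹ * g : GL (Fin n) ℂ) : CMat n) = diagConj Q fun i => (a i : ℂ) := by
  let u := r * g * r⁻¹
  have hpos : ((u : CMat n).conjTranspose * (u : CMat n)).PosDef :=
    Matrix.PosDef.conjTranspose_mul_self _ (Matrix.mulVec_injective_of_isUnit u.isUnit)
  let V := Unitary.toUnits hpos.isHermitian.eigenvectorUnitary
  refine ⟨r⁻¹ * V, hpos.isHermitian.eigenvalues, hpos.eigenvalues_pos, ?_⟩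
  have h1 : (unitaryDual r g)⁻¹ * g = r⁻¹ * (star u * u) * r := by
    rw [unitaryDual_apply]
    simp only [u]
    group
  have h2 : ((star u * u : GL (Fin n) ℂ) : CMat n) = (V : CMat n) *
      Matrix.diagonal (fun i => (hpos.isHermitian.eigenvalues i : ℂ)) *
      ((V⁻¹ : GL (Fin n) ℂ) : CMat n) := by
    have h3 := hpos.isHermitian.spectral_theorem
    rw [Unitary.conjStarAlgAut_apply] at h3
    exact h3
  rw [h1, diagConj_apply, Units.val_mul, Units.val_mul, h2, mul_inv_rev, inv_inv]
  push_cast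
  simp only [mul_assoc]

end UnitaryDual

/-! ### Finiteness of the stabilizer -/

section StabilizerFinite

open NormedSpace

variable {n : ℕ} {𝔤 : LieSubalgebra ℝ (CMat n)}

/-- The pairs `(Z, Z̄)` with `Z ∈ 𝔤_ℂ`, where the bar is the conjugation with respect to `𝔤`. -/
def conjPairs (𝔤 : LieSubalgebra ℝ (CMat n)) : Submodule ℝ (CMat n × CMat n) where
  carrier := {q | ∃ A B : 𝔤, q = ((A : CMat n) + Complex.I • (B : CMat n),
    (A : CMat n) - Complex.I • (B : CMat n))}
  zero_mem' := ⟨0, 0, Prod.ext (by simp) (by simp)⟩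
  add_mem' := by
    rintro _ _ ⟨A, B, rfl⟩ ⟨A', B', rfl⟩
    refine ⟨A + A', B + B', Prod.ext ?_ ?_⟩
    · change (A : CMat n) + Complex.I • (B : CMat n) + ((A' : CMat n) + Complex.I • (B' : CMat n)) =
        ((A + A' : 𝔤) : CMat n) + Complex.I • ((B + B' : 𝔤) : CMat n)
      push_cast
      module
    · change (A : CMat n) - Complex.I • (B : CMat n) + ((A' : CMat n) - Complex.I • (B' : CMat n)) =
        ((A + A' : 𝔤) : CMat n) - Complex.I • ((B + B' : 𝔤) : CMat n)
      push_cast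
      module
  smul_mem' := by
    rintro c _ ⟨A, B, rfl⟩
    refine ⟨c • A, c • B, Prod.ext ?_ ?_⟩
    · change c • ((A : CMat n) + Complex.I • (B : CMat n)) =
        ((c • A : 𝔤) : CMat n) + Complex.I • ((c • B : 𝔤) : CMat n)
      push_cast
      rw [smul_add, smul_comm c]
    · change c • ((A : CMat n) - Complex.I • (B : CMat n)) =
        ((c • A : 𝔤) : CMat n) - Complex.I • ((c • B : 𝔤) : CMat n)
      push_cast
      rw [smul_sub, smul_comm c]

section

attribute [local instance] Matrix.linftyOpNormedRing Matrix.linftyOpNormedAlgebra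

/-- For `Z ∈ 𝔤_ℂ`, conjugation by `exp Z` and by `exp Z̄` are compatible with the conjugation
of `𝔤_ℂ`. -/
lemma conj_expGL_mem_conjPairs (X Y : 𝔤) {q : CMat n × CMat n} (hq : q ∈ conjPairs 𝔤) :
    (exp ((X : CMat n) + Complex.I • (Y : CMat n)) * q.1 *
        exp (-((X : CMat n) + Complex.I • (Y : CMat n))),
      exp ((X : CMat n) - Complex.I • (Y : CMat n)) * q.2 *
        exp (-((X : CMat n) - Complex.I • (Y : CMat n)))) ∈ conjPairs 𝔤 := by
  refine conj_exp_prod_mem (W := conjPairs 𝔤) (conjPairs 𝔤).closed_of_finiteDimensional ?_ hq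
  · rintro _ ⟨A, B, rfl⟩
    refine ⟨⁅X, A⁆ - ⁅Y, B⁆, ⁅X, B⁆ + ⁅Y, A⁆, Prod.ext ?_ ?_⟩
    · change ((X : CMat n) + Complex.I • (Y : CMat n)) * ((A : CMat n) + Complex.I • (B : CMat n)) -
        ((A : CMat n) + Complex.I • (B : CMat n)) * ((X : CMat n) + Complex.I • (Y : CMat n)) =
        ((⁅X, A⁆ - ⁅Y, B⁆ : 𝔤) : CMat n) + Complex.I • ((⁅X, B⁆ + ⁅Y, A⁆ : 𝔤) : CMat n)
      simp only [AddSubgroupClass.coe_sub, AddMemClass.coe_add, coe_lie_eq,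
        mul_add, add_mul, mul_smul_comm, smul_mul_assoc, smul_add, smul_sub, smul_smul,
        Complex.I_mul_I]
      module
    · change ((X : CMat n) - Complex.I • (Y : CMat n)) * ((A : CMat n) - Complex.I • (B : CMat n)) -
        ((A : CMat n) - Complex.I • (B : CMat n)) * ((X : CMat n) - Complex.I • (Y : CMat n)) =
        ((⁅X, A⁆ - ⁅Y, B⁆ : 𝔤) : CMat n) - Complex.I • ((⁅X, B⁆ + ⁅Y, A⁆ : 𝔤) : CMat n)
      simp only [AddSubgroupClass.coe_sub, AddMemClass.coe_add, coe_lie_eq,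
        mul_sub, sub_mul, mul_smul_comm, smul_mul_assoc, smul_add, smul_sub, smul_smul,
        Complex.I_mul_I]
      module

end

variable {θ : 𝔤 ≃ₗ⁅ℝ⁆ 𝔤} {r : GL (Fin n) ℂ}

lemma unitaryDual_expGL_of_mem (hr : ∀ X ∈ fixedSubmodule θ,
      star ((r : CMat n) * X * ((r⁻¹ : GL (Fin n) ℂ) : CMat n)) =
        -((r : CMat n) * X * ((r⁻¹ : GL (Fin n) ℂ) : CMat n)))
    {Z : CMat n} (hZ : Z ∈ complexify (fixedSubmodule θ)) :
    ∃ X ∈ fixedSubmodule θ, ∃ Y ∈ fixedSubmodule θ,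
      Z = (X : CMat n) + Complex.I • (Y : CMat n) ∧
      unitaryDual r (expGL Z) = expGL ((X : CMat n) - Complex.I • (Y : CMat n)) := by
  obtain ⟨X, hX, Y, hY, rfl⟩ := exists_of_mem_complexify hZ
  exact ⟨X, hX, Y, hY, rfl, unitaryDual_expGL_add_I_smul (hr X hX) (hr Y hY)⟩

lemma unitaryDual_mem (hr : ∀ X ∈ fixedSubmodule θ,
      star ((r : CMat n) * X * ((r⁻¹ : GL (Fin n) ℂ) : CMat n)) =
        -((r : CMat n) * X * ((r⁻¹ : GL (Fin n) ℂ) : CMat n)))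
    {g : GL (Fin n) ℂ} (hg : g ∈ analyticSubgroup (complexify (fixedSubmodule θ) : Set (CMat n))) :
    unitaryDual r g ∈ analyticSubgroup (complexify (fixedSubmodule θ) : Set (CMat n)) := by
  have h : analyticSubgroup (complexify (fixedSubmodule θ) : Set (CMat n)) ≤
      (analyticSubgroup (complexify (fixedSubmodule θ) : Set (CMat n))).comap (unitaryDual r) := by
    refine analyticSubgroup_le fun Z hZ => ?_
    obtain ⟨X, hX, Y, hY, -, hXY⟩ := unitaryDual_expGL_of_mem hr hZ
    rw [Subgroup.mem_comap, hXY]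
    refine expGL_mem_analyticSubgroup (sub_mem (coe_mem_complexify hX) (Submodule.smul_mem _ _
      (coe_mem_complexify hY)))
  exact h hg

/-- On `K(ℂ)`, the automorphism `g ↦ (g†)⁻¹` is compatible with the conjugation of `𝔤_ℂ`. -/
lemma conj_unitaryDual_mem_conjPairs (hr : ∀ X ∈ fixedSubmodule θ,
      star ((r : CMat n) * X * ((r⁻¹ : GL (Fin n) ℂ) : CMat n)) =
        -((r : CMat n) * X * ((r⁻¹ : GL (Fin n) ℂ) : CMat n)))
    {g : GL (Fin n) ℂ} (hg : g ∈ analyticSubgroup (complexify (fixedSubmodule θ) : Set (CMat n)))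
    {q : CMat n × CMat n} (hq : q ∈ conjPairs 𝔤) :
    ((g : CMat n) * q.1 * ((g⁻¹ : GL (Fin n) ℂ) : CMat n),
      (unitaryDual r g : CMat n) * q.2 * (((unitaryDual r g)⁻¹ : GL (Fin n) ℂ) : CMat n)) ∈
      conjPairs 𝔤 := by
  let P : GL (Fin n) ℂ → Prop := fun g => ∀ q ∈ conjPairs 𝔤,
    ((g : CMat n) * q.1 * ((g⁻¹ : GL (Fin n) ℂ) : CMat n),
      (unitaryDual r g : CMat n) * q.2 * (((unitaryDual r g)⁻¹ : GL (Fin n) ℂ) : CMat n)) ∈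
      conjPairs 𝔤
  have hgen : ∀ Z ∈ complexify (fixedSubmodule θ), P (expGL Z) := by
    intro Z hZ q hq
    obtain ⟨X, hX, Y, hY, rfl, hXY⟩ := unitaryDual_expGL_of_mem hr hZ
    rw [hXY, coe_expGL_inv, coe_expGL_inv]
    exact conj_expGL_mem_conjPairs X Y hq
  suffices h : P g ∧ P g⁻¹ from h.1 q hq
  clear hq
  induction hg using Subgroup.closure_induction with
  | mem g hg =>
    obtain ⟨Z, hZ, rfl⟩ := hg
    refine ⟨hgen Z hZ, ?_⟩
    rw [← expGL_neg]
    exact hgen _ (neg_mem hZ)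
  | one =>
    rw [inv_one, and_self]
    intro q hq
    simpa using hq
  | mul g h _ _ hg hh =>
    have hmul : ∀ g h : GL (Fin n) ℂ, P g → P h → P (g * h) := by
      intro g h hg hh q hq
      have := hg _ (hh q hq)
      simpa only [map_mul, mul_inv_rev, Units.val_mul, mul_assoc] using this
    refine ⟨hmul g h hg.1 hh.1, ?_⟩
    rw [mul_inv_rev]
    exact hmul _ _ hh.2 hg.2
  | inv g _ hg =>
    rw [inv_inv]
    exact hg.symm

/-- If `s ∈ K(ℂ)` normalizes a complexified subspace, then so does `(s†)⁻¹`. -/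
lemma unitaryDual_mem_adNormalizer (hreal : ∀ X ∈ 𝔤, Complex.I • X ∈ 𝔤 → X = 0)
    (hr : ∀ X ∈ fixedSubmodule θ,
      star ((r : CMat n) * X * ((r⁻¹ : GL (Fin n) ℂ) : CMat n)) =
        -((r : CMat n) * X * ((r⁻¹ : GL (Fin n) ℂ) : CMat n)))
    {g : GL (Fin n) ℂ} (hg : g ∈ analyticSubgroup (complexify (fixedSubmodule θ) : Set (CMat n)))
    {W : Submodule ℝ 𝔤} (hW : g ∈ adNormalizer (complexify W : Set (CMat n))) :
    unitaryDual r g ∈ adNormalizer (complexify W : Set (CMat n)) := by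
  have key : ∀ g ∈ analyticSubgroup (complexify (fixedSubmodule θ) : Set (CMat n)),
      g ∈ adNormalizer (complexify W : Set (CMat n)) → ∀ Z ∈ complexify W,
      (unitaryDual r g : CMat n) * Z * (((unitaryDual r g)⁻¹ : GL (Fin n) ℂ) : CMat n) ∈
        complexify W := by
    intro g hg hW Z hZ
    obtain ⟨A, hA, B, hB, rfl⟩ := exists_of_mem_complexify hZ
    obtain ⟨A', B', h⟩ := conj_unitaryDual_mem_conjPairs hr hg (q := (_, _)) ⟨A, -B, rfl⟩
    have h1 : (g : CMat n) * ((A : CMat n) + Complex.I • ((-B : 𝔤) : CMat n)) *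
      ((g⁻¹ : GL (Fin n) ℂ) : CMat n) = (A' : CMat n) + Complex.I • (B' : CMat n) :=
      congrArg Prod.fst h
    have h2 : (unitaryDual r g : CMat n) * ((A : CMat n) - Complex.I • ((-B : 𝔤) : CMat n)) *
      (((unitaryDual r g)⁻¹ : GL (Fin n) ℂ) : CMat n) =
      (A' : CMat n) - Complex.I • (B' : CMat n) := congrArg Prod.snd h
    have h3 := (hW _).1 (add_I_smul_mem_complexify hA (W.neg_mem hB))
    rw [h1] at h3
    obtain ⟨hA', hB'⟩ := (add_I_smul_mem_complexify_iff hreal).1 h3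
    have h4 : (A : CMat n) + Complex.I • (B : CMat n) =
        (A : CMat n) - Complex.I • ((-B : 𝔤) : CMat n) := by
      push_cast
      module
    rw [h4, h2]
    exact sub_mem (coe_mem_complexify hA') (Submodule.smul_mem _ _ (coe_mem_complexify hB'))
  refine mem_adNormalizer_of_conj_mem (key g hg hW) fun Z hZ => ?_
  have := key g⁻¹ (inv_mem hg) (inv_mem hW) Z hZ
  rwa [map_inv, inv_inv] at this

lemma analyticSubgroup_fixed_le_adNormalizer {W : Submodule ℝ 𝔤}
    (hW : ∀ X ∈ fixedSubmodule θ, ∀ Y ∈ W, ⁅X, Y⁆ ∈ W) :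
    analyticSubgroup (complexify (fixedSubmodule θ) : Set (CMat n)) ≤
      adNormalizer (complexify W : Set (CMat n)) := by
  exact analyticSubgroup_le fun Z hZ => expGL_mem_adNormalizer
    (W := (complexify W).restrictScalars ℝ) fun V hV => commutator_mem_complexify hW hZ hV

lemma analyticSubgroup_fixed_le {Gc : Subgroup (GL (Fin n) ℂ)} (hGc : IsComplexGroupOf 𝔤 Gc) :
    analyticSubgroup (complexify (fixedSubmodule θ) : Set (CMat n)) ≤ Gc :=
  analyticSubgroup_le fun _ hZ => hGc.expGL_mem (Submodule.span_mono
    (Set.image_mono (Set.subset_univ _)) hZ)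

variable [LieAlgebra.IsKilling ℝ 𝔤]
  {𝔥 : LieSubalgebra ℝ 𝔤} [𝔥.IsCartanSubalgebra] [LieModule.IsTriangularizable ℝ 𝔥 𝔤]
  (Δ : (LieAlgebra.IsKilling.rootSystem 𝔥).Base) (hθ : IsCartanInvolution θ)
  {Gc : Subgroup (GL (Fin n) ℂ)} (hGc : IsComplexGroupOf 𝔤 Gc)

include hGc in
lemma mem_borelNormalizer {g : GL (Fin n) ℂ}
    (hg : g ∈ analyticSubgroup (complexify (fixedSubmodule θ) : Set (CMat n)))
    (hb : g ∈ adNormalizer (complexify (borelSubmodule Δ) : Set (CMat n))) :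
    g ∈ borelNormalizer Δ Gc θ := by
  refine ⟨⟨⟨?_, ?_⟩, ?_⟩, hb⟩
  · exact analyticSubgroup_fixed_le hGc hg
  · refine analyticSubgroup_fixed_le_adNormalizer (fun X hX Y hY => ?_) hg
    rw [mem_fixedSubmodule] at *
    rw [LieEquiv.map_lie, hX, hY]
  · refine analyticSubgroup_fixed_le_adNormalizer (fun X hX Y hY => ?_) hg
    rw [mem_fixedSubmodule] at hX
    rw [mem_antifixedSubmodule] at *
    rw [LieEquiv.map_lie, hX, hY, lie_neg]

include hGc hθ in
/-- The stabilizer of the base point in `K(ℂ)` is finite: it consists of elements of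
`borelNormalizer`, and these are unitary for a Hermitian form preserved by `K`, since for such an
element `s` the positive matrix `s† s` lies in `borelNormalizer` as well. -/
lemma finite_analyticSubgroup_inter_adNormalizer {K : Subgroup (GL (Fin n) ℂ)}
    (hK : IsCompact (K : Set (GL (Fin n) ℂ)))
    (hfix : ∀ X ∈ fixedSubmodule θ, expGL (X : CMat n) ∈ K) :
    {g : GL (Fin n) ℂ | g ∈ analyticSubgroup (complexify (fixedSubmodule θ) : Set (CMat n)) ∧
      g ∈ adNormalizer (complexify (borelSubmodule Δ) : Set (CMat n))}.Finite := by
  obtain ⟨r, hr⟩ := exists_conj_unitary hK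
  have hskew : ∀ X ∈ fixedSubmodule θ,
      star ((r : CMat n) * X * ((r⁻¹ : GL (Fin n) ℂ) : CMat n)) =
        -((r : CMat n) * X * ((r⁻¹ : GL (Fin n) ℂ) : CMat n)) := fun X hX =>
    star_conj_eq_neg fun t => hr _ (hfix (t • X) (Submodule.smul_mem _ _ hX))
  refine (finite_borelNormalizer_inter Δ hθ hGc
    (isCompact_setOf_conj_star_mul_self_eq_one r)).subset ?_
  rintro s ⟨hs, hsb⟩
  refine ⟨mem_borelNormalizer Δ hGc hs hsb, star_mul_self_eq_one_of_unitaryDual_eq ?_⟩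
  obtain ⟨Q, a, ha, hQ⟩ := exists_unitaryDual_inv_mul_eq_diagConj r s
  have hp := mul_mem (inv_mem (unitaryDual_mem hskew hs)) hs
  have hp1 : (unitaryDual r s)⁻¹ * s = 1 := by
    refine eq_one_of_eq_diagConj Δ hθ hGc.real_form ?_ (mem_borelNormalizer Δ hGc hp ?_) Q ha hQ
    · exact Subgroup.closure_mono (Set.image_mono (Submodule.span_mono
        (Set.image_mono (Set.subset_univ _)))) hp
    · exact mul_mem (inv_mem (unitaryDual_mem_adNormalizer hGc.real_form hskew hs hsb)) hsb
  exact inv_mul_eq_one.1 hp1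

end StabilizerFinite

/-! ### The open orbit -/

section OpenOrbit

open scoped Topology

/-- By homogeneity, openness of an orbit map can be checked at the identity. -/
lemma isOpenMap_orbitMap_of_nhds {Γ X : Type} [TopologicalSpace Γ] [Group Γ] [IsTopologicalGroup Γ]
    [TopologicalSpace X] [MulAction Γ X] [ContinuousSMul Γ X] {o : X}
    (h : ∀ U ∈ 𝓝 (1 : Γ), (fun g : Γ => g • o) '' U ∈ 𝓝 o) : IsOpenMap fun g : Γ => g • o := by
  refine IsOpenMap.of_nhds_le fun g => Filter.le_def.2 fun V hV => ?_
  have h1 : (fun a : Γ => g * a) ⁻¹' ((fun g : Γ => g • o) ⁻¹' V) ∈ 𝓝 (1 : Γ) := by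
    refine (continuous_const_mul g).continuousAt.preimage_mem_nhds ?_
    rwa [mul_one]
  have h2 := (Homeomorph.smul g).isOpenMap.image_mem_nhds (h _ h1)
  refine Filter.mem_of_superset h2 ?_
  rintro _ ⟨_, ⟨a, ha, rfl⟩, rfl⟩
  have ha' : (g * a) • o ∈ V := ha
  rwa [mul_smul] at ha'

variable {n : ℕ} {𝔤 : LieSubalgebra ℝ (CMat n)} {θ : 𝔤 ≃ₗ⁅ℝ⁆ 𝔤}
  {Gc : Subgroup (GL (Fin n) ℂ)} (hGc : IsComplexGroupOf 𝔤 Gc)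

include hGc

/-- The group `K(ℂ)` is a continuous image of the analytic subgroup of `𝔨_ℂ`, which is contained
in `G(ℂ)`. -/
lemma pathConnectedSpace_complexK : PathConnectedSpace (complexK θ Gc) := by
  have : PathConnectedSpace (analyticSubgroup (complexify (fixedSubmodule θ) : Set (CMat n))) :=
    pathConnectedSpace_analyticSubgroup fun t _ hX => smul_mem_complexify t hX
  let f : analyticSubgroup (complexify (fixedSubmodule θ) : Set (CMat n)) → complexK θ Gc :=
    fun g => ⟨⟨g, analyticSubgroup_fixed_le hGc g.2⟩, g.2⟩
  have hf : Continuous f := (continuous_subtype_val.subtype_mk _).subtype_mk _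
  exact Function.Surjective.pathConnectedSpace (f := f) (fun g => ⟨⟨g.1.1, g.2⟩, rfl⟩) hf

variable [LieAlgebra.IsKilling ℝ 𝔤]
  {𝔥 : LieSubalgebra ℝ 𝔤} [𝔥.IsCartanSubalgebra] [LieModule.IsTriangularizable ℝ 𝔥 𝔤]
  (Δ : (LieAlgebra.IsKilling.rootSystem 𝔥).Base) (hθ : IsCartanInvolution θ)

omit hGc in
lemma expGL_mem_adNormalizer_borel {Y : CMat n} (hY : Y ∈ complexify (borelSubmodule Δ)) :
    expGL Y ∈ adNormalizer (complexify (borelSubmodule Δ) : Set (CMat n)) := by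
  refine expGL_mem_adNormalizer (W := (complexify (borelSubmodule Δ)).restrictScalars ℝ)
    fun V hV => ?_
  exact commutator_mem_complexify (fun X hX Y hY => lie_mem_borelSubmodule_of_mem Δ hX hY) hY hV

include hθ in
/-- The orbit map of `K(ℂ)` at the base point is open, since `𝔤_ℂ = 𝔨_ℂ + 𝔟_ℂ`. -/
lemma image_smul_mem_nhds {U : Set (complexK θ Gc)} (hU : U ∈ 𝓝 1) :
    (fun g : complexK θ Gc => g • ((1 : Gc) : Gc ⧸ complexBorel 𝔥 Δ Gc)) '' U ∈
      𝓝 ((1 : Gc) : Gc ⧸ complexBorel 𝔥 Δ Gc) := by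
  obtain ⟨V, hV, hVU⟩ : ∃ V ∈ 𝓝 (1 : GL (Fin n) ℂ),
      (fun g : complexK θ Gc => ((g : Gc) : GL (Fin n) ℂ)) ⁻¹' V ⊆ U := by
    have hind : Topology.IsInducing fun g : complexK θ Gc => ((g : Gc) : GL (Fin n) ℂ) :=
      Topology.IsInducing.subtypeVal.comp Topology.IsInducing.subtypeVal
    rw [hind.nhds_eq_comap] at hU
    exact hU
  obtain ⟨W, hW⟩ := Submodule.exists_isCompl
    ((complexify (⊤ : Submodule ℝ 𝔤)).restrictScalars ℝ)
  have hsup : (complexify (fixedSubmodule θ)).restrictScalars ℝ ⊔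
      (complexify (borelSubmodule Δ)).restrictScalars ℝ ⊔ W = ⊤ := by
    rw [eq_top_iff, ← hW.sup_eq_top]
    refine sup_le_sup_right (fun Z hZ => ?_) W
    obtain ⟨A, -, B, -, rfl⟩ := exists_of_mem_complexify hZ
    obtain ⟨X, hX, b, hb, rfl⟩ := hθ.exists_fixed_add_borel Δ A
    obtain ⟨X', hX', b', hb', rfl⟩ := hθ.exists_fixed_add_borel Δ B
    refine Submodule.mem_sup.2 ⟨_, add_I_smul_mem_complexify (W := fixedSubmodule θ) hX hX', _,
      add_I_smul_mem_complexify hb hb', ?_⟩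
    push_cast
    module
  have hp : ∀ᶠ X in 𝓝 (0 : CMat n), expGL X ∈ V :=
    continuous_expGL.continuousAt.eventually (by rwa [expGL_zero])
  have key := eventually_exists_expGL_mul_expGL hGc.isClosed
    (V₁ := (complexify (fixedSubmodule θ)).restrictScalars ℝ)
    (V₂ := (complexify (borelSubmodule Δ)).restrictScalars ℝ) (W := W)
    (fun X hX => analyticSubgroup_fixed_le hGc (expGL_mem_analyticSubgroup hX))
    (fun X hX => hGc.expGL_mem (Submodule.span_mono (Set.image_mono (Set.subset_univ _)) hX))
    (fun Z hZ hZG => Submodule.disjoint_def.1 hW.disjoint Z (hGc.mem_complexify_top hZG) hZ)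
    hsup hp
  have h1 : {g : Gc | ∃ X ∈ complexify (fixedSubmodule θ), expGL X ∈ V ∧
      ∃ Y ∈ complexify (borelSubmodule Δ), (g : GL (Fin n) ℂ) = expGL X * expGL Y} ∈
      𝓝 (1 : Gc) := by
    have h2 : Filter.Tendsto (fun g : Gc => (g : GL (Fin n) ℂ)) (𝓝 1) (𝓝 1) :=
      continuous_subtype_val.tendsto _
    filter_upwards [h2.eventually key] with g hg
    exact hg g.2
  refine Filter.mem_of_superset ((QuotientGroup.isOpenMap_coe
    (N := complexBorel 𝔥 Δ Gc)).image_mem_nhds h1) ?_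
  rintro _ ⟨g, ⟨X, hX, hXV, Y, hY, hg⟩, rfl⟩
  have hXG := analyticSubgroup_fixed_le hGc (expGL_mem_analyticSubgroup hX)
  refine ⟨⟨⟨expGL X, hXG⟩, expGL_mem_analyticSubgroup hX⟩, hVU hXV, ?_⟩
  change ((⟨expGL X, hXG⟩ * 1 : Gc) : Gc ⧸ complexBorel 𝔥 Δ Gc) = g
  rw [mul_one, QuotientGroup.eq]
  have h3 : (((⟨expGL X, hXG⟩ : Gc)⁻¹ * g : Gc) : GL (Fin n) ℂ) = expGL Y := by
    rw [Subgroup.coe_mul, hg]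
    exact inv_mul_cancel_left _ _
  change (((⟨expGL X, hXG⟩ : Gc)⁻¹ * g : Gc) : GL (Fin n) ℂ) ∈ adNormalizer _
  rw [h3]
  exact expGL_mem_adNormalizer_borel Δ hY

include hθ in
lemma finite_stabilizer {K : Subgroup (GL (Fin n) ℂ)}
    (hK : IsCompact (K : Set (GL (Fin n) ℂ)))
    (hfix : ∀ X ∈ fixedSubmodule θ, expGL (X : CMat n) ∈ K) :
    Finite (MulAction.stabilizer (complexK θ Gc) ((1 : Gc) : Gc ⧸ complexBorel 𝔥 Δ Gc)) := by
  have hfin := finite_analyticSubgroup_inter_adNormalizer Δ hθ hGc hK hfix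
  have : Finite {g : GL (Fin n) ℂ |
      g ∈ analyticSubgroup (complexify (fixedSubmodule θ) : Set (CMat n)) ∧
      g ∈ adNormalizer (complexify (borelSubmodule Δ) : Set (CMat n))} := hfin
  have hmem : ∀ s : MulAction.stabilizer (complexK θ Gc) ((1 : Gc) : Gc ⧸ complexBorel 𝔥 Δ Gc),
      (((s : complexK θ Gc) : Gc) : GL (Fin n) ℂ) ∈ {g : GL (Fin n) ℂ |
        g ∈ analyticSubgroup (complexify (fixedSubmodule θ) : Set (CMat n)) ∧
        g ∈ adNormalizer (complexify (borelSubmodule Δ) : Set (CMat n))} := by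
    rintro ⟨s, hs⟩
    refine ⟨s.2, ?_⟩
    have h1 : (((s : Gc) * 1 : Gc) : Gc ⧸ complexBorel 𝔥 Δ Gc) = (1 : Gc) := hs
    rw [mul_one, eq_comm, QuotientGroup.eq, inv_one, one_mul] at h1
    exact h1
  refine Finite.of_injective (fun s => (⟨_, hmem s⟩ : {g : GL (Fin n) ℂ |
      g ∈ analyticSubgroup (complexify (fixedSubmodule θ) : Set (CMat n)) ∧
      g ∈ adNormalizer (complexify (borelSubmodule Δ) : Set (CMat n))})) fun s t h => ?_
  have h' : (((s : complexK θ Gc) : Gc) : GL (Fin n) ℂ) = ((t : complexK θ Gc) : Gc) := by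
    have h1 := congrArg Subtype.val h
    exact h1
  exact Subtype.ext (Subtype.ext (Subtype.ext h'))

include hθ in
/-- A dense orbit of `K(ℂ)` on the flag manifold is the orbit of the base point, and a nonconstant
equivariant local system of rank one on it has no cohomology. -/
lemma subsingleton_cohomology_of_dense_orbit {K : Subgroup (GL (Fin n) ℂ)}
    (hK : IsCompact (K : Set (GL (Fin n) ℂ)))
    (hfix : ∀ X ∈ fixedSubmodule θ, expGL (X : CMat n) ∈ K) {x : Gc ⧸ complexBorel 𝔥 Δ Gc}
    (hx : Dense (MulAction.orbit (complexK θ Gc) x))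
    {L : LocalSystem (MulAction.orbit (complexK θ Gc) x)}
    (hL : ∀ y, Module.finrank ℚ (L.fiber y) = 1) (E : L.EquivariantStructure (complexK θ Gc))
    (hne : ¬ Nonempty (L ≅ LocalSystem.trivial _)) (k : ℕ) : Subsingleton (L.Cohomology k) := by
  let o : Gc ⧸ complexBorel 𝔥 Δ Gc := ((1 : Gc) : Gc ⧸ complexBorel 𝔥 Δ Gc)
  have hnhds : ∀ U ∈ 𝓝 (1 : complexK θ Gc), (fun g : complexK θ Gc => g • o) '' U ∈ 𝓝 o :=
    fun U hU => image_smul_mem_nhds hGc Δ hθ hU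
  have ho : o ∈ MulAction.orbit (complexK θ Gc) x := by
    obtain ⟨_, hy, ⟨g, -, rfl⟩⟩ := hx.inter_nhds_nonempty (hnhds _ Filter.univ_mem)
    obtain ⟨h, hh⟩ := hy
    have hh' : h • x = g • o := hh
    exact ⟨g⁻¹ * h, (mul_smul _ _ _).trans (by rw [hh', inv_smul_smul])⟩
  have hopen := isOpenMap_orbitMap_of_nhds hnhds
  let o' : MulAction.orbit (complexK θ Gc) x := ⟨o, ho⟩
  have := pathConnectedSpace_complexK (θ := θ) hGc
  have hfin : Finite (MulAction.stabilizer (complexK θ Gc) o) := finite_stabilizer hGc Δ hθ hK hfix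
  have : Finite (MulAction.stabilizer (complexK θ Gc) o') := by
    have h : MulAction.stabilizer (complexK θ Gc) o' = MulAction.stabilizer (complexK θ Gc) o := by
      ext g
      exact Subtype.ext_iff
    rwa [h]
  refine E.subsingleton_cohomology (o := o') ?_ ?_ (hL o') hne k
  · intro U hU
    have h1 : (LocalSystem.EquivariantStructure.orbitMap (complexK θ Gc) o') '' U =
        Subtype.val ⁻¹' ((fun g : complexK θ Gc => g • o) '' U) := by
      ext y
      constructor
      · rintro ⟨g, hg, rfl⟩
        exact ⟨g, hg, rfl⟩
      · rintro ⟨g, hg, h⟩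
        exact ⟨g, hg, Subtype.ext h⟩
    rw [h1]
    exact (hopen U hU).preimage continuous_subtype_val
  · exact fun y => MulAction.exists_smul_eq _ o' y

end OpenOrbit

end

theorem mainTheorem7 (n : ℕ) (𝔤 : LieSubalgebra ℝ (CMat n)) [LieAlgebra.IsKilling ℝ 𝔤]
    (𝔥 : LieSubalgebra ℝ 𝔤) [𝔥.IsCartanSubalgebra] [LieModule.IsTriangularizable ℝ 𝔥 𝔤]
    (Δ : (LieAlgebra.IsKilling.rootSystem 𝔥).Base)
    (Gc : Subgroup (GL (Fin n) ℂ)) (hGc : IsComplexGroupOf 𝔤 Gc)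
    (θ : 𝔤 ≃ₗ⁅ℝ⁆ 𝔤) (hθ : IsCartanInvolution θ)
    (Θ : realGroup 𝔤 →* realGroup 𝔤) (hΘ : ∀ X : 𝔤, Θ (realExp X) = realExp (θ X))
    (K : Subgroup (GL (Fin n) ℂ)) (hK : IsMaximalCompactSubgroup K (realGroup 𝔤))
    (hKΘ : K = fixedGroup Θ) :
    Finite (torusPart 𝔥 Δ K) ∧
    (∀ k : ℕ, Function.Bijective (RationalCohomology.map (quotientMap (torusPart 𝔥 Δ K)) k)) ∧
    (∀ x : Gc ⧸ complexBorel 𝔥 Δ Gc,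
      IsOpen (MulAction.orbit (complexK θ Gc) x) → Dense (MulAction.orbit (complexK θ Gc) x) →
      ∀ L : LocalSystem (MulAction.orbit (complexK θ Gc) x),
        (∀ y, Module.finrank ℚ (L.fiber y) = 1) →
        Nonempty (L.EquivariantStructure (complexK θ Gc)) →
        ¬ Nonempty (L ≅ LocalSystem.trivial _) →
        ∀ k : ℕ, Subsingleton (L.Cohomology k)) := by
  have hcpt := hK.isCompact
  have hfix : ∀ X ∈ fixedSubmodule θ, expGL (X : CMat n) ∈ K := fun X hX =>
    hKΘ ▸ expGL_mem_fixedGroup hΘ hX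
  have hT := finite_torusPart Δ hGc hθ hΘ hcpt hKΘ
  have hpath : PathConnectedSpace K := by
    rw [hKΘ]
    exact pathConnectedSpace_fixedGroup hGc hθ hΘ
  refine ⟨hT, fun k => bijective_cohomology_quotientMap _ k, ?_⟩
  rintro x - hx L hL ⟨E⟩ hne k
  exact subsingleton_cohomology_of_dense_orbit hGc Δ hθ hcpt hfix hx hL E hne k
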